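/- **Setting.** Let $Z=(Z_t)_{t\in\mathbb R}$ be an $n$-dimensional measurable and integrable process with stationary increments on a probability space $(\Omega,\mathcal F,\mathbb P)$, each coordinate of which is a *regular integrator*: for $k=1,\dots,n$ there is a linear map $I_k:L^1(\mathbb R)\cap L^2(\mathbb R)\to L^1(\mathbb P)$, written $I_k(\varphi)=\int\varphi\,dZ^k$, such that (i) $I_k(\mathbf 1_{(a,b]})=Z^k_b-Z^k_a$ for all $a<b$, and (ii) for every finite Borel measure $\nu$ on $\mathbb R$ with $\int|r|\,\nu(dr)<\infty$ and every $t\in\mathbb R$, almost surely $I_k\big(\int f_r(t-\cdot)\,\nu(dr)\big)=\int I_k(f_r(t-\cdot))\,\nu(dr)$, where $f_r=\mathbf 1_{[0,\infty)}(\cdot-r)-\mathbf 1_{[0,\infty)}$. Let $0\le q<p$ be integers and let $$P(z)=I_nz^p+A_1z^{p-1}+\dots+A_p,\qquad Q(z)=I_nz^q+B_{q-1}z^{q-1}+\dots+B_0$$ have real $n\times n$ matrix coefficients, with $\det P(z)\ne0$ and $\det Q(z)\ne 0$ for all $z\in\mathbb C$ with $\operatorname{Re}z\ge0$. Let $X$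 be a measurable version of the $Z$-driven MCARMA$(p,q)$ process, that is, for each $t$ almost surely $X_t=\int_{\mathbb R}\tilde g(t-u)\,dZ_u$, where $\tilde g\in L^1\cap L^2$ is the function with $\int_{\mathbb R} e^{iyu}\tilde g(u)\,du=P(-iy)^{-1}Q(-iy)$ for all $y\in\mathbb R$. **Notation.** Let $A$ be the $np\times np$ block companion matrix of $P$ (blocks $I_n$ directly above the diagonal, last block row $(-A_p,\dots,-A_1)$, all other blocks zero), and let $E=(E_1^T,\dots,E_p^T)^T$, where $E(z)=E_1z^{p-1}+\dots+E_p$ is the polynomial such that $P(z)E(z)-Q(z)z^p$ has degree at most $p-1$. Let $R(z)=\sum_{k=0}^{p-q}C_kz^k$, $C_{p-q}=I_n$, be the polynomial such that $Q(z)R(z)-P(z)$ has degree at most $q-1$ (is zero if $q=0$). Let $B$ be the block companion matrix of $Q$ (last block row $(-B_0,\dots,-B_{q-1})$) and $F=(F_1^T,\dots,F_q^T)^T$, where $F(z)=F_1z^{q-1}+\dots+F_q$ is the polynomial such that $Q(z)F(z)-[Q(z)R(z)-P(z)]z^q$ has degree at most $q-1$. With $e^d_1$ the first canonical basis vector of $\mathbb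 R^d$, put for $t\in\mathbb R$ $$\tilde g(t)=\mathbf 1_{[0,\infty)}(t)\,(e_1^p\otimes I_n)^Te^{At}E,\qquad f(t)=\mathbf 1_{[0,\infty)}(t)\,(e_1^q\otimes I_n)^Te^{Bt}F\quad(f=0\text{ if }q=0),$$ $$\tilde g_j(t)=(e_1^p\otimes I_n)^Te^{At}\sum_{k=j}^{p-q}A^{k-j}EC_k,\qquad j=1,\dots,p-q$$ (this $\tilde g$ is the version used below). Fix $s<t$ and let $\hat Z_u=\mathbb E[Z_u-Z_s\mid Z_s-Z_r,\ r<s]$ for $u>s$. **Statement.** The derivatives $X^{(j)}$, $0\le j\le p-q-1$, exist: there are processes $X^{(j)}$ such that $X^{(0)}$ is a modification of $X$ and, for each $j<p-q-1$ and each time $r$, almost surely the path of $X^{(j)}$ is differentiable at $r$ with derivative $X^{(j+1)}_r$. The process $(\hat Z_u)_{u>s}$ has a measurable version, and the entries of $\tilde g$ have bounded variation on $\mathbb R$. For every such choice of derivatives and of a measurable version of $\hat Z$, almost surely $$\mathbb E[X_t\mid X_u,\,u\le s]=\sum_{j=1}^{p-q}\tilde g_j(t-s)X_s^{(j-1)}+\int_{-\infty}^s\Big(\int_s^t\tilde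 g(t-u)f(u-v)\,du\Big)X_v\,dv+\tilde g*\{\hat Z\mathbf 1_{(s,\infty)}\}(t),$$ where $\big(\tilde g*\{\hat Z\mathbf 1_{(s,\infty)}\}(t)\big)_j=\sum_{k=1}^n\int_{[0,t-s)}\hat Z^k_{t-v}\,\tilde g_{jk}(dv)$ is the convolution with the Lebesgue–Stieltjes measure of $\tilde g$, and almost surely $$\tilde g*\{\hat Z\mathbf 1_{(s,\infty)}\}(t)=\mathbf 1_{\{p=q+1\}}\hat Z_t+(e_1^p\otimes I_n)^TAe^{At}\int_s^te^{-Av}E\hat Z_v\,dv.$$ The integrals $\int_{-\infty}^s\cdots X_v\,dv$ and $\int_s^t e^{-Av}E\hat Z_v\,dv$ converge absolutely almost surely. -/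

import Mathlib

open MeasureTheory ProbabilityTheory Polynomial
open scoped Matrix Polynomial

noncomputable section

namespace MCARMA

/-! ### Matrix polynomials -/

/-- The value `∑ₖ zᵏ Mₖ` at `z ∈ ℂ` of a matrix polynomial `∑ₖ Mₖ zᵏ` with real coefficients. -/
def matEval {n : ℕ} (M : (Matrix (Fin n) (Fin n) ℝ)[X]) (z : ℂ) : Matrix (Fin n) (Fin n) ℂ :=
  M.sum fun k C => z ^ k • C.map (fun x : ℝ => (x : ℂ))

/-- Division by a monic matrix polynomial on the left: `N /ₘ M` is the unique polynomial `S` such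
that `M S - N` has smaller degree than `M`. -/
theorem eq_divByMonic_iff {R : Type*} [Ring R] [Nontrivial R] (M N S : R[X]) (hM : M.Monic) :
    S = N /ₘ M ↔ (M * S - N).degree < M.degree := by
  constructor
  · rintro rfl
    have h := modByMonic_add_div N M
    have h2 : M * (N /ₘ M) - N = -(N %ₘ M) := by
      rw [eq_comm, neg_eq_iff_eq_neg, neg_sub, eq_sub_iff_add_eq]; exact h
    rw [h2, degree_neg]
    exact degree_modByMonic_lt N hM
  · intro h
    have h2 := div_modByMonic_unique S (N - M * S) hM
      ⟨by abel, by rw [← degree_neg, neg_sub]; exact h⟩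
    exact h2.1.symm

/-- The block companion matrix of a monic matrix polynomial `M` of degree `d`: identity blocks above
the diagonal, and last block row `(-M₀, -M₁, …, -M_{d-1})`, where `Mⱼ` is the coefficient of `zʲ`. -/
def companion {n : ℕ} (d : ℕ) (M : (Matrix (Fin n) (Fin n) ℝ)[X]) :
    Matrix (Fin d × Fin n) (Fin d × Fin n) ℝ :=
  Matrix.of fun x y =>
    if (x.1 : ℕ) + 1 = d then -(M.coeff (y.1 : ℕ) x.2 y.2)
    else if (y.1 : ℕ) = (x.1 : ℕ) + 1 then (1 : Matrix (Fin n) (Fin n) ℝ) x.2 y.2 else 0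

/-- `(e₁ᵈ ⊗ Iₙ)ᵀ = (Iₙ, 0, …, 0)`. -/
def firstBlock (n d : ℕ) : Matrix (Fin n) (Fin d × Fin n) ℝ :=
  Matrix.of fun a y => if (y.1 : ℕ) = 0 then (1 : Matrix (Fin n) (Fin n) ℝ) a y.2 else 0

/-- The blocks `S₁, …, S_d`, stacked on top of each other, of the polynomial
`S(z) = S₁ z^{d-1} + ⋯ + S_d` for which `M(z) S(z) - N(z) z^d` has degree at most `d - 1`
(for `M` monic of degree `d` and `N` of degree at most `d - 1`). -/
def inputBlocks {n : ℕ} (d : ℕ) (M N : (Matrix (Fin n) (Fin n) ℝ)[X]) :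
    Matrix (Fin d × Fin n) (Fin n) ℝ :=
  Matrix.of fun x b => ((N * X ^ d) /ₘ M).coeff (d - 1 - (x.1 : ℕ)) x.2 b

/-- The kernel `1_{[0,∞)}(t) (e₁ᵈ ⊗ Iₙ)ᵀ e^{t 𝐌} 𝐒`, where `𝐌` is the block companion matrix of `M`
and `𝐒 = inputBlocks d M N`. It vanishes for `d = 0`. -/
def stateKernel {n : ℕ} (d : ℕ) (M N : (Matrix (Fin n) (Fin n) ℝ)[X]) (t : ℝ) :
    Matrix (Fin n) (Fin n) ℝ :=
  if 0 ≤ t then firstBlock n d * NormedSpace.exp (t • companion d M) * inputBlocks d M N else 0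

/-! ### The kernels of an MCARMA(p, q) process -/

section Kernels

variable {n : ℕ} (p q : ℕ) (P Q : (Matrix (Fin n) (Fin n) ℝ)[X])

/-- The matrix `A`. -/
def matA : Matrix (Fin p × Fin n) (Fin p × Fin n) ℝ := companion p P

/-- The matrix `E`, with blocks `E₁, …, E_p`. -/
def matE : Matrix (Fin p × Fin n) (Fin n) ℝ := inputBlocks p P Q

/-- The polynomial `R` for which `Q R - P` has degree at most `q - 1`. -/
def polyR : (Matrix (Fin n) (Fin n) ℝ)[X] := P /ₘ Q

/-- `g̃(t) = 1_{[0,∞)}(t) (e₁ᵖ ⊗ Iₙ)ᵀ e^{At} E`. -/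
def gTilde (t : ℝ) : Matrix (Fin n) (Fin n) ℝ := stateKernel p P Q t

/-- `f(t) = (e₁^q ⊗ Iₙ)ᵀ e^{Bt} F` for `t ≥ 0`, where `B` is the companion matrix of `Q` and
`F₁ z^{q-1} + ⋯ + F_q` is such that `Q(z) F(z) - [Q(z) R(z) - P(z)] z^q` has degree at most
`q - 1`; in particular `f = 0` if `q = 0`. -/
def fKernel (t : ℝ) : Matrix (Fin n) (Fin n) ℝ := stateKernel q Q (Q * polyR P Q - P) t

/-- `g̃ⱼ(t) = (e₁ᵖ ⊗ Iₙ)ᵀ e^{At} ∑_{k=j}^{p-q} A^{k-j} E C_k`, where `C_k` is the coefficient of `z^k`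
in `R`. -/
def gTildeJ (j : ℕ) (t : ℝ) : Matrix (Fin n) (Fin n) ℝ :=
  firstBlock n p * NormedSpace.exp (t • matA p P) *
    ∑ k ∈ Finset.Icc j (p - q), matA p P ^ (k - j) * matE p P Q * (polyR P Q).coeff k

/-- `∫_s^t g̃(t - u) f(u - v) du`, entrywise. -/
def pastKernel (s t v : ℝ) : Matrix (Fin n) (Fin n) ℝ :=
  Matrix.of fun a b => ∫ u in s..t, (gTilde p P Q (t - u) * fKernel q P Q (u - v)) a b

end Kernels

/-! ### The noise -/

section Noise

variable {Ω : Type*} [MeasurableSpace Ω] (μ : Measure Ω) {n : ℕ}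

/-- A measurable and integrable `n`-dimensional process with stationary increments, that is, the
finite-dimensional distributions of `(Z_{t+h} - Z_h)_t` do not depend on `h`. -/
structure IsNoise (Z : ℝ → Ω → (Fin n → ℝ)) : Prop where
  measurable : Measurable (Function.uncurry Z)
  integrable : ∀ t, Integrable (Z t) μ
  stationary_increments : ∀ h : ℝ,
    IdentDistrib (fun ω (t : ℝ) => Z (t + h) ω - Z h ω) (fun ω (t : ℝ) => Z t ω - Z 0 ω) μ μ

/-- The function belongs to `L¹ ∩ L²`. -/
def InL1L2 (f : ℝ → ℝ) : Prop := MemLp f 1 volume ∧ MemLp f 2 volume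

/-- `f_r = 1_{[0,∞)}(· - r) - 1_{[0,∞)}`. -/
def stepFun (r x : ℝ) : ℝ :=
  (Set.Ici (0 : ℝ)).indicator (fun _ => (1 : ℝ)) (x - r) -
    (Set.Ici (0 : ℝ)).indicator (fun _ => (1 : ℝ)) x

/-- `I` represents a linear map `L¹ ∩ L² → L¹(μ)`, making the real process `Y` a regular
integrator. In `fubini`, `J` is a jointly measurable version of `r ↦ I (f_r (t - ·))`. -/
structure IsRegularIntegrator (Y : ℝ → Ω → ℝ) (I : (ℝ → ℝ) → Ω → ℝ) : Prop where
  integrable : ∀ f, InL1L2 f → Integrable (I f) μ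
  congr : ∀ f g, InL1L2 f → f =ᵐ[volume] g → I f =ᵐ[μ] I g
  add : ∀ f g, InL1L2 f → InL1L2 g → I (fun u => f u + g u) =ᵐ[μ] fun ω => I f ω + I g ω
  smul : ∀ (c : ℝ) (f), InL1L2 f → I (fun u => c * f u) =ᵐ[μ] fun ω => c * I f ω
  indicator : ∀ s t, s < t →
    I ((Set.Ioc s t).indicator fun _ => 1) =ᵐ[μ] fun ω => Y t ω - Y s ω
  fubini : ∀ ν : Measure ℝ, IsFiniteMeasure ν → Integrable (fun r : ℝ => r) ν →
    ∀ (t : ℝ) (J : ℝ → Ω → ℝ), Measurable (Function.uncurry J) →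
      (∀ r, J r =ᵐ[μ] I (fun u => stepFun r (t - u))) →
      I (fun u => ∫ r, stepFun r (t - u) ∂ν) =ᵐ[μ] fun ω => ∫ r, J r ω ∂ν

/-- `X` is a measurable process with `X_t = ∫ g(t - u) dZ_u` almost surely for each `t`, where `I k`
is the integral with respect to the `k`-th coordinate of the noise, and `g ∈ L¹ ∩ L²` has Fourier
transform `∫ e^{iyu} g(u) du = P(-iy)⁻¹ Q(-iy)`. -/
def IsMCARMA (P Q : (Matrix (Fin n) (Fin n) ℝ)[X]) (I : Fin n → (ℝ → ℝ) → Ω → ℝ)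
    (X : ℝ → Ω → (Fin n → ℝ)) : Prop :=
  Measurable (Function.uncurry X) ∧
  ∃ g : ℝ → Matrix (Fin n) (Fin n) ℝ,
    (∀ j k, InL1L2 fun u => g u j k) ∧
    (∀ (y : ℝ) (j k), ∫ u : ℝ, Complex.exp (Complex.I * y * u) * (g u j k : ℂ) =
      ((matEval P (-(Complex.I * y)))⁻¹ * matEval Q (-(Complex.I * y))) j k) ∧
    ∀ t j, (fun ω => X t ω j) =ᵐ[μ] fun ω => ∑ k, I k (fun u => g (t - u) j k) ω

/-- `D 0, …, D (m-1)` are the derivatives of orders `0, …, m-1` of (a modification `D 0` of) the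
process `X`: at each time, almost every path of `D j` has the value of `D (j+1)` as its
derivative. This determines `D j t` almost surely. -/
def IsDerivFamily (m : ℕ) (X : ℝ → Ω → (Fin n → ℝ)) (D : ℕ → ℝ → Ω → (Fin n → ℝ)) : Prop :=
  (∀ t, D 0 t =ᵐ[μ] X t) ∧
  ∀ j, j + 1 < m → ∀ t, ∀ᵐ ω ∂μ, HasDerivAt (fun r => D j r ω) (D (j + 1) t ω) t

/-- `σ(X_u : u ≤ s)`. -/
abbrev pastSigma (X : ℝ → Ω → (Fin n → ℝ)) (s : ℝ) : MeasurableSpace Ω :=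
  ⨆ u : Set.Iic s, MeasurableSpace.comap (X u) inferInstance

/-- `σ(Z_s - Z_r : r < s)`. -/
abbrev pastIncrSigma (Z : ℝ → Ω → (Fin n → ℝ)) (s : ℝ) : MeasurableSpace Ω :=
  ⨆ r : Set.Iio s, MeasurableSpace.comap (fun ω => Z s ω - Z r ω) inferInstance

/-- `Zhat` is a measurable process with `Ẑ_u = E[Z_u - Z_s | Z_s - Z_r, r < s]` for each `u > s`. -/
def IsNoisePrediction (Z : ℝ → Ω → (Fin n → ℝ)) (s : ℝ) (Zhat : ℝ → Ω → (Fin n → ℝ)) : Prop :=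
  Measurable (Function.uncurry Zhat) ∧
  ∀ u, s < u → Zhat u =ᵐ[μ] μ[fun ω => Z u ω - Z s ω | pastIncrSigma Z s]

end Noise

/-! ### Convolution with a Lebesgue-Stieltjes measure -/

open scoped Classical in
/-- The Lebesgue-Stieltjes measure of a (right-continuous) function of bounded variation on `ℝ`. -/
def stieltjes (φ : ℝ → ℝ) : VectorMeasure ℝ ℝ :=
  if h : BoundedVariationOn φ Set.univ then h.vectorMeasure else 0

/-- `(g ∗ {z 1_{(s,∞)}})(t)`: its `j`-th entry is `∑_k ∫_{[0,t-s)} z^k_{t-v} g_{jk}(dv)`. -/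
def stieltjesConv {n : ℕ} (g : ℝ → Matrix (Fin n) (Fin n) ℝ) (z : ℝ → (Fin n → ℝ)) (s t : ℝ) :
    Fin n → ℝ :=
  fun j => ∑ k, ∫ᵛ v in Set.Ico 0 (t - s), z (t - v) k ∂•(stieltjes fun u => g u j k)

end MCARMA

end

noncomputable section

namespace MCARMA

/-! ### Companion matrices and Markov parameters -/

section Companion

variable {n : ℕ}

/-! The process is the output of a linear system, and the prediction formula is linear algebra along
paths followed by one conditional expectation.

State equation. The kernel `gTilde` is a superposition of step functions with density its derivative
on `(0, ∞)` (`stateKernel_eq_integral_stepFun`). The Fubini property of a regular integrator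
therefore turns the integral that defines `X` into an ordinary integral of increments of `Z` along a
path: almost surely `X_t = e₁ᵀ G_t` with `G = state`, which solves `dG = A G dt + E dZ`
(`IsMCARMA.ae_eq_statePath`). Here `e₁ᵀ` abbreviates `firstBlock`. Variation of constants expresses
`G_t` by `e^{A(t-s)} G_s` and the increments of `Z` after `s`. Conditioning on the past increments
of `Z` fixes `G_s` and replaces the later increments by `Zhat` (`condExp_output`). The terms with
`Zhat` form the Stieltjes convolution, because the measure of `gTilde` is an atom at `0` plus a
density (`stieltjesConv_gTilde`).

Inverse filter. It remains to read `e₁ᵀ e^{A(t-s)} G_s` off the past of `X`, and to see that the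
pasts of `X` and of the increments of `Z` agree up to null sets. Both rest on `(P⁻¹Q)⁻¹ = Q⁻¹P = R -
Q⁻¹(QR - P)`: the noise is recovered by differentiating `X` and by a stable filter driven by `X`.
The state of that filter is `∫_{-∞}^s e^{B(s-v)} F X_v dv`, and it equals `L G_s` for a constant
matrix `L = matL`, since `L A = B L + F e₁ᵀ` and `L E = 0` (`matL_mul_matA`, `matL_mul_matE`,
`integral_expm_mulVec_statePath`). A row matrix `Γ = matGamma` with `Γ E = 1`, for which `Γ G` is a
combination of derivatives of `X`, then recovers the increments of `Z` (`Tempered.sub_eq_state`), so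
the two σ-algebras agree (`IsNoise.condExp_pastSigma`).

The past term. The state splits as `1 = S + (1 - S)` with `S = matS`. The part `e₁ᵀ e^{A(t-s)} S
G_s` is the sum over the derivatives of `X`, and `e₁ᵀ e^{A(t-s)} (1 - S) = Θ L` with `Θ = matTheta`
(`matTheta_mul_matL`), which yields the integral over `X_v`. The matrix identities behind this come
from comparing coefficients of power series in `1/z`.

Analysis. The noise is only measurable, with integrable and stationary increments. A Steinhaus
argument bounds `E‖Z_r - Z_0‖` linearly in `r`, so almost every path is tempered and all integrals
converge. Stationarity also makes every fixed time almost surely a Lebesgue point of the path, which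
is what differentiability of the outputs at fixed times requires. -/

/-- The block row with an identity in position `k`. -/
def rowBlock (n d k : ℕ) : Matrix (Fin n) (Fin d × Fin n) ℝ :=
  Matrix.of fun a y => if (y.1 : ℕ) = k then (1 : Matrix (Fin n) (Fin n) ℝ) a y.2 else 0

theorem firstBlock_eq_rowBlock (n d : ℕ) : firstBlock n d = rowBlock n d 0 := rfl

theorem rowBlock_mul {κ : Type*} {d k : ℕ} (hk : k < d) (T : Matrix (Fin d × Fin n) κ ℝ) :
    rowBlock n d k * T = Matrix.of fun a y => T (⟨k, hk⟩, a) y := by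
  ext a y
  rw [Matrix.mul_apply, Fintype.sum_prod_type, Finset.sum_eq_single ⟨k, hk⟩]
  · simp [rowBlock, Matrix.one_apply]
  · intro i _ hi
    have : (i : ℕ) ≠ k := fun h => hi (Fin.ext h)
    simp [rowBlock, this]
  · simp

theorem rowBlock_mul_companion {d k : ℕ} (hk : k + 1 < d) (M : (Matrix (Fin n) (Fin n) ℝ)[X]) :
    rowBlock n d k * companion d M = rowBlock n d (k + 1) := by
  rw [rowBlock_mul (by omega)]
  ext a y
  simp [companion, rowBlock, hk.ne]

theorem rowBlock_last_mul_companion {d k : ℕ} (hk : k + 1 = d)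
    (M : (Matrix (Fin n) (Fin n) ℝ)[X]) :
    rowBlock n d k * companion d M = -∑ j ∈ Finset.range d, M.coeff j * rowBlock n d j := by
  rw [rowBlock_mul (by omega)]
  ext a y
  rw [Matrix.neg_apply, Matrix.sum_apply, Finset.sum_eq_single (y.1 : ℕ)]
  · simp [companion, rowBlock, hk, Matrix.mul_apply, Matrix.one_apply]
  · intro j _ hj
    simp [rowBlock, Matrix.mul_apply, hj.symm]
  · intro h
    exact absurd (Finset.mem_range.2 y.1.2) h

/-- The companion matrix shifts blocks upwards, so its powers bring each block to the front in turn.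
A state is thus determined by its first `d` outputs. -/
theorem firstBlock_mul_companion_pow {d k : ℕ} (hk : k < d) (M : (Matrix (Fin n) (Fin n) ℝ)[X]) :
    firstBlock n d * companion d M ^ k = rowBlock n d k := by
  induction k with
  | zero => simp [firstBlock_eq_rowBlock]
  | succ k ih =>
    rw [pow_succ, ← Matrix.mul_assoc, ih (by omega), rowBlock_mul_companion hk]

theorem firstBlock_zero (n : ℕ) : firstBlock n 0 = 0 := by
  ext a y; exact y.1.elim0

/-- The first block row of `M(companion M)` vanishes. -/
theorem sum_coeff_mul_firstBlock_mul_pow {d : ℕ} {M : (Matrix (Fin n) (Fin n) ℝ)[X]}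
    (hM : M.Monic) (hd : M.natDegree = d) :
    ∑ j ∈ Finset.range (d + 1), M.coeff j * (firstBlock n d * companion d M ^ j) = 0 := by
  rcases Nat.eq_zero_or_pos d with rfl | hpos
  · simp [firstBlock_zero]
  rw [Finset.sum_range_succ]
  have h1 : M.coeff d = 1 := by rw [← hd]; exact hM
  obtain ⟨e, rfl⟩ : ∃ e, d = e + 1 := ⟨d - 1, by omega⟩
  rw [h1, Matrix.one_mul, pow_succ, ← Matrix.mul_assoc, firstBlock_mul_companion_pow (by omega),
    rowBlock_last_mul_companion rfl, add_neg_eq_zero]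
  refine Finset.sum_congr rfl fun j hj => ?_
  rw [firstBlock_mul_companion_pow (Finset.mem_range.1 hj)]

/-- The Markov parameters `(Iₙ, 0, …, 0) 𝐌ᵏ 𝐒` of the state-space model of `M⁻¹ N`. -/
def markov (d : ℕ) (M N : (Matrix (Fin n) (Fin n) ℝ)[X]) (k : ℕ) : Matrix (Fin n) (Fin n) ℝ :=
  firstBlock n d * companion d M ^ k * inputBlocks d M N

/-- The generating function of the matrices `(Iₙ, 0, …, 0) 𝐌ᵏ T`. -/
def outputSeries (d : ℕ) (M : (Matrix (Fin n) (Fin n) ℝ)[X]) (T : Matrix (Fin d × Fin n) (Fin n) ℝ) :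
    PowerSeries (Matrix (Fin n) (Fin n) ℝ) :=
  PowerSeries.mk fun k => firstBlock n d * companion d M ^ k * T

/-- The generating function of the Markov parameters. -/
def markovSeries (d : ℕ) (M N : (Matrix (Fin n) (Fin n) ℝ)[X]) :
    PowerSeries (Matrix (Fin n) (Fin n) ℝ) :=
  outputSeries d M (inputBlocks d M N)

/-- The polynomial `w ^ d M(1 / w)` as a power series. -/
def revSeries (d : ℕ) (M : (Matrix (Fin n) (Fin n) ℝ)[X]) :
    PowerSeries (Matrix (Fin n) (Fin n) ℝ) :=
  ((reflect d M : (Matrix (Fin n) (Fin n) ℝ)[X]) : PowerSeries (Matrix (Fin n) (Fin n) ℝ))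

theorem coeff_revSeries (d : ℕ) (M : (Matrix (Fin n) (Fin n) ℝ)[X]) (k : ℕ) :
    PowerSeries.coeff k (revSeries d M) = M.coeff (revAt d k) := by
  rw [revSeries, Polynomial.coeff_coe, coeff_reflect]

theorem coeff_revSeries_of_le {d k : ℕ} (M : (Matrix (Fin n) (Fin n) ℝ)[X]) (hk : k ≤ d) :
    PowerSeries.coeff k (revSeries d M) = M.coeff (d - k) := by
  rw [coeff_revSeries, revAt_le hk]

theorem coeff_revSeries_of_lt {d k : ℕ} (M : (Matrix (Fin n) (Fin n) ℝ)[X]) (hk : d < k)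
    (hM : M.natDegree ≤ d) : PowerSeries.coeff k (revSeries d M) = 0 := by
  rw [coeff_revSeries, revAt_eq_self_of_lt hk, coeff_eq_zero_of_natDegree_lt (by omega)]

theorem revSeries_mul {d e : ℕ} (M N : (Matrix (Fin n) (Fin n) ℝ)[X]) (hM : M.natDegree ≤ d)
    (hN : N.natDegree ≤ e) : revSeries (d + e) (M * N) = revSeries d M * revSeries e N := by
  rw [revSeries, reflect_mul _ _ hM hN, Polynomial.coe_mul]; rfl

theorem natDegree_inputQuotient_lt {d : ℕ} (hd0 : 0 < d) {M N : (Matrix (Fin n) (Fin n) ℝ)[X]}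
    (hM : M.Monic) (hd : M.natDegree = d) (hN : N.degree < d) :
    ((N * X ^ d) /ₘ M).natDegree ≤ d - 1 := by
  rw [natDegree_divByMonic _ hM, hd]
  have h1 : (N * X ^ d).natDegree ≤ N.natDegree + d :=
    natDegree_mul_le.trans (Nat.add_le_add_left (natDegree_X_pow_le d) _)
  have h2 : N.natDegree < d := by
    rcases eq_or_ne N 0 with rfl | h0
    · simpa using hd0
    · exact (natDegree_lt_iff_degree_lt h0).2 hN
  omega

/-- For `r = d + e` the convolution sum is the vanishing row of `sum_coeff_mul_firstBlock_mul_pow`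
multiplied by `companion d M ^ e * T`: the outputs satisfy the recursion with coefficients `M`. -/
theorem coeff_revSeries_mul_outputSeries {d : ℕ} {M : (Matrix (Fin n) (Fin n) ℝ)[X]}
    (hM : M.Monic) (hd : M.natDegree = d) (T : Matrix (Fin d × Fin n) (Fin n) ℝ) {r : ℕ}
    (hr : d ≤ r) : PowerSeries.coeff r (revSeries d M * outputSeries d M T) = 0 := by
  rw [PowerSeries.coeff_mul, Finset.Nat.sum_antidiagonal_eq_sum_range_succ_mk]
  obtain ⟨e, rfl⟩ := Nat.exists_eq_add_of_le hr
  have hsub : Finset.range (d + 1) ⊆ Finset.range (d + e + 1) :=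
    Finset.range_subset_range.2 (by omega)
  rw [← Finset.sum_subset hsub]
  · have key := congrArg (fun S => S * (companion d M ^ e * T))
      (sum_coeff_mul_firstBlock_mul_pow hM hd)
    simp only [Matrix.zero_mul, Matrix.sum_mul] at key
    rw [← Finset.sum_range_reflect] at key
    rw [← key]
    refine Finset.sum_congr rfl fun i hi => ?_
    have hi' : i ≤ d := by simpa [Nat.lt_succ_iff] using hi
    rw [coeff_revSeries_of_le _ hi', outputSeries, PowerSeries.coeff_mk,
      show d + 1 - 1 - i = d - i by omega, show d + e - i = (d - i) + e by omega, pow_add]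
    simp only [Matrix.mul_assoc]
  · intro i _ hi
    rw [coeff_revSeries_of_lt _ (by simpa using hi) hd.le, zero_mul]

/-- `M(z) ∑ₖ Sₖ z^{-k-1} = N(z)` for the Markov parameters `Sₖ`. -/
theorem revSeries_mul_markovSeries {d : ℕ} {M N : (Matrix (Fin n) (Fin n) ℝ)[X]} (hM : M.Monic)
    (hd : M.natDegree = d) (hN : N.degree < d) (r : ℕ) :
    PowerSeries.coeff r (revSeries d M * markovSeries d M N) =
      if r < d then N.coeff (d - 1 - r) else 0 := by
  split_ifs with hr
  · have hd0 : 0 < d := by omega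
    set T := (N * X ^ d) /ₘ M with hT
    have hTd : T.natDegree ≤ d - 1 := natDegree_inputQuotient_lt hd0 hM hd hN
    -- The first `d` Markov parameters are the coefficients of the quotient in descending order, so
    -- up to degree `d - 1` the series may be replaced by the reversed quotient.
    have h1 : PowerSeries.coeff r (revSeries d M * markovSeries d M N) =
        PowerSeries.coeff r (revSeries d M * revSeries (d - 1) T) := by
      rw [PowerSeries.coeff_mul, PowerSeries.coeff_mul]
      refine Finset.sum_congr rfl fun x hx => ?_
      have hx2 : x.2 ≤ r := by have := Finset.HasAntidiagonal.mem_antidiagonal.1 hx; omega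
      rw [coeff_revSeries_of_le T (by omega : x.2 ≤ d - 1), markovSeries, outputSeries, PowerSeries.coeff_mk,
        firstBlock_mul_companion_pow (by omega : x.2 < d), rowBlock_mul (by omega)]
      rfl
    rw [h1, ← revSeries_mul _ _ hd.le hTd, coeff_revSeries_of_le _ (by omega)]
    have h2 := modByMonic_add_div (N * X ^ d) M
    have h3 : M * T = N * X ^ d - (N * X ^ d) %ₘ M := by rw [eq_sub_iff_add_eq']; exact h2
    rw [h3, coeff_sub, show d + (d - 1) - r = (d - 1 - r) + d by omega, coeff_mul_X_pow,
      coeff_eq_zero_of_degree_lt (p := _ %ₘ _), sub_zero]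
    have hn : Nontrivial (Matrix (Fin n) (Fin n) ℝ) := by
      by_contra h
      rw [not_nontrivial_iff_subsingleton] at h
      have := Polynomial.natDegree_of_subsingleton (p := M)
      omega
    refine (degree_modByMonic_lt (N * X ^ d) hM).trans_le ?_
    rw [degree_eq_natDegree hM.ne_zero, hd]
    exact_mod_cast Nat.le_add_left _ _
  · exact coeff_revSeries_mul_outputSeries hM hd _ (not_lt.1 hr)

end Companion

/-! ### Inversion of the transfer function -/

/-- With constant term `1`, multiplication by `a` is unitriangular on coefficients, so it keeps the
lowest term. The coefficients are matrices, hence all cancellation is done on the left in a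
noncommutative ring. -/
theorem _root_.PowerSeries.coeff_eq_of_mul_coeff_eq_zero {R : Type*} [Ring R] {a f : PowerSeries R}
    (ha : PowerSeries.coeff 0 a = 1) {k : ℕ} (h : ∀ j < k, PowerSeries.coeff j (a * f) = 0) :
    (∀ j < k, PowerSeries.coeff j f = 0) ∧
      PowerSeries.coeff k f = PowerSeries.coeff k (a * f) := by
  have key : ∀ m, (∀ j < m, PowerSeries.coeff j f = 0) →
      PowerSeries.coeff m (a * f) = PowerSeries.coeff m f := by
    intro m hm
    rw [PowerSeries.coeff_mul, Finset.sum_eq_single (0, m), ha, one_mul]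
    · rintro ⟨i, j⟩ hij hne
      have := Finset.HasAntidiagonal.mem_antidiagonal.1 hij
      have hj : j < m := by
        rcases Nat.eq_zero_or_pos i with rfl | hi
        · exact absurd (by simp_all) hne
        · simp only at this; omega
      rw [hm j hj, mul_zero]
    · intro h; exact absurd (Finset.HasAntidiagonal.mem_antidiagonal.2 (zero_add m)) h
  have h1 : ∀ j < k, PowerSeries.coeff j f = 0 := by
    intro j
    induction j using Nat.strong_induction_on with
    | _ j ih => intro hj; rw [← key j fun i hi => ih i hi (hi.trans hj)]; exact h j hj
  exact ⟨h1, (key k h1).symm⟩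

theorem _root_.PowerSeries.mul_left_cancel_of_coeff_zero {R : Type*} [Ring R]
    {a f g : PowerSeries R} (ha : PowerSeries.coeff 0 a = 1) (h : a * f = a * g) : f = g := by
  rw [← sub_eq_zero]
  ext k
  have h0 : a * (f - g) = 0 := by rw [mul_sub, h, sub_self]
  rw [(PowerSeries.coeff_eq_of_mul_coeff_eq_zero ha (k := k) (f := f - g) (by simp [h0])).2, h0]

section Inversion

variable {n p q : ℕ} {P Q : (Matrix (Fin n) (Fin n) ℝ)[X]}

/-- `Q R - P`. -/
def remPoly (P Q : (Matrix (Fin n) (Fin n) ℝ)[X]) : (Matrix (Fin n) (Fin n) ℝ)[X] :=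
  Q * polyR P Q - P

theorem mul_polyR : Q * polyR P Q = P + remPoly P Q := by rw [remPoly]; abel

/-- Over the zero ring every degree is `0`, so `q < p` already excludes `n = 0`. -/
theorem nontrivial_of_natDegree (hp : P.natDegree = p) (hqp : q < p) :
    Nontrivial (Matrix (Fin n) (Fin n) ℝ) := by
  by_contra h
  rw [not_nontrivial_iff_subsingleton] at h
  have := Polynomial.natDegree_of_subsingleton (p := P)
  omega

theorem degree_remPoly_lt [Nontrivial (Matrix (Fin n) (Fin n) ℝ)] (hQ : Q.Monic)
    (hq : Q.natDegree = q) : (remPoly P Q).degree < q := by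
  have h := modByMonic_add_div P Q
  have : remPoly P Q = -(P %ₘ Q) := by
    rw [remPoly, polyR, sub_eq_iff_eq_add, eq_neg_add_iff_add_eq]; exact h
  rw [this, degree_neg]
  refine (degree_modByMonic_lt P hQ).trans_le ?_
  rw [degree_eq_natDegree hQ.ne_zero, hq]

theorem natDegree_polyR (hp : P.natDegree = p) (hQ : Q.Monic) (hq : Q.natDegree = q) :
    (polyR P Q).natDegree = p - q := by
  rw [polyR, natDegree_divByMonic _ hQ, hp, hq]

theorem degree_Q_lt [Nontrivial (Matrix (Fin n) (Fin n) ℝ)] (hQ : Q.Monic)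
    (hq : Q.natDegree = q) (hqp : q < p) : Q.degree < p := by
  rw [degree_eq_natDegree hQ.ne_zero, hq]; exact_mod_cast hqp

theorem coeff_zero_revSeries {d : ℕ} {M : (Matrix (Fin n) (Fin n) ℝ)[X]} (hM : M.Monic)
    (hd : M.natDegree = d) : PowerSeries.coeff 0 (revSeries d M) = 1 := by
  rw [coeff_revSeries_of_le _ (Nat.zero_le d), Nat.sub_zero, ← hd]; exact hM

/-- This is `P · (P⁻¹Q) = Q` in the variable `w = 1/z`. The expansion of `P⁻¹Q` starts at `z⁻¹`, so
it is `w` times the Markov series; together with the factors `w⁻ᵖ` and `w^{-q}` this produces the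
exponent `p - q - 1`. -/
theorem revSeries_mul_markovSeries_transfer [Nontrivial (Matrix (Fin n) (Fin n) ℝ)] (hP : P.Monic)
    (hp : P.natDegree = p) (hQ : Q.Monic) (hq : Q.natDegree = q) (hqp : q < p) :
    revSeries p P * markovSeries p P Q = PowerSeries.X ^ (p - q - 1) * revSeries q Q := by
  ext1 r
  rw [revSeries_mul_markovSeries hP hp (degree_Q_lt hQ hq hqp), PowerSeries.coeff_X_pow_mul']
  split_ifs with h1 h2 h2
  · rw [coeff_revSeries_of_le _ (by omega)]; congr 1; omega
  · exact coeff_eq_zero_of_natDegree_lt (by omega)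
  · rw [coeff_revSeries_of_lt _ (by omega) hq.le]
  · rfl

/-- The identity `QR = P + (QR - P)` times `wᵖ`, with the remainder written as `Q` times the
expansion of `Q⁻¹(QR - P)`, which is `w` times its Markov series. -/
theorem revSeries_mul_revSeries_polyR [Nontrivial (Matrix (Fin n) (Fin n) ℝ)]
    (hp : P.natDegree = p) (hQ : Q.Monic) (hq : Q.natDegree = q) (hqp : q < p) :
    revSeries q Q * revSeries (p - q) (polyR P Q) = revSeries p P +
      PowerSeries.X ^ (p - q + 1) * (revSeries q Q * markovSeries q Q (remPoly P Q)) := by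
  rw [← revSeries_mul _ _ hq.le (natDegree_polyR hp hQ hq).le, Nat.add_sub_cancel' hqp.le,
    mul_polyR]
  have hN := degree_remPoly_lt (P := P) hQ hq
  ext1 r
  rw [map_add, PowerSeries.coeff_X_pow_mul', coeff_revSeries, coeff_revSeries, coeff_add]
  congr 1
  have hdeg : ∀ k, q ≤ k → (remPoly P Q).coeff k = 0 := fun k hk =>
    coeff_eq_zero_of_degree_lt (hN.trans_le (by exact_mod_cast hk))
  split_ifs with h
  · rw [revSeries_mul_markovSeries hQ hq hN]
    split_ifs with h2
    · rw [revAt_le (by omega)]; congr 1; omega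
    · rcases le_or_gt r p with h3 | h3
      · omega
      · rw [revAt_eq_self_of_lt h3]; exact hdeg _ (by omega)
  · rw [revAt_le (by omega)]; exact hdeg _ (by omega)

theorem coeff_polyR_top [Nontrivial (Matrix (Fin n) (Fin n) ℝ)] (hP : P.Monic)
    (hp : P.natDegree = p) (hQ : Q.Monic) (hq : Q.natDegree = q) (hqp : q < p) :
    (polyR P Q).coeff (p - q) = 1 := by
  have h := congrArg (PowerSeries.coeff 0) (revSeries_mul_revSeries_polyR hp hQ hq hqp)
  rw [map_add, PowerSeries.coeff_X_pow_mul', if_neg (by omega), add_zero,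
    coeff_zero_revSeries hP hp, PowerSeries.coeff_mul] at h
  simpa [coeff_zero_revSeries hQ hq, coeff_revSeries_of_le] using h

/-- `(R - Q⁻¹ (Q R - P)) P⁻¹ = Q⁻¹`, in terms of generating functions. -/
theorem revSeries_mul_inverse_series [Nontrivial (Matrix (Fin n) (Fin n) ℝ)]
    (hp : P.natDegree = p) (hQ : Q.Monic) (hq : Q.natDegree = q) (hqp : q < p) :
    revSeries q Q * (revSeries (p - q) (polyR P Q) -
      PowerSeries.X ^ (p - q + 1) * markovSeries q Q (remPoly P Q)) = revSeries p P := by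
  rw [mul_sub, revSeries_mul_revSeries_polyR hp hQ hq hqp, ← mul_assoc (revSeries q Q),
    ← PowerSeries.X_pow_mul, mul_assoc, add_sub_cancel_right]

/-- The inverse filter undoes the transfer function: after multiplication by `Q` from the left both
sides become `P · P⁻¹Q`, and `Q` cancels. -/
theorem inverse_series_mul_markovSeries [Nontrivial (Matrix (Fin n) (Fin n) ℝ)] (hP : P.Monic)
    (hp : P.natDegree = p) (hQ : Q.Monic) (hq : Q.natDegree = q) (hqp : q < p) :
    (revSeries (p - q) (polyR P Q) -
      PowerSeries.X ^ (p - q + 1) * markovSeries q Q (remPoly P Q)) * markovSeries p P Q =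
      PowerSeries.X ^ (p - q - 1) := by
  refine PowerSeries.mul_left_cancel_of_coeff_zero (coeff_zero_revSeries hQ hq) ?_
  rw [← mul_assoc, revSeries_mul_inverse_series hp hQ hq hqp,
    revSeries_mul_markovSeries_transfer hP hp hQ hq hqp, PowerSeries.X_pow_mul]

/-- As `P` and `Q` are monic, `P⁻¹Q` behaves like `z^{-(p-q)}` at infinity. This relative degree is
what makes the output `p - q - 1` times differentiable. -/
theorem markov_of_lt [Nontrivial (Matrix (Fin n) (Fin n) ℝ)] (hP : P.Monic)
    (hp : P.natDegree = p) (hQ : Q.Monic) (hq : Q.natDegree = q) (hqp : q < p) {k : ℕ}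
    (hk : k < p - q - 1) : markov p P Q k = 0 := by
  have h := (PowerSeries.coeff_eq_of_mul_coeff_eq_zero (f := markovSeries p P Q)
    (coeff_zero_revSeries hP hp) (k := p - q - 1) (fun j hj => by
      rw [revSeries_mul_markovSeries_transfer hP hp hQ hq hqp, PowerSeries.coeff_X_pow_mul',
        if_neg (by omega)])).1 k hk
  simpa [markovSeries, outputSeries, markov] using h

theorem markov_top [Nontrivial (Matrix (Fin n) (Fin n) ℝ)] (hP : P.Monic)
    (hp : P.natDegree = p) (hQ : Q.Monic) (hq : Q.natDegree = q) (hqp : q < p) :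
    markov p P Q (p - q - 1) = 1 := by
  have h := (PowerSeries.coeff_eq_of_mul_coeff_eq_zero (f := markovSeries p P Q)
    (coeff_zero_revSeries hP hp) (k := p - q - 1) (fun j hj => by
      rw [revSeries_mul_markovSeries_transfer hP hp hQ hq hqp, PowerSeries.coeff_X_pow_mul',
        if_neg (by omega)])).2
  rw [revSeries_mul_markovSeries_transfer hP hp hQ hq hqp, PowerSeries.coeff_X_pow_mul',
    if_pos le_rfl, Nat.sub_self, coeff_zero_revSeries hQ hq] at h
  simpa [markovSeries, outputSeries, markov] using h

/-- The coefficients of `z⁻ʲ`, `1 ≤ j ≤ p - q`, in `P⁻¹ Q R` vanish. -/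
theorem sum_markov_mul_coeff_polyR [Nontrivial (Matrix (Fin n) (Fin n) ℝ)] (hP : P.Monic)
    (hp : P.natDegree = p) (hQ : Q.Monic) (hq : Q.natDegree = q) (hqp : q < p) {i : ℕ}
    (hi : i < p - q) :
    ∑ k ∈ Finset.range (p - q + 1), markov p P Q (k + i) * (polyR P Q).coeff k = 0 := by
  set m := markovSeries p P Q with hm
  set R := revSeries (p - q) (polyR P Q) with hR
  -- Since `P⁻¹QR = 1 + P⁻¹(QR - P)` and the last term has order `w^{p-q+1}`, the series `m * R`
  -- differs from `w^{p-q-1}` only from order `2(p-q)` on.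
  have h1 : revSeries p P * (m * R - PowerSeries.X ^ (p - q - 1)) =
      PowerSeries.X ^ (2 * (p - q)) * (revSeries q Q * markovSeries q Q (remPoly P Q)) := by
    rw [mul_sub, ← mul_assoc, hm, revSeries_mul_markovSeries_transfer hP hp hQ hq hqp, mul_assoc,
      revSeries_mul_revSeries_polyR hp hQ hq hqp, mul_add, PowerSeries.X_pow_mul,
      add_sub_cancel_left, ← mul_assoc, ← pow_add]
    congr 2; omega
  have h2 := (PowerSeries.coeff_eq_of_mul_coeff_eq_zero (coeff_zero_revSeries hP hp)
    (f := m * R - PowerSeries.X ^ (p - q - 1)) (k := 2 * (p - q)) (fun j hj => by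
      rw [h1, PowerSeries.coeff_X_pow_mul', if_neg (by omega)])).1 (p - q + i) (by omega)
  rw [map_sub, PowerSeries.coeff_X_pow, if_neg (by omega), sub_zero, PowerSeries.coeff_mul,
    Finset.Nat.sum_antidiagonal_eq_sum_range_succ_mk, ← Finset.sum_range_reflect] at h2
  have hsub : Finset.range (p - q + 1) ⊆ Finset.range (p - q + i + 1) :=
    Finset.range_subset_range.2 (by omega)
  rw [← Finset.sum_subset hsub, ← Finset.sum_range_reflect] at h2
  · rw [← h2]
    refine Finset.sum_congr rfl fun k hk => ?_
    have hk' : k ≤ p - q := by simpa [Nat.lt_succ_iff] using hk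
    rw [hm, hR, coeff_revSeries_of_le _ (by omega), markovSeries, outputSeries,
      PowerSeries.coeff_mk, ← markov]
    congr 2 <;> omega
  · intro k hk hk2
    simp only [Finset.mem_range] at hk hk2
    rw [hR, coeff_revSeries_of_lt _ (by omega) (natDegree_polyR hp hQ hq).le, mul_zero]

/-- The rows of the matrix which expresses the state of the inverse filter by the state of the
MCARMA process. -/
def obsRow (p q : ℕ) (P Q : (Matrix (Fin n) (Fin n) ℝ)[X]) (i : ℕ) :
    Matrix (Fin n) (Fin p × Fin n) ℝ :=
  ∑ k ∈ Finset.range (p - q + 1), (polyR P Q).coeff k * (firstBlock n p * matA p P ^ (k + i)) -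
    ∑ b ∈ Finset.range i, markov q Q (remPoly P Q) (i - 1 - b) * (firstBlock n p * matA p P ^ b)

/-- Multiplication by `A` shifts both sums by one; only the term `b = 0` of the second sum is new.
This recursion becomes the block-shift part of `matL_mul_matA`. -/
theorem obsRow_succ (i : ℕ) : obsRow p q P Q (i + 1) =
    obsRow p q P Q i * matA p P - markov q Q (remPoly P Q) i * firstBlock n p := by
  rw [obsRow, obsRow, Finset.sum_range_succ' _ i, Matrix.sub_mul, Matrix.sum_mul, Matrix.sum_mul,
    sub_sub]
  congr 1
  · exact Finset.sum_congr rfl fun k _ => by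
      rw [← add_assoc, pow_succ]; simp only [Matrix.mul_assoc]
  · congr 1
    · refine Finset.sum_congr rfl fun k _ => ?_
      rw [pow_succ, show i + 1 - 1 - (k + 1) = i - 1 - k by omega]; simp only [Matrix.mul_assoc]
    · simp

/-- With an arbitrary input matrix `T` in place of `E`, identities between power series yield
identities for the rows `obsRow` themselves. -/
theorem coeff_inverse_series_mul_outputSeries (hp : P.natDegree = p) (hQ : Q.Monic)
    (hq : Q.natDegree = q)
    (T : Matrix (Fin p × Fin n) (Fin n) ℝ) (i : ℕ) :
    PowerSeries.coeff (p - q + i) ((revSeries (p - q) (polyR P Q) -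
      PowerSeries.X ^ (p - q + 1) * markovSeries q Q (remPoly P Q)) * outputSeries p P T) =
      obsRow p q P Q i * T := by
  rw [sub_mul, map_sub, obsRow, Matrix.sub_mul, Matrix.sum_mul, Matrix.sum_mul]
  congr 1
  · rw [PowerSeries.coeff_mul, Finset.Nat.sum_antidiagonal_eq_sum_range_succ_mk]
    have hsub : Finset.range (p - q + 1) ⊆ Finset.range (p - q + i + 1) :=
      Finset.range_subset_range.2 (by omega)
    rw [← Finset.sum_subset hsub, ← Finset.sum_range_reflect]
    · refine Finset.sum_congr rfl fun k hk => ?_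
      have hk' : k ≤ p - q := by simpa [Nat.lt_succ_iff] using hk
      rw [coeff_revSeries_of_le _ (by omega), outputSeries, PowerSeries.coeff_mk,
        show p - q - (p - q + 1 - 1 - k) = k by omega,
        show p - q + i - (p - q + 1 - 1 - k) = k + i by omega, matA]
      simp only [Matrix.mul_assoc]
    · intro k hk hk2
      simp only [Finset.mem_range] at hk hk2
      rw [coeff_revSeries_of_lt _ (by omega) (natDegree_polyR hp hQ hq).le, zero_mul]
  · rw [mul_assoc, PowerSeries.coeff_X_pow_mul']
    rcases i with _ | i
    · rw [if_neg (by omega)]; simp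
    · rw [if_pos (by omega), show p - q + (i + 1) - (p - q + 1) = i by omega,
        PowerSeries.coeff_mul, Finset.Nat.sum_antidiagonal_eq_sum_range_succ_mk,
        ← Finset.sum_range_reflect]
      refine Finset.sum_congr rfl fun k hk => ?_
      have hk' : k ≤ i := by simpa [Nat.lt_succ_iff] using hk
      rw [markovSeries, outputSeries, outputSeries, PowerSeries.coeff_mk, PowerSeries.coeff_mk,
        markov, matA, show i - (i + 1 - 1 - k) = k by omega]
      simp only [Matrix.mul_assoc]

theorem _root_.Matrix.eq_zero_of_forall_mul_eq_zero {m κ : Type*} [Fintype m] [Fintype κ]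
    [DecidableEq m] [DecidableEq κ] {M : Matrix m κ ℝ} (h : ∀ T : Matrix κ m ℝ, M * T = 0) :
    M = 0 := by
  ext a y
  have := congrFun (congrFun (h (Matrix.single y a 1)) a) a
  simpa using this

/-- The sum is the coefficient of `wᵖ` in `Q` times the inverse filter times an output series. The
first two factors multiply to `P`, which annihilates output series from order `p` on. -/
theorem sum_coeff_mul_obsRow [Nontrivial (Matrix (Fin n) (Fin n) ℝ)] (hP : P.Monic)
    (hp : P.natDegree = p) (hQ : Q.Monic) (hq : Q.natDegree = q) (hqp : q < p) :
    ∑ j ∈ Finset.range (q + 1), Q.coeff j * obsRow p q P Q j = 0 := by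
  refine Matrix.eq_zero_of_forall_mul_eq_zero fun T => ?_
  have h := coeff_revSeries_mul_outputSeries hP hp T (le_refl p)
  rw [← revSeries_mul_inverse_series hp hQ hq hqp, mul_assoc, PowerSeries.coeff_mul,
    Finset.Nat.sum_antidiagonal_eq_sum_range_succ_mk] at h
  have hsub : Finset.range (q + 1) ⊆ Finset.range (p + 1) :=
    Finset.range_subset_range.2 (by omega)
  rw [← Finset.sum_subset hsub, ← Finset.sum_range_reflect] at h
  · rw [← h, Matrix.sum_mul]
    refine Finset.sum_congr rfl fun k hk => ?_
    have hk' : k ≤ q := by simpa [Nat.lt_succ_iff] using hk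
    rw [Matrix.mul_assoc, ← coeff_inverse_series_mul_outputSeries hp hQ hq,
      coeff_revSeries_of_le _ (by omega), show p - (q + 1 - 1 - k) = p - q + k by omega,
      show q - (q + 1 - 1 - k) = k by omega]
  · intro k hk hk2
    simp only [Finset.mem_range] at hk hk2
    rw [coeff_revSeries_of_lt _ (by omega) hq.le, zero_mul]

/-- Applied to the transfer function itself, the inverse filter leaves the single power `w^{p-q-1}`;
the coefficients at `p - q + i` lie beyond it. -/
theorem obsRow_mul_matE [Nontrivial (Matrix (Fin n) (Fin n) ℝ)] (hP : P.Monic)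
    (hp : P.natDegree = p) (hQ : Q.Monic) (hq : Q.natDegree = q) (hqp : q < p) (i : ℕ) :
    obsRow p q P Q i * matE p P Q = 0 := by
  rw [← coeff_inverse_series_mul_outputSeries hp hQ hq, matE, ← markovSeries,
    inverse_series_mul_markovSeries hP hp hQ hq hqp, PowerSeries.coeff_X_pow, if_neg (by omega)]

/-- The state of the inverse filter is `L` times the state of the MCARMA process. -/
def matL (p q : ℕ) (P Q : (Matrix (Fin n) (Fin n) ℝ)[X]) :
    Matrix (Fin q × Fin n) (Fin p × Fin n) ℝ :=
  Matrix.of fun x y => obsRow p q P Q x.1 x.2 y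

theorem matL_mul_matE [Nontrivial (Matrix (Fin n) (Fin n) ℝ)] (hP : P.Monic)
    (hp : P.natDegree = p) (hQ : Q.Monic) (hq : Q.natDegree = q) (hqp : q < p) :
    matL p q P Q * matE p P Q = 0 := by
  ext x b
  exact congrFun (congrFun (obsRow_mul_matE hP hp hQ hq hqp x.1) x.2) b

theorem rowBlock_mul_matL {k : ℕ} (hk : k < q) :
    rowBlock n q k * matL p q P Q = obsRow p q P Q k := by
  rw [rowBlock_mul hk]; rfl

theorem _root_.Matrix.eq_of_rowBlock_mul_eq {κ : Type*} {d : ℕ}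
    {S T : Matrix (Fin d × Fin n) κ ℝ}
    (h : ∀ k < d, rowBlock n d k * S = rowBlock n d k * T) : S = T := by
  ext x y
  have := congrFun (congrFun (h x.1 x.1.2) x.2) y
  rw [rowBlock_mul x.1.2, rowBlock_mul x.1.2] at this
  exact this

/-- Together with `L E = 0` this says that `L G` solves the state equation of the inverse filter
with input `X`: `d(L G) = (B L G + F X) dt`. Above the last block row it is the recursion
`obsRow_succ`; in the last row `sum_coeff_mul_obsRow` closes the companion form. -/
theorem matL_mul_matA [Nontrivial (Matrix (Fin n) (Fin n) ℝ)] (hP : P.Monic)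
    (hp : P.natDegree = p) (hQ : Q.Monic) (hq : Q.natDegree = q) (hqp : q < p) :
    matL p q P Q * matA p P = companion q Q * matL p q P Q +
      inputBlocks q Q (remPoly P Q) * firstBlock n p := by
  refine Matrix.eq_of_rowBlock_mul_eq fun k hk => ?_
  have h2 : rowBlock n q k * (inputBlocks q Q (remPoly P Q) * firstBlock n p) =
      markov q Q (remPoly P Q) k * firstBlock n p := by
    rw [markov, firstBlock_mul_companion_pow hk, Matrix.mul_assoc]
  rw [Matrix.mul_add, h2, ← Matrix.mul_assoc, rowBlock_mul_matL hk, ← Matrix.mul_assoc,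
    ← sub_eq_iff_eq_add, ← obsRow_succ]
  rcases Nat.lt_or_ge (k + 1) q with h | h
  · rw [rowBlock_mul_companion h, rowBlock_mul_matL h]
  · have hkq : k + 1 = q := by omega
    rw [rowBlock_last_mul_companion hkq, Matrix.neg_mul, eq_neg_iff_add_eq_zero,
      ← sum_coeff_mul_obsRow hP hp hQ hq hqp, Finset.sum_range_succ, add_comm, Matrix.sum_mul]
    congr 1
    · refine Finset.sum_congr rfl fun j hj => ?_
      rw [Matrix.mul_assoc, rowBlock_mul_matL (Finset.mem_range.1 hj)]
    · have h1 : Q.coeff q = 1 := by rw [← hq]; exact hQ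
      rw [h1, Matrix.one_mul, hkq]

theorem firstBlock_mul_matL [Nontrivial (Matrix (Fin n) (Fin n) ℝ)] (hP : P.Monic)
    (hp : P.natDegree = p) (hQ : Q.Monic) (hq : Q.natDegree = q) (hqp : q < p) :
    firstBlock n q * matL p q P Q = ∑ k ∈ Finset.range (p - q + 1),
      (polyR P Q).coeff k * (firstBlock n p * matA p P ^ k) := by
  have h0 : obsRow p q P Q 0 = ∑ k ∈ Finset.range (p - q + 1),
      (polyR P Q).coeff k * (firstBlock n p * matA p P ^ k) := by simp [obsRow]
  rw [← h0]
  -- For `q = 0` there is no first block to read off. The left side is zero, and so is `obsRow` at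
  -- `0`, because the recursion of length `q` reduces to that one row.
  rcases Nat.eq_zero_or_pos q with rfl | hq0
  · have h := sum_coeff_mul_obsRow hP hp hQ hq hqp
    have h1 : Q.coeff 0 = 1 := by rw [← hq]; exact hQ
    rw [zero_add, Finset.sum_range_one, h1, Matrix.one_mul] at h
    rw [h, firstBlock_zero, Matrix.zero_mul]
  · exact rowBlock_mul_matL hq0

end Inversion

/-! ### Splitting the state into derivatives of the output and the state of the inverse filter -/

section Decomposition

variable {n p q : ℕ} {P Q : (Matrix (Fin n) (Fin n) ℝ)[X]}

theorem firstBlock_mul_pow_mul_matE (k : ℕ) :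
    firstBlock n p * (matA p P ^ k * matE p P Q) = markov p P Q k := by
  rw [markov, Matrix.mul_assoc]; rfl

/-- Iteration of `L A = B L + F e₁ᵀ`, starting from `L E = 0`. -/
theorem matL_mul_pow_mul_matE [Nontrivial (Matrix (Fin n) (Fin n) ℝ)] (hP : P.Monic)
    (hp : P.natDegree = p) (hQ : Q.Monic) (hq : Q.natDegree = q) (hqp : q < p) (k : ℕ) :
    matL p q P Q * (matA p P ^ k * matE p P Q) = ∑ a ∈ Finset.range k,
      companion q Q ^ a * (inputBlocks q Q (remPoly P Q) * markov p P Q (k - 1 - a)) := by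
  induction k with
  | zero => simp [matL_mul_matE hP hp hQ hq hqp]
  | succ k ih =>
    rw [pow_succ', Matrix.mul_assoc, ← Matrix.mul_assoc, matL_mul_matA hP hp hQ hq hqp,
      Matrix.add_mul, Matrix.mul_assoc, ih, Matrix.mul_assoc, firstBlock_mul_pow_mul_matE,
      Finset.sum_range_succ' _ k, Matrix.mul_sum]
    congr 1
    · refine Finset.sum_congr rfl fun a _ => ?_
      rw [pow_succ', show k + 1 - 1 - (a + 1) = k - 1 - a by omega]
      simp only [Matrix.mul_assoc]
    · simp

/-- The matrix `∑ₖ Aᵏ E Cₖ`. -/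
def matV (p q : ℕ) (P Q : (Matrix (Fin n) (Fin n) ℝ)[X]) : Matrix (Fin p × Fin n) (Fin n) ℝ :=
  ∑ k ∈ Finset.range (p - q + 1), matA p P ^ k * matE p P Q * (polyR P Q).coeff k

/-- The matrix `∑ⱼ ∑_{k ≥ j} A^{k-j} E Cₖ (Iₙ, 0, …, 0) A^{j-1}`. -/
def matS (p q : ℕ) (P Q : (Matrix (Fin n) (Fin n) ℝ)[X]) :
    Matrix (Fin p × Fin n) (Fin p × Fin n) ℝ :=
  ∑ k ∈ Finset.range (p - q + 1), ∑ i ∈ Finset.range k,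
    matA p P ^ (k - 1 - i) * (matE p P Q * (polyR P Q).coeff k * firstBlock n p) * matA p P ^ i

/-- In this order of summation the row `firstBlock n p * matA p P ^ (j - 1)` reads the derivative of
order `j - 1` off the state, and what precedes it is the matrix factor of `gTildeJ`. -/
theorem matS_eq : matS p q P Q = ∑ j ∈ Finset.Icc 1 (p - q), (∑ k ∈ Finset.Icc j (p - q),
    matA p P ^ (k - j) * matE p P Q * (polyR P Q).coeff k) *
      (firstBlock n p * matA p P ^ (j - 1)) := by
  have h1 : ∀ k, ∑ i ∈ Finset.range k, matA p P ^ (k - 1 - i) *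
      (matE p P Q * (polyR P Q).coeff k * firstBlock n p) * matA p P ^ i =
      ∑ j ∈ Finset.Icc 1 k, matA p P ^ (k - j) * matE p P Q * (polyR P Q).coeff k *
      (firstBlock n p * matA p P ^ (j - 1)) := by
    intro k
    refine Finset.sum_bij' (fun i _ => i + 1) (fun j _ => j - 1) ?_ ?_ ?_ ?_ ?_
    · intro i hi; simp at hi ⊢; omega
    · intro i hi; simp at hi ⊢; omega
    · intro i hi; simp
    · intro i hi; simp at hi ⊢; omega
    · intro i hi
      simp only [Matrix.mul_assoc, Nat.add_sub_cancel, show k - 1 - i = k - (i + 1) by omega]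
  simp only [matS, h1, Matrix.sum_mul]
  refine Finset.sum_comm' fun k j => ?_
  simp only [Finset.mem_range, Finset.mem_Icc]
  omega

/-- For each `k` the sum `∑ A^{k-1-i} G Aⁱ` has commutator `Aᵏ G - G Aᵏ` with `A`, by telescoping.
-/
theorem commutator_matS :
    matA p P * matS p q P Q - matS p q P Q * matA p P = matV p q P Q * firstBlock n p -
      matE p P Q * ∑ k ∈ Finset.range (p - q + 1),
        (polyR P Q).coeff k * (firstBlock n p * matA p P ^ k) := by
  have h1 : ∀ (A G : Matrix (Fin p × Fin n) (Fin p × Fin n) ℝ) (k : ℕ),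
      A * ∑ i ∈ Finset.range k, A ^ (k - 1 - i) * G * A ^ i -
        (∑ i ∈ Finset.range k, A ^ (k - 1 - i) * G * A ^ i) * A = A ^ k * G - G * A ^ k := by
    intro A G k
    rw [Finset.mul_sum, Finset.sum_mul, ← Finset.sum_sub_distrib]
    have : ∀ i ∈ Finset.range k, A * (A ^ (k - 1 - i) * G * A ^ i) -
        A ^ (k - 1 - i) * G * A ^ i * A =
        A ^ (k - i) * G * A ^ i - A ^ (k - (i + 1)) * G * A ^ (i + 1) := by
      intro i hi
      have hi := Finset.mem_range.1 hi
      rw [show k - 1 - i = k - (i + 1) by omega, ← mul_assoc, ← mul_assoc, ← pow_succ',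
        show k - (i + 1) + 1 = k - i by omega, pow_succ A i, ← mul_assoc]
    rw [Finset.sum_congr rfl this, Finset.sum_range_sub' (fun i => A ^ (k - i) * G * A ^ i)]
    simp
  rw [matS, Finset.mul_sum, Finset.sum_mul, ← Finset.sum_sub_distrib,
    Finset.sum_congr rfl fun k _ => h1 _ _ k, Finset.sum_sub_distrib, matV, Matrix.sum_mul,
    Matrix.mul_sum]
  congr 1
  · exact Finset.sum_congr rfl fun k _ => by simp only [Matrix.mul_assoc]
  · exact Finset.sum_congr rfl fun k _ => by simp only [Matrix.mul_assoc]

/-- Each summand of `S` ends in `e₁ᵀ Aⁱ` with `i < p - q`, and `e₁ᵀ Aⁱ V` is one of the vanishing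
coefficients of `P⁻¹QR`. -/
theorem matS_mul_matV [Nontrivial (Matrix (Fin n) (Fin n) ℝ)] (hP : P.Monic)
    (hp : P.natDegree = p) (hQ : Q.Monic) (hq : Q.natDegree = q) (hqp : q < p) :
    matS p q P Q * matV p q P Q = 0 := by
  rw [matS, Matrix.sum_mul]
  refine Finset.sum_eq_zero fun k hk => ?_
  rw [Matrix.sum_mul]
  refine Finset.sum_eq_zero fun i hi => ?_
  have h : firstBlock n p * (matA p P ^ i * matV p q P Q) = 0 := by
    rw [← sum_markov_mul_coeff_polyR hP hp hQ hq hqp (i := i)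
      (by have := Finset.mem_range.1 hk; have := Finset.mem_range.1 hi; omega), matV,
      Matrix.mul_sum, Matrix.mul_sum]
    refine Finset.sum_congr rfl fun m _ => ?_
    rw [← firstBlock_mul_pow_mul_matE, add_comm m i, pow_add]
    simp only [Matrix.mul_assoc]
  simp only [Matrix.mul_assoc, h, Matrix.mul_zero]

/-- Only `k = p - q`, `i = 0` survives: all other terms contain a Markov parameter below the
relative degree, and this one contains the first nonzero parameter, which is the identity. -/
theorem firstBlock_mul_matS [Nontrivial (Matrix (Fin n) (Fin n) ℝ)] (hP : P.Monic)
    (hp : P.natDegree = p) (hQ : Q.Monic) (hq : Q.natDegree = q) (hqp : q < p) :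
    firstBlock n p * matS p q P Q = firstBlock n p := by
  rw [matS, Matrix.mul_sum, Finset.sum_eq_single (p - q), Matrix.mul_sum, Finset.sum_eq_single 0]
  · rw [coeff_polyR_top hP hp hQ hq hqp]
    have := firstBlock_mul_pow_mul_matE (P := P) (Q := Q) (p := p) (p - q - 1)
    rw [markov_top hP hp hQ hq hqp, ← Matrix.mul_assoc] at this
    rw [Matrix.mul_one, Nat.sub_zero, pow_zero, Matrix.mul_one, ← Matrix.mul_assoc,
      ← Matrix.mul_assoc, this, Matrix.one_mul]
  · intro i hi hi0
    have := firstBlock_mul_pow_mul_matE (P := P) (Q := Q) (p := p) (p - q - 1 - i)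
    rw [markov_of_lt hP hp hQ hq hqp (by have := Finset.mem_range.1 hi; omega),
      ← Matrix.mul_assoc] at this
    simp only [← Matrix.mul_assoc, this, Matrix.zero_mul]
  · intro h; exact absurd (Finset.mem_range.2 (by omega)) h
  · intro k hk hk2
    rw [Matrix.mul_sum]
    refine Finset.sum_eq_zero fun i hi => ?_
    have := firstBlock_mul_pow_mul_matE (P := P) (Q := Q) (p := p) (k - 1 - i)
    rw [markov_of_lt hP hp hQ hq hqp
      (by have := Finset.mem_range.1 hi; have := Finset.mem_range.1 hk; omega),
      ← Matrix.mul_assoc] at this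
    simp only [← Matrix.mul_assoc, this, Matrix.zero_mul]
  · intro h; exact absurd (Finset.mem_range.2 (by omega)) h

/-- Again the relative degree leaves a single term, `k = p - q` with the power `B⁰`. -/
theorem matL_mul_matV [Nontrivial (Matrix (Fin n) (Fin n) ℝ)] (hP : P.Monic)
    (hp : P.natDegree = p) (hQ : Q.Monic) (hq : Q.natDegree = q) (hqp : q < p) :
    matL p q P Q * matV p q P Q = inputBlocks q Q (remPoly P Q) := by
  rw [matV, Matrix.mul_sum, Finset.sum_eq_single (p - q)]
  · rw [coeff_polyR_top hP hp hQ hq hqp, Matrix.mul_one, matL_mul_pow_mul_matE hP hp hQ hq hqp,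
      Finset.sum_eq_single 0]
    · rw [Nat.sub_zero, markov_top hP hp hQ hq hqp, pow_zero, Matrix.one_mul, Matrix.mul_one]
    · intro i hi hi0
      rw [markov_of_lt hP hp hQ hq hqp (by have := Finset.mem_range.1 hi; omega), Matrix.mul_zero,
        Matrix.mul_zero]
    · intro h; exact absurd (Finset.mem_range.2 (by omega)) h
  · intro k hk hk2
    rw [← Matrix.mul_assoc, matL_mul_pow_mul_matE hP hp hQ hq hqp, Finset.sum_eq_zero,
      Matrix.zero_mul]
    intro i hi
    rw [markov_of_lt hP hp hQ hq hqp
      (by have := Finset.mem_range.1 hi; have := Finset.mem_range.1 hk; omega), Matrix.mul_zero,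
      Matrix.mul_zero]
  · intro h; exact absurd (Finset.mem_range.2 (by omega)) h

/-- The generator of the state equation with vanishing input to the inverse filter. -/
def matW (p q : ℕ) (P Q : (Matrix (Fin n) (Fin n) ℝ)[X]) :
    Matrix (Fin p × Fin n) (Fin p × Fin n) ℝ :=
  matA p P - matV p q P Q * firstBlock n p

theorem matL_mul_matW [Nontrivial (Matrix (Fin n) (Fin n) ℝ)] (hP : P.Monic)
    (hp : P.natDegree = p) (hQ : Q.Monic) (hq : Q.natDegree = q) (hqp : q < p) :
    matL p q P Q * matW p q P Q = companion q Q * matL p q P Q := by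
  rw [matW, Matrix.mul_sub, matL_mul_matA hP hp hQ hq hqp, ← Matrix.mul_assoc,
    matL_mul_matV hP hp hQ hq hqp, add_sub_cancel_right]

/-- The commutator formula with `S V = 0`. Up to the term with `E e₁ᵀ L`, the matrix `1 - S`
intertwines `W` and `A`; that term becomes the integrand of `matTheta` in `matTheta_mul_matL`. -/
theorem one_sub_matS_mul_matW [Nontrivial (Matrix (Fin n) (Fin n) ℝ)] (hP : P.Monic)
    (hp : P.natDegree = p) (hQ : Q.Monic) (hq : Q.natDegree = q) (hqp : q < p) :
    (1 - matS p q P Q) * matW p q P Q = matA p P * (1 - matS p q P Q) -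
      matE p P Q * (firstBlock n q * matL p q P Q) := by
  have h1 := commutator_matS (p := p) (q := q) (P := P) (Q := Q)
  rw [← firstBlock_mul_matL hP hp hQ hq hqp] at h1
  have h2 : matS p q P Q * (matV p q P Q * firstBlock n p) = 0 := by
    rw [← Matrix.mul_assoc, matS_mul_matV hP hp hQ hq hqp, Matrix.zero_mul]
  rw [matW, sub_mul, mul_sub, one_mul, mul_sub, h2, mul_sub, mul_one, sub_zero]
  rw [sub_eq_sub_iff_add_eq_add] at h1
  rw [sub_sub, sub_sub, h1, Matrix.one_mul]

/-- The combination of derivatives by which the noise is recovered. -/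
def matGamma (p q : ℕ) (P Q : (Matrix (Fin n) (Fin n) ℝ)[X]) : Matrix (Fin n) (Fin p × Fin n) ℝ :=
  ∑ k ∈ Finset.range (p - q), (polyR P Q).coeff (k + 1) * (firstBlock n p * matA p P ^ k)

theorem matGamma_mul_matE [Nontrivial (Matrix (Fin n) (Fin n) ℝ)] (hP : P.Monic)
    (hp : P.natDegree = p) (hQ : Q.Monic) (hq : Q.natDegree = q) (hqp : q < p) :
    matGamma p q P Q * matE p P Q = 1 := by
  rw [matGamma, Matrix.sum_mul, Finset.sum_eq_single (p - q - 1)]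
  · rw [Matrix.mul_assoc, Matrix.mul_assoc, firstBlock_mul_pow_mul_matE,
      markov_top hP hp hQ hq hqp, show p - q - 1 + 1 = p - q by omega,
      coeff_polyR_top hP hp hQ hq hqp, Matrix.mul_one]
  · intro k hk hk2
    rw [Matrix.mul_assoc, Matrix.mul_assoc, firstBlock_mul_pow_mul_matE,
      markov_of_lt hP hp hQ hq hqp (by have := Finset.mem_range.1 hk; omega), Matrix.mul_zero]
  · intro h; exact absurd (Finset.mem_range.2 (by omega)) h

theorem matGamma_mul_matA [Nontrivial (Matrix (Fin n) (Fin n) ℝ)] (hP : P.Monic)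
    (hp : P.natDegree = p) (hQ : Q.Monic) (hq : Q.natDegree = q) (hqp : q < p) :
    matGamma p q P Q * matA p P =
      firstBlock n q * matL p q P Q - (polyR P Q).coeff 0 * firstBlock n p := by
  rw [firstBlock_mul_matL hP hp hQ hq hqp, Finset.sum_range_succ', matGamma, Matrix.sum_mul,
    pow_zero, Matrix.mul_one, add_sub_cancel_right]
  exact Finset.sum_congr rfl fun k _ => by rw [pow_succ]; simp only [Matrix.mul_assoc]

end Decomposition

/-! ### Matrix exponentials -/

section Exponential

open Filter Topology

attribute [local instance] Matrix.linftyOpNormedAddCommGroup Matrix.linftyOpNormedSpace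
  Matrix.linftyOpNormedRing Matrix.linftyOpNormedAlgebra

variable {ι κ : Type*} [Fintype ι] [DecidableEq ι] [Fintype κ] [DecidableEq κ]

/-- `e^{tA}`. -/
abbrev expm {ι : Type*} [Fintype ι] [DecidableEq ι] (A : Matrix ι ι ℝ) (t : ℝ) : Matrix ι ι ℝ :=
  NormedSpace.exp (t • A)

theorem expm_zero (A : Matrix ι ι ℝ) : expm A 0 = 1 := by simp [expm]

theorem expm_add (A : Matrix ι ι ℝ) (s t : ℝ) : expm A (s + t) = expm A s * expm A t := by
  rw [expm, add_smul]
  exact Matrix.exp_add_of_commute _ _ (((Commute.refl A).smul_left s).smul_right t)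

theorem hasDerivAt_expm (A : Matrix ι ι ℝ) (t : ℝ) :
    HasDerivAt (expm A) (expm A t * A) t :=
  hasDerivAt_exp_smul_const A t

theorem continuous_expm (A : Matrix ι ι ℝ) : Continuous (expm A) :=
  continuous_iff_continuousAt.2 fun t => (hasDerivAt_expm A t).continuousAt

theorem expm_mul_comm (A : Matrix ι ι ℝ) (t : ℝ) : expm A t * A = A * expm A t :=
  (((Commute.refl A).smul_left t).exp_left).eq

theorem expm_intertwine {A : Matrix ι ι ℝ} {B : Matrix κ κ ℝ} {L : Matrix κ ι ℝ}
    (h : L * A = B * L) (t : ℝ) : L * expm A t = expm B t * L := by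
  have h1 : ∀ k : ℕ, L * A ^ k = B ^ k * L := by
    intro k
    induction k with
    | zero => simp
    | succ k ih => rw [pow_succ', pow_succ', ← Matrix.mul_assoc, h, Matrix.mul_assoc, ih,
        Matrix.mul_assoc]
  have hA := NormedSpace.exp_series_hasSum_exp' (𝕂 := ℝ) (t • A)
  have hB := NormedSpace.exp_series_hasSum_exp' (𝕂 := ℝ) (t • B)
  have hA' := hA.map (AddMonoidHom.mk' (fun T : Matrix ι ι ℝ => L * T) (Matrix.mul_add L))
    (continuous_const.matrix_mul continuous_id)
  have hB' := hB.map (AddMonoidHom.mk' (fun T : Matrix κ κ ℝ => T * L)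
    fun S T => Matrix.add_mul S T L) (continuous_id.matrix_mul continuous_const)
  refine hA'.unique ?_
  convert! hB' using 1
  funext k
  simp [_root_.smul_pow, h1]

theorem mulVec_exp_of_eigenvector {A : Matrix ι ι ℂ} {v : ι → ℂ} {z : ℂ} (h : A *ᵥ v = z • v) :
    NormedSpace.exp A *ᵥ v = Complex.exp z • v := by
  have h1 : ∀ k : ℕ, A ^ k *ᵥ v = z ^ k • v := by
    intro k
    induction k with
    | zero => simp
    | succ k ih => rw [pow_succ, ← Matrix.mulVec_mulVec, h, Matrix.mulVec_smul, ih, smul_smul,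
        pow_succ']
  have hA := NormedSpace.exp_series_hasSum_exp' (𝕂 := ℂ) A
  have hA' := hA.map (AddMonoidHom.mk' (fun T : Matrix ι ι ℂ => T *ᵥ v)
    fun S T => Matrix.add_mulVec S T v) (continuous_id.matrix_mulVec continuous_const)
  have hB := (NormedSpace.exp_series_hasSum_exp' (𝕂 := ℂ) z).smul_const v
  rw [← Complex.exp_eq_exp_ℂ] at hB
  refine hA'.unique ?_
  convert! hB using 2 with k
  simp [h1, Matrix.smul_mulVec, smul_smul]

/-- Each eigenspace of `exp A` is invariant under `A`, which commutes with it, and so contains an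
eigenvector of `A`, say for `z`. The eigenvalue of `exp A` is then `exp z`, of modulus `exp (Re z) <
1`. -/
theorem norm_lt_one_of_mem_spectrum_exp {A : Matrix ι ι ℂ}
    (h : ∀ (z : ℂ) (v : ι → ℂ), v ≠ 0 → A *ᵥ v = z • v → z.re < 0) {l : ℂ}
    (hl : l ∈ spectrum ℂ (NormedSpace.exp A)) : ‖l‖ < 1 := by
  rw [← Matrix.spectrum_toLin', ← Module.End.hasEigenvalue_iff_mem_spectrum] at hl
  set M := NormedSpace.exp A with hM
  have hcomm : Commute (Matrix.toLin' M) (Matrix.toLin' A) := by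
    have : Commute M A := (Commute.refl A).exp_left
    change Matrix.toLin' M * Matrix.toLin' A = Matrix.toLin' A * Matrix.toLin' M
    rw [Module.End.mul_eq_comp, Module.End.mul_eq_comp, ← Matrix.toLin'_mul, ← Matrix.toLin'_mul,
      this.eq]
  set W := Module.End.eigenspace (Matrix.toLin' M) l
  have hmaps : ∀ x ∈ W, Matrix.toLin' A x ∈ W :=
    Module.End.mapsTo_genEigenspace_of_comm hcomm l 1
  have hnt : Nontrivial W := by
    obtain ⟨v, hv⟩ := hl.exists_hasEigenvector
    exact ⟨⟨⟨v, hv.1⟩, 0, fun h0 => hv.2 (congrArg Subtype.val h0)⟩⟩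
  obtain ⟨z, hz⟩ := Module.End.exists_eigenvalue ((Matrix.toLin' A).restrict hmaps)
  obtain ⟨⟨v, hvW⟩, hv, hv0⟩ := hz.exists_hasEigenvector
  have hv0' : v ≠ 0 := fun h0 => hv0 (Subtype.ext h0)
  rw [Module.End.mem_eigenspace_iff] at hv
  have hAv : A *ᵥ v = z • v := by
    have := congrArg Subtype.val hv
    simpa using this
  have hMv : M *ᵥ v = l • v := by
    have := Module.End.mem_eigenspace_iff.1 hvW
    simpa using this
  have : l = Complex.exp z := by
    have h2 := mulVec_exp_of_eigenvector hAv
    rw [← hM, hMv] at h2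
    exact smul_left_injective ℂ hv0' h2
  rw [this, Complex.norm_exp, Real.exp_lt_one_iff]
  exact h z v hv0' hAv

theorem norm_map_ofReal {ι κ : Type*} [Fintype ι] [Fintype κ] (A : Matrix ι κ ℝ) : ‖A.map (fun x : ℝ => (x : ℂ))‖ = ‖A‖ := by
  simp [Matrix.linfty_opNorm_def]

theorem exp_map_ofReal (A : Matrix ι ι ℝ) :
    NormedSpace.exp (A.map (fun x : ℝ => (x : ℂ))) =
      (NormedSpace.exp A).map (fun x : ℝ => (x : ℂ)) := by
  have hA := NormedSpace.exp_series_hasSum_exp' (𝕂 := ℝ) A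
  have hB := NormedSpace.exp_series_hasSum_exp' (𝕂 := ℝ) (A.map (fun x : ℝ => (x : ℂ)))
  have hA' := hA.map (Complex.ofRealHom.mapMatrix (m := ι)).toAddMonoidHom
    (by exact continuous_id.matrix_map Complex.continuous_ofReal)
  refine hB.unique ?_
  convert! hA' using 2 with k
  have : (A ^ k).map (fun x : ℝ => (x : ℂ)) = A.map (fun x : ℝ => (x : ℂ)) ^ k :=
    map_pow (Complex.ofRealHom.mapMatrix (m := ι)) A k
  simp only [Function.comp]
  ext i j
  simp [← this]

/-- Exponential stability of a matrix whose eigenvalues have negative real parts. -/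
theorem exists_norm_expm_le {A : Matrix ι ι ℝ}
    (h : ∀ (z : ℂ) (v : ι → ℂ), v ≠ 0 → A.map (fun x : ℝ => (x : ℂ)) *ᵥ v = z • v → z.re < 0) :
    ∃ K δ : ℝ, 0 < K ∧ 0 < δ ∧ ∀ t, 0 ≤ t → ‖expm A t‖ ≤ K * Real.exp (-(δ * t)) := by
  rcases isEmpty_or_nonempty ι with hι | hι
  · refine ⟨1, 1, one_pos, one_pos, fun t _ => ?_⟩
    have : expm A t = 0 := Subsingleton.elim _ _
    rw [this, norm_zero]; positivity
  set AC := A.map (fun x : ℝ => (x : ℂ))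
  have hr : spectralRadius ℂ (NormedSpace.exp AC) < (1 : NNReal) :=
    spectrum.spectralRadius_lt_of_forall_lt _ fun z hz => by
      have := norm_lt_one_of_mem_spectrum_exp h hz
      exact_mod_cast this
  -- Gelfand's formula: a spectral radius below `1` forces some power of `exp A` to have norm below
  -- `1`.
  have hg := spectrum.pow_nnnorm_pow_one_div_tendsto_nhds_spectralRadius (NormedSpace.exp AC)
  obtain ⟨N, hN, hN1⟩ := ((hg.eventually_lt_const hr).and (eventually_ge_atTop 1)).exists
  have hN0 : (0 : ℝ) < N := by exact_mod_cast hN1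
  have hlt : ‖NormedSpace.exp AC ^ N‖ < 1 := by
    have h1 : (‖NormedSpace.exp AC ^ N‖₊ : ENNReal) < 1 := by
      by_contra hcon
      push Not at hcon
      have : (1 : ENNReal) ≤ (‖NormedSpace.exp AC ^ N‖₊ : ENNReal) ^ (1 / N : ℝ) :=
        ENNReal.one_le_rpow hcon (by positivity)
      exact absurd hN (not_lt.2 (by simpa using this))
    exact_mod_cast h1
  have hexpN : ‖expm A N‖ < 1 := by
    rw [← norm_map_ofReal, ← exp_map_ofReal]
    have : ((N : ℝ) • A).map (fun x : ℝ => (x : ℂ)) = N • AC := by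
      ext i j; simp [AC]
    rw [this, Matrix.exp_nsmul]; exact hlt
  -- The lower bound `1/2` makes `c` positive, so that `Real.log c` is a genuine negative logarithm.
  set c := max ‖expm A N‖ (1 / 2) with hc
  have hc0 : 0 < c := lt_max_of_lt_right (by norm_num)
  have hc1 : c < 1 := max_lt hexpN (by norm_num)
  obtain ⟨C, hC⟩ := (isCompact_Icc (a := (0 : ℝ)) (b := N)).exists_bound_of_continuousOn
    (continuous_expm A).continuousOn
  have hpow : ∀ k : ℕ, ‖expm A (N * k)‖ ≤ c ^ k := by
    intro k
    induction k with
    | zero => simp [expm_zero]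
    | succ k ih =>
      rw [Nat.cast_succ, mul_add, mul_one, expm_add, pow_succ]
      exact (norm_mul_le _ _).trans (mul_le_mul ih (le_max_left _ _) (norm_nonneg _) (by positivity))
  have hC0 : 0 ≤ C := (norm_nonneg _).trans (hC 0 ⟨le_rfl, hN0.le⟩)
  -- For `k = ⌊t / N⌋` the factor `c ^ k` is at most `c ^ (t / N) / c`. The division by `c` pays for
  -- the floor, and `C` bounds the exponential on the remaining piece of length at most `N`.
  refine ⟨(C + 1) / c, -Real.log c / N, by positivity, ?_, fun t ht => ?_⟩
  · exact div_pos (neg_pos.2 (Real.log_neg hc0 hc1)) hN0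
  set k := ⌊t / N⌋₊
  have hk1 : (k : ℝ) ≤ t / N := Nat.floor_le (by positivity)
  have hk2 : t / N < k + 1 := Nat.lt_floor_add_one _
  have h1 : N * (k : ℝ) ≤ t := by rwa [mul_comm, ← le_div_iff₀ hN0]
  have h2 : t - N * k ≤ N := by
    rw [div_lt_iff₀ hN0] at hk2; nlinarith
  have h3 : expm A t = expm A (N * k) * expm A (t - N * k) := by
    rw [← expm_add]; congr 1; ring
  have h4 : c ^ k ≤ Real.exp (-(-Real.log c / N * t)) / c := by
    rw [le_div_iff₀ hc0, ← pow_succ, ← Real.rpow_natCast, Real.rpow_def_of_pos hc0,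
      Real.exp_le_exp]
    have := Real.log_neg hc0 hc1
    push_cast
    rw [show -(-Real.log c / N * t) = Real.log c * (t / N) by ring]
    nlinarith
  rw [h3]
  calc ‖expm A (N * k) * expm A (t - N * k)‖
      ≤ c ^ k * C := (norm_mul_le _ _).trans
        (mul_le_mul (hpow k) (hC _ ⟨by linarith, h2⟩) (norm_nonneg _) (by positivity))
    _ ≤ (Real.exp (-(-Real.log c / N * t)) / c) * (C + 1) :=
        mul_le_mul h4 (by linarith) hC0 (by positivity)
    _ = _ := by ring

end Exponential

/-! ### Transfer functions -/

section Transfer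

open Filter Topology

attribute [local instance] Matrix.linftyOpNormedAddCommGroup Matrix.linftyOpNormedSpace
  Matrix.linftyOpNormedRing Matrix.linftyOpNormedAlgebra

variable {n d : ℕ} {M N : (Matrix (Fin n) (Fin n) ℝ)[X]}

/-- A real matrix as a complex matrix. -/
def cmap {ι κ : Type*} (T : Matrix ι κ ℝ) : Matrix ι κ ℂ := T.map fun x : ℝ => (x : ℂ)

@[simp]
theorem cmap_apply {ι κ : Type*} (T : Matrix ι κ ℝ) (i : ι) (j : κ) :
    cmap T i j = (T i j : ℂ) := rfl

theorem cmap_mul {ι κ κ' : Type*} [Fintype κ] (S : Matrix ι κ ℝ) (T : Matrix κ κ' ℝ) :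
    cmap (S * T) = cmap S * cmap T := by
  ext a b; simp [Matrix.mul_apply]

theorem matEval_eq_sum (hd : M.natDegree ≤ d) (z : ℂ) :
    matEval M z = ∑ j ∈ Finset.range (d + 1), z ^ j • cmap (M.coeff j) :=
  Polynomial.sum_over_range' M (fun k => by ext; simp) (d + 1) (by omega)

theorem sum_coeff_mul_markov (hM : M.Monic) (hd : M.natDegree = d) (hN : N.degree < d) {m : ℕ}
    (hm : m < d) :
    ∑ j ∈ Finset.Ico (m + 1) (d + 1), M.coeff j * markov d M N (j - 1 - m) = N.coeff m := by
  have h := revSeries_mul_markovSeries hM hd hN (d - 1 - m)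
  rw [if_pos (by omega), show d - 1 - (d - 1 - m) = m by omega, PowerSeries.coeff_mul,
    Finset.Nat.sum_antidiagonal_eq_sum_range_succ_mk] at h
  rw [← h]
  refine Finset.sum_bij' (fun j _ => d - j) (fun i _ => d - i) ?_ ?_ ?_ ?_ ?_
  · intro j hj; simp at hj ⊢; omega
  · intro j hj; simp at hj ⊢; omega
  · intro j hj; simp at hj ⊢; omega
  · intro j hj; simp at hj ⊢; omega
  · intro j hj
    simp only [Finset.mem_Ico] at hj
    rw [coeff_revSeries_of_le _ (by omega), markovSeries, outputSeries, PowerSeries.coeff_mk,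
      ← markov]
    congr 2 <;> omega

/-- The first block row of the matrix `M(z) (z - 𝐌)⁻¹`. -/
def resolventRow (d : ℕ) (M : (Matrix (Fin n) (Fin n) ℝ)[X]) (z : ℂ) :
    Matrix (Fin n) (Fin d × Fin n) ℂ :=
  ∑ j ∈ Finset.range (d + 1), cmap (M.coeff j) * ∑ l ∈ Finset.range j,
    z ^ (j - 1 - l) • cmap (firstBlock n d * companion d M ^ l)

/-- Telescoping of `zʲ - 𝐌ʲ = ∑ z^{j-1-l} 𝐌ˡ (z - 𝐌)`, summed against the coefficients of `M`; the
part with `𝐌ʲ` is the vanishing first row of `M(𝐌)`. -/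
theorem resolventRow_mul (hM : M.Monic) (hd : M.natDegree = d) (z : ℂ) :
    resolventRow d M z * (z • 1 - cmap (companion d M)) = matEval M z * cmap (firstBlock n d) := by
  have h1 : ∀ j, (∑ l ∈ Finset.range j, z ^ (j - 1 - l) •
      cmap (firstBlock n d * companion d M ^ l)) * (z • 1 - cmap (companion d M)) =
      z ^ j • cmap (firstBlock n d) - cmap (firstBlock n d * companion d M ^ j) := by
    intro j
    have h2 : ∀ l ∈ Finset.range j, (z ^ (j - 1 - l) • cmap (firstBlock n d * companion d M ^ l)) *
        (z • 1 - cmap (companion d M)) =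
        z ^ (j - l) • cmap (firstBlock n d * companion d M ^ l) -
        z ^ (j - (l + 1)) • cmap (firstBlock n d * companion d M ^ (l + 1)) := by
      intro l hl
      have hl := Finset.mem_range.1 hl
      rw [Matrix.mul_sub, Matrix.mul_smul, Matrix.mul_one, smul_smul, ← pow_succ',
        show j - 1 - l + 1 = j - l by omega, show j - 1 - l = j - (l + 1) by omega,
        Matrix.smul_mul, pow_succ, ← Matrix.mul_assoc, cmap_mul (_ * _) (companion d M)]
    rw [Matrix.sum_mul, Finset.sum_congr rfl h2,
      Finset.sum_range_sub' fun l => z ^ (j - l) • cmap (firstBlock n d * companion d M ^ l)]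
    simp
  have h3 := congrArg cmap (sum_coeff_mul_firstBlock_mul_pow hM hd)
  rw [resolventRow, Matrix.sum_mul, matEval_eq_sum hd.le, Matrix.sum_mul]
  have h4 : ∀ j ∈ Finset.range (d + 1), (cmap (M.coeff j) * ∑ l ∈ Finset.range j,
      z ^ (j - 1 - l) • cmap (firstBlock n d * companion d M ^ l)) *
        (z • 1 - cmap (companion d M)) = z ^ j • cmap (M.coeff j) * cmap (firstBlock n d) -
        cmap (M.coeff j * (firstBlock n d * companion d M ^ j)) := by
    intro j _
    rw [Matrix.mul_assoc, h1, Matrix.mul_sub, Matrix.mul_smul, Matrix.smul_mul,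
      cmap_mul (M.coeff j)]
  rw [Finset.sum_congr rfl h4, Finset.sum_sub_distrib, sub_eq_self]
  have h5 : cmap (∑ j ∈ Finset.range (d + 1), M.coeff j * (firstBlock n d * companion d M ^ j)) =
      ∑ j ∈ Finset.range (d + 1), cmap (M.coeff j * (firstBlock n d * companion d M ^ j)) := by
    ext a b; simp [Matrix.sum_apply]
  rw [← h5, h3]
  ext; simp

/-- Collecting powers of `z` gives convolutions of `M` with the Markov parameters, which are the
coefficients of `N`. With `resolventRow_mul` this identifies the transfer function as `M⁻¹N`. -/
theorem resolventRow_mul_inputBlocks (hM : M.Monic) (hd : M.natDegree = d) (hN : N.degree < d)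
    (z : ℂ) : resolventRow d M z * cmap (inputBlocks d M N) = matEval N z := by
  have hN0 : N.coeff d = 0 := coeff_eq_zero_of_degree_lt hN
  rw [matEval_eq_sum (natDegree_le_of_degree_le hN.le), Finset.sum_range_succ, hN0]
  have h1 : ∀ j ∈ Finset.range (d + 1), (cmap (M.coeff j) * ∑ l ∈ Finset.range j,
      z ^ (j - 1 - l) • cmap (firstBlock n d * companion d M ^ l)) * cmap (inputBlocks d M N) =
      ∑ m ∈ Finset.range j, z ^ m • cmap (M.coeff j * markov d M N (j - 1 - m)) := by
    intro j _
    rw [Matrix.mul_assoc, Matrix.sum_mul, Matrix.mul_sum, ← Finset.sum_range_reflect]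
    refine Finset.sum_congr rfl fun m hm => ?_
    have hm := Finset.mem_range.1 hm
    rw [Matrix.smul_mul, Matrix.mul_smul, show j - 1 - (j - 1 - m) = m by omega, markov,
      cmap_mul (M.coeff j), cmap_mul _ (inputBlocks d M N)]
  rw [resolventRow, Matrix.sum_mul, Finset.sum_congr rfl h1,
    Finset.sum_comm' (t' := Finset.range d) (s' := fun m => Finset.Ico (m + 1) (d + 1))]
  · have h0 : z ^ d • cmap (0 : Matrix (Fin n) (Fin n) ℝ) = 0 := by ext; simp
    rw [h0, add_zero]
    refine Finset.sum_congr rfl fun m hm => ?_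
    rw [← sum_coeff_mul_markov hM hd hN (Finset.mem_range.1 hm)]
    ext a b
    simp [Matrix.sum_apply, Finset.mul_sum]
  · intro j m
    simp only [Finset.mem_range, Finset.mem_Ico]
    omega

/-- The first block of an eigenvector lies in the kernel of `M(z)`. Were `M(z)` invertible, that
block would vanish, and with it all the others, which are its multiples by powers of `z`. -/
theorem re_lt_zero_of_companion_eigenvector (hM : M.Monic) (hd : M.natDegree = d)
    (hdet : ∀ z : ℂ, 0 ≤ z.re → (matEval M z).det ≠ 0) (z : ℂ) (v : Fin d × Fin n → ℂ)
    (hv : v ≠ 0) (h : cmap (companion d M) *ᵥ v = z • v) : z.re < 0 := by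
  by_contra hz
  push Not at hz
  apply hv
  have h1 : cmap (firstBlock n d) *ᵥ v = 0 := by
    refine Matrix.eq_zero_of_mulVec_eq_zero (hdet z hz) ?_
    rw [Matrix.mulVec_mulVec, ← resolventRow_mul hM hd, ← Matrix.mulVec_mulVec, Matrix.sub_mulVec,
      h, Matrix.smul_mulVec, Matrix.one_mulVec, sub_self, Matrix.mulVec_zero]
  have h2 : ∀ k : ℕ, cmap (companion d M ^ k) *ᵥ v = z ^ k • v := by
    intro k
    induction k with
    | zero =>
      have : cmap (1 : Matrix (Fin d × Fin n) (Fin d × Fin n) ℝ) = 1 := by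
        ext a b; simp [Matrix.one_apply, apply_ite]
      rw [pow_zero, pow_zero, one_smul, this, Matrix.one_mulVec]
    | succ k ih =>
      rw [pow_succ, cmap_mul, ← Matrix.mulVec_mulVec, h, Matrix.mulVec_smul, ih,
        smul_smul, pow_succ']
  funext x
  have h3 : cmap (rowBlock n d x.1) *ᵥ v = 0 := by
    rw [← firstBlock_mul_companion_pow x.1.2 M, cmap_mul, ← Matrix.mulVec_mulVec, h2,
      Matrix.mulVec_smul, h1, smul_zero]
  have h4 := congrFun h3 x.2
  rw [Matrix.mulVec, dotProduct, Fintype.sum_prod_type, Finset.sum_eq_single x.1] at h4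
  · simpa [rowBlock, Matrix.one_apply, apply_ite] using h4
  · intro i _ hi
    have : (i : ℕ) ≠ x.1 := fun h => hi (Fin.ext h)
    simp [rowBlock, this]
  · simp

/-- Exponential stability of the companion matrix of a stable matrix polynomial. -/
theorem exists_norm_expm_companion_le (hM : M.Monic) (hd : M.natDegree = d)
    (hdet : ∀ z : ℂ, 0 ≤ z.re → (matEval M z).det ≠ 0) :
    ∃ K δ : ℝ, 0 < K ∧ 0 < δ ∧ ∀ t, 0 ≤ t → ‖expm (companion d M) t‖ ≤ K * Real.exp (-(δ * t)) :=
  exists_norm_expm_le fun z v hv h => re_lt_zero_of_companion_eigenvector hM hd hdet z v hv h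

end Transfer

/-! ### Integrals of stable matrix exponentials -/

section Stable

open Filter Topology

attribute [local instance] Matrix.linftyOpNormedAddCommGroup Matrix.linftyOpNormedSpace
  Matrix.linftyOpNormedRing Matrix.linftyOpNormedAlgebra

variable {ι κ κ' : Type*} [Fintype ι] [DecidableEq ι] {A : Matrix ι ι ℝ} {K δ : ℝ}

theorem hasDerivAt_expm_mulVec (A : Matrix ι ι ℝ) (v : ι → ℝ) (t : ℝ) :
    HasDerivAt (fun t => expm A t *ᵥ v) (expm A t *ᵥ (A *ᵥ v)) t := by
  let c : Matrix ι ι ℝ →L[ℝ] (ι → ℝ) := LinearMap.toContinuousLinearMap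
    { toFun := fun T => T *ᵥ v
      map_add' := fun S T => Matrix.add_mulVec S T v
      map_smul' := fun r T => Matrix.smul_mulVec r T v }
  rw [Matrix.mulVec_mulVec]
  exact c.hasFDerivAt.comp_hasDerivAt t (hasDerivAt_expm A t)

theorem hasDerivAt_cmap_expm_mulVec (A : Matrix ι ι ℝ) (v : ι → ℂ) (t : ℝ) :
    HasDerivAt (fun t => cmap (expm A t) *ᵥ v) (cmap A *ᵥ (cmap (expm A t) *ᵥ v)) t := by
  let c : Matrix ι ι ℝ →L[ℝ] (ι → ℂ) := LinearMap.toContinuousLinearMap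
    { toFun := fun T => cmap T *ᵥ v
      map_add' := fun S T => by
        rw [← Matrix.add_mulVec]; congr 1; ext; simp
      map_smul' := fun r T => by
        ext i; simp [Matrix.mulVec, dotProduct, Finset.mul_sum, mul_assoc] }
  rw [Matrix.mulVec_mulVec, ← cmap_mul, ← expm_mul_comm]
  exact c.hasFDerivAt.comp_hasDerivAt t (hasDerivAt_expm A t)

theorem continuous_expm_mulVec (A : Matrix ι ι ℝ) (v : ι → ℝ) :
    Continuous fun t => expm A t *ᵥ v :=
  continuous_iff_continuousAt.2 fun t => (hasDerivAt_expm_mulVec A v t).continuousAt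

theorem integrableOn_exp_neg_mul_Ioi (hδ : 0 < δ) :
    IntegrableOn (fun t : ℝ => Real.exp (-(δ * t))) (Set.Ioi 0) := by
  simpa [neg_mul] using exp_neg_integrableOn_Ioi 0 hδ

theorem tendsto_const_mul_exp_neg_atTop (hδ : 0 < δ) (c : ℝ) :
    Tendsto (fun t : ℝ => c * Real.exp (-(δ * t))) atTop (𝓝 0) := by
  have h1 : Tendsto (fun t : ℝ => -(δ * t)) atTop atBot :=
    tendsto_neg_atTop_atBot.comp (tendsto_id.const_mul_atTop hδ)
  simpa using (Real.tendsto_exp_atBot.comp h1).const_mul c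

theorem norm_expm_mulVec_le (hA : ∀ t, 0 ≤ t → ‖expm A t‖ ≤ K * Real.exp (-(δ * t))) {t : ℝ}
    (ht : 0 ≤ t) (v : ι → ℝ) : ‖expm A t *ᵥ v‖ ≤ K * ‖v‖ * Real.exp (-(δ * t)) := by
  refine (Matrix.linfty_opNorm_mulVec _ _).trans ?_
  rw [mul_right_comm]
  exact mul_le_mul_of_nonneg_right (hA t ht) (norm_nonneg v)

theorem integrableOn_expm_mulVec (hδ : 0 < δ)
    (hA : ∀ t, 0 ≤ t → ‖expm A t‖ ≤ K * Real.exp (-(δ * t))) (v : ι → ℝ) :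
    IntegrableOn (fun t => expm A t *ᵥ v) (Set.Ioi 0) := by
  refine Integrable.mono' ((integrableOn_exp_neg_mul_Ioi hδ).const_mul (K * ‖v‖))
    (continuous_expm_mulVec A v).aestronglyMeasurable ?_
  exact (ae_restrict_mem measurableSet_Ioi).mono fun t ht => norm_expm_mulVec_le hA (le_of_lt ht) v

theorem integral_expm_mulVec (hδ : 0 < δ)
    (hA : ∀ t, 0 ≤ t → ‖expm A t‖ ≤ K * Real.exp (-(δ * t))) (v : ι → ℝ) :
    ∫ t in Set.Ioi (0 : ℝ), expm A t *ᵥ (A *ᵥ v) = -v := by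
  have hlim : Tendsto (fun t => expm A t *ᵥ v) atTop (𝓝 0) :=
    squeeze_zero_norm' (eventually_atTop.2 ⟨0, fun t ht => norm_expm_mulVec_le hA ht v⟩)
      (tendsto_const_mul_exp_neg_atTop hδ _)
  rw [integral_Ioi_of_hasDerivAt_of_tendsto' (fun t _ => hasDerivAt_expm_mulVec A v t)
    (integrableOn_expm_mulVec hδ hA _) hlim, expm_zero, Matrix.one_mulVec, zero_sub]

/-- Multiplication by a matrix as a continuous linear map. -/
def mulVecCLM {𝕜 : Type*} [RCLike 𝕜] {κ ι : Type*} [Fintype κ] [Fintype ι] (S : Matrix κ ι 𝕜) :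
    (ι → 𝕜) →L[𝕜] (κ → 𝕜) :=
  LinearMap.toContinuousLinearMap S.mulVecLin

theorem mulVec_integral {𝕜 : Type*} [RCLike 𝕜] {κ ι α : Type*} [Fintype κ] [Fintype ι]
    [MeasurableSpace α] {ν : Measure α} (S : Matrix κ ι 𝕜) {f : α → ι → 𝕜}
    (hf : Integrable f ν) : ∫ x, S *ᵥ f x ∂ν = S *ᵥ ∫ x, f x ∂ν :=
  (mulVecCLM S).integral_comp_comm hf

theorem integrable_mulVec {𝕜 : Type*} [RCLike 𝕜] {κ ι α : Type*} [Fintype κ] [Fintype ι]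
    [MeasurableSpace α] {ν : Measure α} (S : Matrix κ ι 𝕜) {f : α → ι → 𝕜}
    (hf : Integrable f ν) : Integrable (fun x => S *ᵥ f x) ν :=
  (mulVecCLM S).integrable_comp hf

/-- The integrand has derivative `(iy + A)` times itself and decays, so the integral of the
derivative is minus the initial value. The resolvent relation follows without inverting a matrix. -/
theorem resolvent_integral (hδ : 0 < δ)
    (hA : ∀ t, 0 ≤ t → ‖expm A t‖ ≤ K * Real.exp (-(δ * t))) (y : ℝ) (v : ι → ℂ) :
    IntegrableOn (fun u : ℝ => Complex.exp (Complex.I * y * u) • (cmap (expm A u) *ᵥ v))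
      (Set.Ioi 0) ∧
    ((-(Complex.I * y)) • 1 - cmap A) *ᵥ
      ∫ u in Set.Ioi (0 : ℝ), Complex.exp (Complex.I * y * u) • (cmap (expm A u) *ᵥ v) = v := by
  have hnorm : ∀ u : ℝ, ‖Complex.exp (Complex.I * y * u)‖ = 1 := fun u => by
    rw [Complex.norm_exp]; simp
  have hcont : Continuous
      (fun u : ℝ => Complex.exp (Complex.I * y * u) • (cmap (expm A u) *ᵥ v)) := by
    refine Continuous.smul (Complex.continuous_exp.comp
      (continuous_const.mul Complex.continuous_ofReal)) ?_
    exact continuous_iff_continuousAt.2 fun t => (hasDerivAt_cmap_expm_mulVec A v t).continuousAt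
  have hbd : ∀ u : ℝ, 0 ≤ u → ‖Complex.exp (Complex.I * y * u) • (cmap (expm A u) *ᵥ v)‖ ≤
      K * ‖v‖ * Real.exp (-(δ * u)) := by
    intro u hu
    rw [norm_smul, hnorm, one_mul, mul_right_comm]
    refine (Matrix.linfty_opNorm_mulVec _ _).trans ?_
    refine mul_le_mul_of_nonneg_right ?_ (norm_nonneg v)
    exact (norm_map_ofReal _).trans_le (hA u hu)
  have hint : IntegrableOn (fun u : ℝ => Complex.exp (Complex.I * y * u) •
      (cmap (expm A u) *ᵥ v)) (Set.Ioi 0) := by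
    refine Integrable.mono' ((integrableOn_exp_neg_mul_Ioi hδ).const_mul (K * ‖v‖))
      hcont.aestronglyMeasurable ?_
    exact (ae_restrict_mem measurableSet_Ioi).mono fun t ht => hbd t (le_of_lt ht)
  refine ⟨hint, ?_⟩
  have hder : ∀ u ∈ Set.Ici (0 : ℝ),
      HasDerivAt (fun u : ℝ => Complex.exp (Complex.I * y * u) • (cmap (expm A u) *ᵥ v))
      (((Complex.I * y) • 1 + cmap A) *ᵥ
        (Complex.exp (Complex.I * y * u) • (cmap (expm A u) *ᵥ v))) u := by
    intro u _
    have h1 : HasDerivAt (fun u : ℝ => Complex.exp (Complex.I * y * u))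
        (Complex.exp (Complex.I * y * u) * (Complex.I * y)) u := by
      have := ((hasDerivAt_id (u : ℂ)).const_mul (Complex.I * y)).cexp.comp_ofReal
      simpa using this
    have h2 := h1.smul (hasDerivAt_cmap_expm_mulVec A v u)
    refine h2.congr_deriv ?_
    rw [Matrix.add_mulVec, Matrix.smul_mulVec, Matrix.one_mulVec, smul_smul,
      mul_comm (Complex.I * (y : ℂ)) (Complex.exp _), Matrix.mulVec_smul, add_comm]
  have hlim : Tendsto (fun u : ℝ => Complex.exp (Complex.I * y * u) • (cmap (expm A u) *ᵥ v)) atTop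
      (𝓝 0) :=
    squeeze_zero_norm' (eventually_atTop.2 ⟨0, hbd⟩) (tendsto_const_mul_exp_neg_atTop hδ _)
  have h := integral_Ioi_of_hasDerivAt_of_tendsto' hder (integrable_mulVec _ hint) hlim
  rw [mulVec_integral _ hint] at h
  have h3 : (-(Complex.I * y)) • (1 : Matrix ι ι ℂ) - cmap A = -((Complex.I * y) • 1 + cmap A) := by
    rw [neg_smul]; abel
  have h4 : cmap (1 : Matrix ι ι ℝ) = 1 := by ext a b; simp [Matrix.one_apply, apply_ite]
  rw [h3, Matrix.neg_mulVec, h]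
  simp [expm_zero, h4]

end Stable

/-! ### The kernel of a state-space model and its Fourier transform -/

section Kernel

open Filter Topology

attribute [local instance] Matrix.linftyOpNormedAddCommGroup Matrix.linftyOpNormedSpace
  Matrix.linftyOpNormedRing Matrix.linftyOpNormedAlgebra

variable {n d : ℕ} {M N : (Matrix (Fin n) (Fin n) ℝ)[X]} {K δ : ℝ}

theorem stateKernel_of_nonneg {t : ℝ} (ht : 0 ≤ t) : stateKernel d M N t =
    firstBlock n d * expm (companion d M) t * inputBlocks d M N := if_pos ht

theorem stateKernel_of_neg {t : ℝ} (ht : t < 0) : stateKernel d M N t = 0 := if_neg (not_le.2 ht)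

theorem stateKernel_apply_of_nonneg {t : ℝ} (ht : 0 ≤ t) (a b : Fin n) :
    stateKernel d M N t a b =
      (firstBlock n d *ᵥ (expm (companion d M) t *ᵥ (inputBlocks d M N).col b)) a := by
  rw [stateKernel_of_nonneg ht, Matrix.mulVec_mulVec, Matrix.mul_apply']; rfl

theorem stateKernel_eq_indicator (a b : Fin n) : (fun t => stateKernel d M N t a b) =
    (Set.Ici 0).indicator fun t =>
      (firstBlock n d *ᵥ (expm (companion d M) t *ᵥ (inputBlocks d M N).col b)) a := by
  funext t
  rcases le_or_gt 0 t with h | h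
  · rw [stateKernel_apply_of_nonneg h, Set.indicator_of_mem (Set.mem_Ici.2 h)]
  · rw [stateKernel_of_neg h, Set.indicator_of_notMem (by simpa using h)]; rfl

theorem continuous_stateKernel_branch (a b : Fin n) : Continuous fun t =>
    (firstBlock n d *ᵥ (expm (companion d M) t *ᵥ (inputBlocks d M N).col b)) a :=
  (continuous_apply a).comp
    ((mulVecCLM (firstBlock n d)).continuous.comp (continuous_expm_mulVec _ _))

theorem measurable_stateKernel (a b : Fin n) : Measurable fun t => stateKernel d M N t a b := by
  rw [stateKernel_eq_indicator]
  exact (continuous_stateKernel_branch a b).measurable.indicator measurableSet_Ici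

theorem exists_abs_stateKernel_le
    (hA : ∀ t, 0 ≤ t → ‖expm (companion d M) t‖ ≤ K * Real.exp (-(δ * t))) (a b : Fin n) :
    ∃ C, ∀ t, |stateKernel d M N t a b| ≤
      (Set.Ici 0).indicator (fun t => C * Real.exp (-(δ * t))) t := by
  refine ⟨‖firstBlock n d‖ * (K * ‖(inputBlocks d M N).col b‖), fun t => ?_⟩
  rcases le_or_gt 0 t with h | h
  · rw [stateKernel_apply_of_nonneg h, Set.indicator_of_mem (Set.mem_Ici.2 h)]
    rw [← Real.norm_eq_abs]
    refine (norm_le_pi_norm _ a).trans ((Matrix.linfty_opNorm_mulVec _ _).trans ?_)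
    rw [mul_assoc]
    exact mul_le_mul_of_nonneg_left (norm_expm_mulVec_le hA h _) (norm_nonneg _)
  · rw [stateKernel_of_neg h, Set.indicator_of_notMem (by simpa using h)]; simp

theorem integrable_indicator_exp (hδ : 0 < δ) (C : ℝ) :
    Integrable ((Set.Ici (0 : ℝ)).indicator fun t => C * Real.exp (-(δ * t))) := by
  rw [integrable_indicator_iff measurableSet_Ici, integrableOn_Ici_iff_integrableOn_Ioi]
  exact (integrableOn_exp_neg_mul_Ioi hδ).const_mul C

theorem inL1L2_of_abs_le (hδ : 0 < δ) {f : ℝ → ℝ} (hf : Measurable f) {C : ℝ}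
    (hC : ∀ t, |f t| ≤ (Set.Ici 0).indicator (fun t => C * Real.exp (-(δ * t))) t) :
    InL1L2 f := by
  have hm := hf.aestronglyMeasurable (μ := volume)
  constructor
  · rw [memLp_one_iff_integrable]
    exact (integrable_indicator_exp hδ C).mono' hm (Eventually.of_forall hC)
  · rw [memLp_two_iff_integrable_sq hm]
    refine (integrable_indicator_exp (δ := 2 * δ) (by positivity) (C ^ 2)).mono'
      (hm.pow 2) (Eventually.of_forall fun t => ?_)
    have h1 := hC t
    rw [Real.norm_eq_abs, abs_pow]
    rcases le_or_gt 0 t with h | h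
    · rw [Set.indicator_of_mem (Set.mem_Ici.2 h)] at h1 ⊢
      refine (pow_le_pow_left₀ (abs_nonneg _) h1 2).trans_eq ?_
      rw [mul_pow, ← Real.exp_nat_mul]; congr 2; push_cast; ring
    · rw [Set.indicator_of_notMem (by simpa using h)] at h1 ⊢
      rw [le_antisymm h1 (abs_nonneg _)]; simp

theorem inL1L2_stateKernel (hδ : 0 < δ)
    (hA : ∀ t, 0 ≤ t → ‖expm (companion d M) t‖ ≤ K * Real.exp (-(δ * t))) (a b : Fin n) :
    InL1L2 fun t => stateKernel d M N t a b := by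
  obtain ⟨C, hC⟩ := exists_abs_stateKernel_le (N := N) hA a b
  exact inL1L2_of_abs_le hδ (measurable_stateKernel a b) hC

/-- The Fourier transform of the kernel with transfer function `M⁻¹ N`. -/
theorem integral_exp_mul_stateKernel (hM : M.Monic) (hd : M.natDegree = d) (hN : N.degree < d)
    (hdet : ∀ z : ℂ, 0 ≤ z.re → (matEval M z).det ≠ 0) (y : ℝ) (a b : Fin n) :
    ∫ u : ℝ, Complex.exp (Complex.I * y * u) * (stateKernel d M N u a b : ℂ) =
      ((matEval M (-(Complex.I * y)))⁻¹ * matEval N (-(Complex.I * y))) a b := by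
  obtain ⟨K, δ, -, hδ, hA⟩ := exists_norm_expm_companion_le hM hd hdet
  set z : ℂ := -(Complex.I * y) with hz
  have hdet' : IsUnit (matEval M z).det := (hdet z (by simp [hz])).isUnit
  obtain ⟨hint, hres⟩ := resolvent_integral hδ hA y ((cmap (inputBlocks d M N)).col b)
  set w := ∫ u in Set.Ioi (0 : ℝ), Complex.exp (Complex.I * y * u) •
    (cmap (expm (companion d M) u) *ᵥ (cmap (inputBlocks d M N)).col b) with hw
  have h1 : matEval M z *ᵥ (cmap (firstBlock n d) *ᵥ w) = (matEval N z).col b := by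
    rw [Matrix.mulVec_mulVec, ← resolventRow_mul hM hd, ← Matrix.mulVec_mulVec, hres,
      ← resolventRow_mul_inputBlocks hM hd hN]
    rfl
  have h2 : cmap (firstBlock n d) *ᵥ w = ((matEval M z)⁻¹ * matEval N z).col b := by
    have := congrArg (fun v => (matEval M z)⁻¹ *ᵥ v) h1
    simp only [Matrix.mulVec_mulVec] at this
    rw [← Matrix.mul_assoc, Matrix.nonsing_inv_mul _ hdet', Matrix.one_mul] at this
    rw [this]; rfl
  have h3 : ((matEval M z)⁻¹ * matEval N z) a b = (cmap (firstBlock n d) *ᵥ w) a := by rw [h2]; rfl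
  rw [h3, hw, ← mulVec_integral _ hint]
  have h4 : ∀ f : ℝ → Fin n → ℂ, Integrable f (volume.restrict (Set.Ioi 0)) →
      (∫ u in Set.Ioi (0 : ℝ), f u) a = ∫ u in Set.Ioi (0 : ℝ), f u a := fun f hf =>
    ((ContinuousLinearMap.proj (R := ℂ) (φ := fun _ : Fin n => ℂ) a).integral_comp_comm hf).symm
  rw [h4 _ (integrable_mulVec _ hint), ← integral_Ici_eq_integral_Ioi,
    ← integral_indicator measurableSet_Ici]
  congr 1
  funext u
  rcases le_or_gt 0 u with h | h
  · rw [Set.indicator_of_mem (Set.mem_Ici.2 h), stateKernel_of_nonneg h, Matrix.mulVec_smul,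
      Pi.smul_apply, smul_eq_mul]
    congr 1
    rw [← cmap_apply, cmap_mul, cmap_mul, Matrix.mulVec_mulVec]
    rfl
  · rw [Set.indicator_of_notMem (by simpa using h), stateKernel_of_neg h]; simp

end Kernel

/-! ### Uniqueness of the kernel with a given transfer function -/

section Uniqueness

/-- Integrable real functions with the same Fourier transform agree almost everywhere. -/
theorem ae_eq_of_fourier_eq {f g : ℝ → ℝ} (hf : Integrable f) (hg : Integrable g)
    (h : ∀ y : ℝ, ∫ u : ℝ, Complex.exp (Complex.I * y * u) * (f u : ℂ) =
      ∫ u : ℝ, Complex.exp (Complex.I * y * u) * (g u : ℂ)) : f =ᵐ[volume] g := by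
  have hm : ∀ {φ : ℝ → ℝ}, Integrable φ →
      IsFiniteMeasure (volume.withDensity fun u => ENNReal.ofReal (φ u)) := fun hφ =>
    isFiniteMeasure_withDensity_ofReal hφ.2
  -- Moving negative parts across gives `f⁺ + g⁻` and `g⁺ + f⁻`, densities of finite measures, to
  -- which uniqueness of characteristic functions applies.
  set φ : ℝ → ℝ := fun u => max (f u) 0 + max (-g u) 0 with hφ
  set ψ : ℝ → ℝ := fun u => max (g u) 0 + max (-f u) 0 with hψ
  have hφi : Integrable φ := hf.pos_part.add hg.neg_part
  have hψi : Integrable ψ := hg.pos_part.add hf.neg_part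
  have hφ0 : ∀ u, 0 ≤ φ u := fun u => add_nonneg (le_max_right _ _) (le_max_right _ _)
  have hψ0 : ∀ u, 0 ≤ ψ u := fun u => add_nonneg (le_max_right _ _) (le_max_right _ _)
  have := hm hφi
  have := hm hψi
  have hdiff : ∀ u, φ u - ψ u = f u - g u := by
    intro u
    have h1 := max_zero_sub_max_neg_zero_eq_self (f u)
    have h2 := max_zero_sub_max_neg_zero_eq_self (g u)
    simp only [hφ, hψ]
    linarith
  have hchar : ∀ {θ : ℝ → ℝ}, Integrable θ → (∀ u, 0 ≤ θ u) → ∀ y : ℝ,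
      charFun (volume.withDensity fun u => ENNReal.ofReal (θ u)) y =
        ∫ u : ℝ, Complex.exp (Complex.I * y * u) * (θ u : ℂ) := by
    intro θ hθ hθ0 y
    rw [charFun_apply_real, integral_withDensity_eq_integral_toReal_smul₀
      hθ.aemeasurable.ennreal_ofReal (by simp)]
    congr 1
    funext u
    rw [ENNReal.toReal_ofReal (hθ0 u), Complex.real_smul, mul_comm]
    congr 2; ring
  have hexp : ∀ {θ : ℝ → ℝ}, Integrable θ → ∀ y : ℝ,
      Integrable fun u : ℝ => Complex.exp (Complex.I * y * u) * (θ u : ℂ) := by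
    intro θ hθ y
    refine hθ.ofReal.bdd_mul (c := 1) ?_ (Filter.Eventually.of_forall fun u => ?_)
    · exact (Complex.continuous_exp.comp
        (continuous_const.mul Complex.continuous_ofReal)).aestronglyMeasurable
    · rw [Complex.norm_exp]; simp
  have heq : (volume.withDensity fun u => ENNReal.ofReal (φ u)) =
      volume.withDensity fun u => ENNReal.ofReal (ψ u) := by
    refine Measure.ext_of_charFun (funext fun y => ?_)
    rw [hchar hφi hφ0, hchar hψi hψ0, ← sub_eq_zero, ← integral_sub (hexp hφi y) (hexp hψi y)]
    have : ∀ u : ℝ, Complex.exp (Complex.I * y * u) * (φ u : ℂ) -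
        Complex.exp (Complex.I * y * u) * (ψ u : ℂ) =
        Complex.exp (Complex.I * y * u) * (f u : ℂ) -
        Complex.exp (Complex.I * y * u) * (g u : ℂ) := by
      intro u
      rw [← mul_sub, ← mul_sub, ← Complex.ofReal_sub, ← Complex.ofReal_sub, hdiff]
    simp only [this]
    rw [integral_sub (hexp hf y) (hexp hg y), h y, sub_self]
  rw [withDensity_eq_iff_of_sigmaFinite hφi.aemeasurable.ennreal_ofReal
    hψi.aemeasurable.ennreal_ofReal] at heq
  filter_upwards [heq] with u hu
  rw [ENNReal.ofReal_eq_ofReal_iff (hφ0 u) (hψ0 u)] at hu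
  have := hdiff u
  linarith

end Uniqueness

/-! ### The kernel through which the past of the process enters -/

section PastKernel

open Filter Topology

attribute [local instance] Matrix.linftyOpNormedAddCommGroup Matrix.linftyOpNormedSpace
  Matrix.linftyOpNormedRing Matrix.linftyOpNormedAlgebra

variable {n p q : ℕ} {P Q : (Matrix (Fin n) (Fin n) ℝ)[X]}

/-- The matrix `∫_s^t g̃(t - u) (Iₙ, 0, …, 0) e^{(u - s) B} du`. -/
def matTheta (p q : ℕ) (P Q : (Matrix (Fin n) (Fin n) ℝ)[X]) (s t : ℝ) :
    Matrix (Fin n) (Fin q × Fin n) ℝ :=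
  Matrix.of fun a x => ∫ u in s..t, ((firstBlock n p * expm (matA p P) (t - u) * matE p P Q) *
    (firstBlock n q * expm (companion q Q) (u - s))) a x

theorem continuous_matTheta_integrand (s t : ℝ) : Continuous fun u =>
    (firstBlock n p * expm (matA p P) (t - u) * matE p P Q) *
    (firstBlock n q * expm (companion q Q) (u - s)) := by
  refine Continuous.matrix_mul ((continuous_const.matrix_mul ?_).matrix_mul continuous_const)
    (continuous_const.matrix_mul ?_)
  · exact (continuous_expm _).comp (continuous_const.sub continuous_id)
  · exact (continuous_expm _).comp (continuous_id.sub continuous_const)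

theorem intervalIntegral_mul_const_matrix {ι κ κ' : Type*} [Fintype κ] {S : ℝ → Matrix ι κ ℝ}
    (hS : Continuous S) (T : Matrix κ κ' ℝ) (s t : ℝ) (a : ι) (b : κ') :
    ∫ u in s..t, (S u * T) a b =
      ((Matrix.of fun a x => ∫ u in s..t, S u a x : Matrix ι κ ℝ) * T) a b := by
  simp only [Matrix.mul_apply, Matrix.of_apply]
  rw [intervalIntegral.integral_finsetSum]
  · simp only [intervalIntegral.integral_mul_const]
  · intro x _
    exact ((hS.matrix_elem a x).mul continuous_const).intervalIntegrable _ _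

/-- The semigroup property `e^{(u-v)B} = e^{(u-s)B} e^{(s-v)B}` separates the integration over `u`
from the dependence on `v`. -/
theorem pastKernel_eq {s t v : ℝ} (hst : s ≤ t) (hv : v ≤ s) : pastKernel p q P Q s t v =
    matTheta p q P Q s t * (expm (companion q Q) (s - v) * inputBlocks q Q (remPoly P Q)) := by
  ext a b
  rw [matTheta, ← intervalIntegral_mul_const_matrix (continuous_matTheta_integrand s t)]
  refine intervalIntegral.integral_congr fun u hu => ?_
  rw [Set.uIcc_of_le hst] at hu
  rw [gTilde, stateKernel_of_nonneg (by linarith [hu.2]), fKernel, ← remPoly,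
    stateKernel_of_nonneg (by linarith [hu.1]), show u - v = (u - s) + (s - v) by ring, expm_add]
  simp only [Matrix.mul_assoc]
  rfl

theorem matTheta_mul_matL [Nontrivial (Matrix (Fin n) (Fin n) ℝ)] (hP : P.Monic)
    (hp : P.natDegree = p) (hQ : Q.Monic) (hq : Q.natDegree = q) (hqp : q < p) (s t : ℝ) :
    matTheta p q P Q s t * matL p q P Q =
      firstBlock n p * expm (matA p P) (t - s) * (1 - matS p q P Q) := by
  ext a b
  rw [matTheta, ← intervalIntegral_mul_const_matrix (continuous_matTheta_integrand s t)]
  -- By `one_sub_matS_mul_matW`, and since `L e^{uW} = e^{uB} L`, the derivative of `firstBlock n p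
  -- * Y` is minus the integrand. At `u = t` this product vanishes because `e₁ᵀ S = e₁ᵀ`; at `u = s`
  -- it is the right-hand side.
  let Y : ℝ → Matrix (Fin p × Fin n) (Fin p × Fin n) ℝ := fun u =>
    expm (matA p P) (t - u) * ((1 - matS p q P Q) * expm (matW p q P Q) (u - s))
  have hY : ∀ u, HasDerivAt Y (-(expm (matA p P) (t - u) * matE p P Q *
      (firstBlock n q * expm (companion q Q) (u - s) * matL p q P Q))) u := by
    intro u
    have h1 : HasDerivAt (fun u => expm (matA p P) (t - u))
        (-(expm (matA p P) (t - u) * matA p P)) u :=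
      ((hasDerivAt_expm (matA p P) (t - u)).scomp u
        ((hasDerivAt_id u).const_sub t)).congr_deriv (by rw [neg_one_smul])
    have h2 : HasDerivAt (fun u => expm (matW p q P Q) (u - s))
        (matW p q P Q * expm (matW p q P Q) (u - s)) u :=
      ((hasDerivAt_expm (matW p q P Q) (u - s)).comp_sub_const u s).congr_deriv
        (expm_mul_comm _ _)
    have h3 := h1.mul (h2.const_mul (1 - matS p q P Q))
    refine h3.congr_deriv ?_
    have h4 := expm_intertwine (matL_mul_matW hP hp hQ hq hqp) (u - s)
    have h5 : (1 - matS p q P Q) * (matW p q P Q * expm (matW p q P Q) (u - s)) =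
        matA p P * ((1 - matS p q P Q) * expm (matW p q P Q) (u - s)) -
        matE p P Q * (firstBlock n q * expm (companion q Q) (u - s) * matL p q P Q) := by
      rw [← mul_assoc, one_sub_matS_mul_matW hP hp hQ hq hqp, sub_mul, mul_assoc]
      congr 1
      rw [Matrix.mul_assoc, Matrix.mul_assoc, h4, Matrix.mul_assoc]
    rw [h5]
    simp only [mul_sub, neg_mul, Matrix.mul_assoc]
    abel
  have hint : ∀ u, HasDerivAt (fun u => -(firstBlock n p * Y u) a b)
      ((firstBlock n p * expm (matA p P) (t - u) * matE p P Q *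
        (firstBlock n q * expm (companion q Q) (u - s)) * matL p q P Q) a b) u := by
    intro u
    let c : Matrix (Fin p × Fin n) (Fin p × Fin n) ℝ →L[ℝ] ℝ := LinearMap.toContinuousLinearMap
      { toFun := fun T => -(firstBlock n p * T) a b
        map_add' := fun T T' => by simp [Matrix.mul_add, add_comm]
        map_smul' := fun r T => by simp }
    refine (c.hasFDerivAt.comp_hasDerivAt u (hY u)).congr_deriv ?_
    have hc : ∀ T, c T = -((firstBlock n p * T) a b) := fun T => rfl
    refine (hc _).trans ?_
    rw [Matrix.mul_neg, Matrix.neg_apply, neg_neg]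
    simp only [Matrix.mul_assoc]
  rw [intervalIntegral.integral_eq_sub_of_hasDerivAt (fun u _ => hint u)]
  · have h0 : firstBlock n p * (1 - matS p q P Q) = 0 := by
      rw [Matrix.mul_sub, firstBlock_mul_matS hP hp hQ hq hqp, Matrix.mul_one, sub_self]
    have ht : firstBlock n p * Y t = 0 := by
      simp only [Y, sub_self, expm_zero, one_mul]
      rw [← Matrix.mul_assoc, h0, Matrix.zero_mul]
    have hs : firstBlock n p * Y s = firstBlock n p * expm (matA p P) (t - s) *
        (1 - matS p q P Q) := by
      simp only [Y, sub_self, expm_zero, mul_one]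
      rw [Matrix.mul_assoc]
    rw [ht, hs]
    simp
  · exact (((continuous_matTheta_integrand s t).matrix_mul continuous_const).matrix_elem
      a b).intervalIntegrable _ _

theorem firstBlock_mul_expm_mul_matS (t : ℝ) :
    firstBlock n p * expm (matA p P) t * matS p q P Q = ∑ j ∈ Finset.Icc 1 (p - q),
      gTildeJ p q P Q j t * (firstBlock n p * matA p P ^ (j - 1)) := by
  rw [matS_eq, Matrix.mul_sum]
  refine Finset.sum_congr rfl fun j _ => ?_
  rw [gTildeJ, ← Matrix.mul_assoc]

end PastKernel

/-! ### The state equation along a path -/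

section StateEquation

set_option linter.unusedSectionVars false

open Filter Topology

attribute [local instance] Matrix.linftyOpNormedAddCommGroup Matrix.linftyOpNormedSpace
  Matrix.linftyOpNormedRing Matrix.linftyOpNormedAlgebra

variable {ι κ : Type*} [Fintype ι] [DecidableEq ι] [Fintype κ] [DecidableEq κ]

/-- A measurable path of subexponential growth on average. -/
def Tempered {E : Type*} [NormedAddCommGroup E] [MeasurableSpace E] (ε : ℝ) (y : ℝ → E) : Prop :=
  Measurable y ∧ Integrable fun u : ℝ => Real.exp (-(ε * |u|)) * ‖y u‖

theorem Tempered.mulVec {ε : ℝ} {y : ℝ → κ → ℝ} (hy : Tempered ε y) (S : Matrix ι κ ℝ) :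
    Tempered ε fun u => S *ᵥ y u := by
  have hm : Measurable fun u => S *ᵥ y u := (mulVecCLM S).continuous.measurable.comp hy.1
  refine ⟨hm, (hy.2.const_mul ‖S‖).mono' ?_ (Eventually.of_forall fun u => ?_)⟩
  · exact (Continuous.measurable (by fun_prop)).aestronglyMeasurable.mul
      hm.norm.aestronglyMeasurable
  · rw [norm_mul, norm_norm, Real.norm_eq_abs, Real.abs_exp, mul_left_comm]
    exact mul_le_mul_of_nonneg_left (Matrix.linfty_opNorm_mulVec S (y u)) (Real.exp_nonneg _)

theorem Tempered.integrable_comp_sub {ε : ℝ} (hε : 0 ≤ ε) {y : ℝ → ι → ℝ} (hy : Tempered ε y)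
    (v : ℝ) : IntegrableOn (fun u => Real.exp (-(ε * (v - u))) * ‖y u‖) (Set.Iic v) := by
  refine Integrable.mono' (hy.2.const_mul (Real.exp (ε * |v|))).integrableOn ?_ ?_
  · exact (Continuous.measurable (by fun_prop)).aestronglyMeasurable.mul
      hy.1.norm.aestronglyMeasurable
  · refine (ae_restrict_mem measurableSet_Iic).mono fun u hu => ?_
    rw [norm_mul, norm_norm, Real.norm_eq_abs, Real.abs_exp, ← mul_assoc, ← Real.exp_add]
    refine mul_le_mul_of_nonneg_right (Real.exp_le_exp.2 ?_) (norm_nonneg _)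
    have h1 : |u| ≤ (v - u) + |v| := by
      have hu : u ≤ v := hu
      rcases abs_cases u with h | h <;> rcases abs_cases v with h' | h' <;> linarith
    nlinarith

theorem Tempered.integrableOn_Ioc {ε : ℝ} (hε : 0 ≤ ε) {y : ℝ → ι → ℝ} (hy : Tempered ε y)
    (s t : ℝ) : IntegrableOn y (Set.Ioc s t) := by
  refine Integrable.mono' ((hy.integrable_comp_sub hε t).mono_set
    Set.Ioc_subset_Iic_self |>.const_mul (Real.exp (ε * (t - s))))
    hy.1.aestronglyMeasurable ?_
  refine (ae_restrict_mem measurableSet_Ioc).mono fun u hu => ?_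
  rw [← mul_assoc, ← Real.exp_add]
  refine le_mul_of_one_le_left (norm_nonneg _) (Real.one_le_exp ?_)
  nlinarith [hu.1]

variable {A : Matrix ι ι ℝ} {K ε : ℝ}

/-- The kernel integrals are dominated. -/
theorem integrableOn_expm_sub_mulVec (hε : 0 ≤ ε) (hA : ∀ t, 0 ≤ t → ‖expm A t‖ ≤ K * Real.exp (-(ε * t)))
    {y : ℝ → ι → ℝ} (hy : Tempered ε y) (v : ℝ) :
    IntegrableOn (fun u => expm A (v - u) *ᵥ y u) (Set.Iic v) := by
  refine Integrable.mono' ((hy.integrable_comp_sub hε v).const_mul K) ?_ ?_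
  · refine Measurable.aestronglyMeasurable ?_
    refine measurable_pi_lambda _ fun i => ?_
    simp only [Matrix.mulVec, dotProduct]
    refine Finset.measurable_sum _ fun j _ => Measurable.mul ?_ ((measurable_pi_apply j).comp hy.1)
    exact ((((continuous_expm A).comp (continuous_const.sub continuous_id)).matrix_elem i j)).measurable
  · refine (ae_restrict_mem measurableSet_Iic).mono fun u hu => ?_
    refine (Matrix.linfty_opNorm_mulVec _ _).trans ?_
    rw [← mul_assoc]
    exact mul_le_mul_of_nonneg_right (hA _ (sub_nonneg.2 hu)) (norm_nonneg _)

/-- `∫_{-∞}^v e^{(v - u) A} y_u du`. -/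
def filtered (A : Matrix ι ι ℝ) (y : ℝ → ι → ℝ) (v : ℝ) : ι → ℝ :=
  ∫ u in Set.Iic v, expm A (v - u) *ᵥ y u

/-- The solution `∫_0^∞ e^{r A} A (y_{v - r} - y_v) dr` of the state equation `dG = A G dt + dy`. -/
def statePath (A : Matrix ι ι ℝ) (y : ℝ → ι → ℝ) (v : ℝ) : ι → ℝ :=
  ∫ r in Set.Ioi (0 : ℝ), expm A r *ᵥ (A *ᵥ (y (v - r) - y v))

theorem setIntegral_Iic_comp_sub {E : Type*} [NormedAddCommGroup E] [NormedSpace ℝ E] (f : ℝ → E)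
    (v : ℝ) : ∫ r in Set.Ioi (0 : ℝ), f (v - r) = ∫ u in Set.Iic v, f u := by
  rw [← integral_Ici_eq_integral_Ioi, ← integral_indicator measurableSet_Ici,
    ← integral_indicator measurableSet_Iic, ← integral_sub_left_eq_self _ volume v]
  congr 1
  funext r
  simp only [Set.indicator, Set.mem_Ici, Set.mem_Iic, sub_nonneg, sub_sub_cancel]

theorem integrableOn_Iic_comp_sub {E : Type*} [NormedAddCommGroup E] {f : ℝ → E}
    {v : ℝ} (hf : IntegrableOn f (Set.Iic v)) :
    IntegrableOn (fun r => f (v - r)) (Set.Ioi (0 : ℝ)) := by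
  rw [← integrableOn_Ici_iff_integrableOn_Ioi, ← integrable_indicator_iff measurableSet_Ici]
  rw [← integrable_indicator_iff measurableSet_Iic] at hf
  refine (hf.comp_sub_left v).congr (Eventually.of_forall fun r => ?_)
  simp only [Set.indicator, Set.mem_Ici, Set.mem_Iic, sub_le_self_iff]

/-- As `∫₀^∞ e^{rA} A dr = -1`, the term `y v` subtracted under the integral contributes `+ y v`.
The definition depends on increments only and suits stationarity; the form here exhibits the part
that integrates. -/
theorem statePath_eq (hε : 0 < ε) (hA : ∀ t, 0 ≤ t → ‖expm A t‖ ≤ K * Real.exp (-(ε * t)))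
    {y : ℝ → ι → ℝ} (hy : Tempered ε y) (v : ℝ) :
    statePath A y v = y v + A *ᵥ filtered A y v := by
  have h1 := integrableOn_Iic_comp_sub (integrableOn_expm_sub_mulVec hε.le hA (hy.mulVec A) v)
  simp only [sub_sub_cancel] at h1
  have h2 := integrableOn_expm_mulVec hε hA (A *ᵥ y v)
  have h3 : ∀ r, expm A r *ᵥ (A *ᵥ (y (v - r) - y v)) =
      expm A r *ᵥ (A *ᵥ y (v - r)) - expm A r *ᵥ (A *ᵥ y v) := fun r => by
    rw [Matrix.mulVec_sub, Matrix.mulVec_sub]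
  simp only [statePath, h3]
  rw [integral_sub h1 h2, integral_expm_mulVec hε hA, sub_neg_eq_add, add_comm]
  congr 1
  rw [filtered, ← mulVec_integral _ (integrableOn_expm_sub_mulVec hε.le hA hy v),
    ← setIntegral_Iic_comp_sub]
  simp only [sub_sub_cancel, Matrix.mulVec_mulVec, expm_mul_comm]

theorem filtered_eq (hε : 0 ≤ ε) (hA : ∀ t, 0 ≤ t → ‖expm A t‖ ≤ K * Real.exp (-(ε * t)))
    {y : ℝ → ι → ℝ} (hy : Tempered ε y) {s t : ℝ} (hst : s ≤ t) :
    filtered A y t = expm A (t - s) *ᵥ filtered A y s +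
      ∫ u in s..t, expm A (t - u) *ᵥ y u := by
  have ht := integrableOn_expm_sub_mulVec hε hA hy t
  have hs := integrableOn_expm_sub_mulVec hε hA hy s
  have h1 : ∫ u in Set.Iic s, expm A (t - u) *ᵥ y u = expm A (t - s) *ᵥ filtered A y s := by
    rw [filtered, ← mulVec_integral _ hs]
    refine setIntegral_congr_fun measurableSet_Iic fun u _ => ?_
    rw [Matrix.mulVec_mulVec, ← expm_add]; congr 2; ring
  rw [← h1, ← intervalIntegral.integral_Iic_sub_Iic (ht.mono_set (Set.Iic_subset_Iic.2 hst)) ht,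
    filtered]
  abel

theorem intervalIntegral_expm_sub (A : Matrix ι ι ℝ) (w : ι → ℝ) (s t : ℝ) :
    ∫ v in s..t, A *ᵥ (expm A (v - s) *ᵥ w) = expm A (t - s) *ᵥ w - w := by
  have h : ∀ v, HasDerivAt (fun v => expm A (v - s) *ᵥ w) (A *ᵥ (expm A (v - s) *ᵥ w)) v := by
    intro v
    refine ((hasDerivAt_expm_mulVec A w (v - s)).comp_sub_const v s).congr_deriv ?_
    rw [Matrix.mulVec_mulVec, Matrix.mulVec_mulVec, expm_mul_comm]
  rw [intervalIntegral.integral_eq_sub_of_hasDerivAt fun v _ => h v]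
  · simp [expm_zero]
  · refine Continuous.intervalIntegrable ?_ _ _
    exact (mulVecCLM A).continuous.comp
      (continuous_iff_continuousAt.2 fun v => (h v).continuousAt)

theorem intervalIntegral_expm_sub_left (A : Matrix ι ι ℝ) (w : ι → ℝ) (s t : ℝ) :
    ∫ v in s..t, A *ᵥ (expm A (t - v) *ᵥ w) = expm A (t - s) *ᵥ w - w := by
  rw [← intervalIntegral_expm_sub A w s t]
  have := intervalIntegral.integral_comp_sub_left (fun v => A *ᵥ (expm A (v - s) *ᵥ w)) (s + t)
    (a := s) (b := t)
  rw [show s + t - t = s by ring, show s + t - s = t by ring] at this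
  rw [← this]
  congr 1
  funext v
  congr 3; ring

theorem _root_.HasDerivAt.matrix_mulVec {S : ℝ → Matrix κ ι ℝ} {S' : Matrix κ ι ℝ}
    {w : ℝ → ι → ℝ} {w' : ι → ℝ} {v : ℝ} (hS : HasDerivAt S S' v) (hw : HasDerivAt w w' v) :
    HasDerivAt (fun v => S v *ᵥ w v) (S' *ᵥ w v + S v *ᵥ w') v := by
  refine hasDerivAt_pi.2 fun i => ?_
  have h1 : ∀ j, HasDerivAt (fun v => S v i j) (S' i j) v := fun j =>
    hasDerivAt_pi.1 (hasDerivAt_pi.1 hS i) j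
  have h2 := HasDerivAt.fun_sum (u := Finset.univ) fun j _ => (h1 j).mul (hasDerivAt_pi.1 hw j)
  refine h2.congr_deriv ?_
  rw [Pi.add_apply, Matrix.mulVec, Matrix.mulVec, dotProduct, dotProduct, Finset.sum_add_distrib]

/-- The increments of the solution of the state equation. -/
theorem statePath_eq_add (hε : 0 < ε) (hA : ∀ t, 0 ≤ t → ‖expm A t‖ ≤ K * Real.exp (-(ε * t)))
    {y : ℝ → ι → ℝ} (hy : Tempered ε y) {s t : ℝ} (hst : s ≤ t) :
    statePath A y t = expm A (t - s) *ᵥ statePath A y s + (y t - y s) +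
      A *ᵥ ∫ u in s..t, expm A (t - u) *ᵥ (y u - y s) := by
  have hint : IntervalIntegrable (fun u => expm A (t - u) *ᵥ y u) volume s t := by
    rw [intervalIntegrable_iff_integrableOn_Ioc_of_le hst]
    exact (integrableOn_expm_sub_mulVec hε.le hA hy t).mono_set Set.Ioc_subset_Iic_self
  have hcont : Continuous fun u => expm A (t - u) *ᵥ y s :=
    (continuous_expm_mulVec A (y s)).comp (continuous_const.sub continuous_id)
  have h1 : A *ᵥ ∫ u in s..t, expm A (t - u) *ᵥ y s = expm A (t - s) *ᵥ y s - y s := by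
    rw [← intervalIntegral_expm_sub_left A (y s) s t, intervalIntegral.integral_of_le hst,
      intervalIntegral.integral_of_le hst, mulVec_integral]
    exact (hcont.integrableOn_Icc).mono_set Set.Ioc_subset_Icc_self
  rw [statePath_eq hε hA hy, statePath_eq hε hA hy, filtered_eq hε.le hA hy hst]
  simp only [Matrix.mulVec_sub]
  rw [intervalIntegral.integral_sub hint (hcont.intervalIntegrable _ _), Matrix.mulVec_sub, h1,
    Matrix.mulVec_add, Matrix.mulVec_add, Matrix.mulVec_mulVec, Matrix.mulVec_mulVec,
    expm_mul_comm]
  abel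

theorem integral_triangle_swap {E : Type*} [NormedAddCommGroup E] [NormedSpace ℝ E]
    (ν : Measure ℝ) [SFinite ν] {k : ℝ → ℝ → E}
    (hk : Integrable (Function.uncurry fun v u => (Set.Iic v).indicator (k v) u) (ν.prod ν)) :
    ∫ v, ∫ u in Set.Iic v, k v u ∂ν ∂ν = ∫ u, ∫ v in Set.Ici u, k v u ∂ν ∂ν := by
  have h := integral_integral_swap hk
  convert h using 2
  · funext v
    rw [integral_indicator measurableSet_Iic]
  · funext u
    rw [← integral_indicator measurableSet_Ici]
    congr 1

theorem measurable_indicator_triangle {S : ℝ → ℝ → Matrix κ ι ℝ}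
    (hS : Continuous (Function.uncurry S)) {y : ℝ → ι → ℝ} (hy : Measurable y) :
    Measurable (Function.uncurry fun v u => (Set.Iic v).indicator (fun u => S v u *ᵥ y u) u) := by
  have h1 : (Function.uncurry fun v u => (Set.Iic v).indicator (fun u => S v u *ᵥ y u) u) =
      {x : ℝ × ℝ | x.2 ≤ x.1}.indicator fun x => S x.1 x.2 *ᵥ y x.2 := by
    funext x; rfl
  rw [h1]
  refine Measurable.indicator ?_ (measurableSet_le measurable_snd measurable_fst)
  refine measurable_pi_lambda _ fun i => ?_
  simp only [Matrix.mulVec, dotProduct]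
  refine Finset.measurable_sum _ fun j _ => Measurable.mul ?_
    ((measurable_pi_apply j).comp (hy.comp measurable_snd))
  exact (hS.matrix_elem i j).measurable

theorem continuous_uncurry_expm_sub (A : Matrix ι ι ℝ) (S : Matrix κ ι ℝ) :
    Continuous (Function.uncurry fun v u : ℝ => S * expm A (v - u)) :=
  continuous_const.matrix_mul ((continuous_expm A).comp (continuous_fst.sub continuous_snd))

/-- The integrated form of `dW = G dt`. -/
theorem filtered_sub_filtered (hε : 0 < ε)
    (hA : ∀ t, 0 ≤ t → ‖expm A t‖ ≤ K * Real.exp (-(ε * t)))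
    {y : ℝ → ι → ℝ} (hy : Tempered ε y) {s t : ℝ} (hst : s ≤ t) :
    IntervalIntegrable (statePath A y) volume s t ∧
    filtered A y t - filtered A y s = ∫ v in s..t, statePath A y v := by
  set ν := volume.restrict (Set.Ioc s t) with hν
  have hyint : Integrable y ν := hy.integrableOn_Ioc hε.le s t
  have hK : 0 ≤ K := by have := (norm_nonneg _).trans (hA 0 le_rfl); simpa using this
  -- Fubini on the triangle `s < u ≤ v ≤ t`: for fixed `u` the integral over `v` of `A e^{(v-u)A}`
  -- is `e^{(t-u)A} - 1`.
  have hk : Integrable (Function.uncurry fun v u =>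
      (Set.Iic v).indicator (fun u => (A * expm A (v - u)) *ᵥ y u) u) (ν.prod ν) := by
    have hdom : Integrable (fun x : ℝ × ℝ => (‖A‖ * K) * ‖y x.2‖) (ν.prod ν) :=
      (hyint.norm.comp_snd ν).const_mul _
    refine hdom.mono' (measurable_indicator_triangle (continuous_uncurry_expm_sub A A)
      hy.1).aestronglyMeasurable (Eventually.of_forall fun x => ?_)
    simp only [Function.uncurry, Set.indicator]
    split_ifs with h
    · refine (Matrix.linfty_opNorm_mulVec _ _).trans
        (mul_le_mul_of_nonneg_right ?_ (norm_nonneg _))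
      refine (norm_mul_le _ _).trans (mul_le_mul_of_nonneg_left ?_ (norm_nonneg _))
      have h0 : 0 ≤ x.1 - x.2 := sub_nonneg.2 h
      refine (hA _ h0).trans (mul_le_of_le_one_right hK (Real.exp_le_one_iff.2 ?_))
      nlinarith
    · rw [norm_zero]; positivity
  have hsw := integral_triangle_swap ν hk
  have hrest : ∀ v ∈ Set.Ioc s t, ∫ u in Set.Iic v, (A * expm A (v - u)) *ᵥ y u ∂ν =
      A *ᵥ ∫ u in s..v, expm A (v - u) *ᵥ y u := by
    intro v hv
    have hi := (integrableOn_expm_sub_mulVec hε.le hA hy v).mono_set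
      (Set.Ioc_subset_Iic_self (a := s))
    rw [hν, Measure.restrict_restrict measurableSet_Iic,
      show Set.Iic v ∩ Set.Ioc s t = Set.Ioc s v by
        ext u; simp only [Set.mem_inter_iff, Set.mem_Iic, Set.mem_Ioc]
        exact ⟨fun h => ⟨h.2.1, h.1⟩, fun h => ⟨h.2, h.1, h.2.trans hv.2⟩⟩,
      intervalIntegral.integral_of_le hv.1.le, ← mulVec_integral _ hi]
    simp only [Matrix.mulVec_mulVec]
  have hrest2 : ∀ u ∈ Set.Ioc s t, ∫ v in Set.Ici u, (A * expm A (v - u)) *ᵥ y u ∂ν =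
      expm A (t - u) *ᵥ y u - y u := by
    intro u hu
    rw [← intervalIntegral_expm_sub A (y u) u t, intervalIntegral.integral_of_le hu.2, hν,
      Measure.restrict_restrict measurableSet_Ici,
      show Set.Ici u ∩ Set.Ioc s t = Set.Icc u t by
        ext v; simp only [Set.mem_inter_iff, Set.mem_Ici, Set.mem_Icc, Set.mem_Ioc]
        exact ⟨fun h => ⟨h.1, h.2.2⟩, fun h => ⟨h.1, hu.1.trans_le h.1, h.2⟩⟩,
      integral_Icc_eq_integral_Ioc]
    simp only [Matrix.mulVec_mulVec]
  have hint : Integrable (fun v => A *ᵥ ∫ u in s..v, expm A (v - u) *ᵥ y u) ν := by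
    refine hk.integral_prod_left.congr ?_
    refine (ae_restrict_mem measurableSet_Ioc).mono fun v hv => ?_
    exact (integral_indicator measurableSet_Iic).trans (hrest v hv)
  have hint0 : Integrable (fun v => A *ᵥ (expm A (v - s) *ᵥ filtered A y s)) ν := by
    have : Continuous fun v => A *ᵥ (expm A (v - s) *ᵥ filtered A y s) :=
      (mulVecCLM A).continuous.comp
        ((continuous_expm_mulVec A _).comp (continuous_id.sub continuous_const))
    exact this.integrableOn_Icc.mono_set Set.Ioc_subset_Icc_self
  have hG : ∀ v ∈ Set.Ioc s t, statePath A y v = y v + (A *ᵥ (expm A (v - s) *ᵥ filtered A y s) +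
      A *ᵥ ∫ u in s..v, expm A (v - u) *ᵥ y u) := by
    intro v hv
    rw [statePath_eq hε hA hy, filtered_eq hε.le hA hy hv.1.le, Matrix.mulVec_add]
  refine ⟨?_, ?_⟩
  · rw [intervalIntegrable_iff_integrableOn_Ioc_of_le hst]
    refine (hyint.add (hint0.add hint)).congr ?_
    exact (ae_restrict_mem measurableSet_Ioc).mono fun v hv => (hG v hv).symm
  · have hi := (integrableOn_expm_sub_mulVec hε.le hA hy t).mono_set
      (Set.Ioc_subset_Iic_self (a := s))
    have hsum : ∫ v in Set.Ioc s t, (y v + (A *ᵥ (expm A (v - s) *ᵥ filtered A y s) +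
        A *ᵥ ∫ u in s..v, expm A (v - u) *ᵥ y u)) = (∫ v in Set.Ioc s t, y v) +
        ((∫ v in Set.Ioc s t, A *ᵥ (expm A (v - s) *ᵥ filtered A y s)) +
          ∫ v in Set.Ioc s t, A *ᵥ ∫ u in s..v, expm A (v - u) *ᵥ y u) :=
      (integral_add hyint (hint0.add hint)).trans (congrArg _ (integral_add hint0 hint))
    rw [intervalIntegral.integral_of_le hst, setIntegral_congr_fun measurableSet_Ioc hG, hsum,
      ← intervalIntegral.integral_of_le hst (f := fun v => A *ᵥ (expm A (v - s) *ᵥ filtered A y s)),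
      intervalIntegral_expm_sub, ← setIntegral_congr_fun measurableSet_Ioc hrest, hsw,
      setIntegral_congr_fun measurableSet_Ioc hrest2, integral_sub hi hyint,
      filtered_eq hε.le hA hy hst, intervalIntegral.integral_of_le hst]
    abel

/-- The state of a filter driven by `D G` is a linear function of `G`. -/
theorem integral_expm_mulVec_statePath {B : Matrix κ κ ℝ} {L D : Matrix κ ι ℝ} (hε : 0 < ε)
    (hA : ∀ t, 0 ≤ t → ‖expm A t‖ ≤ K * Real.exp (-(2 * ε * t)))
    (hB : ∀ t, 0 ≤ t → ‖expm B t‖ ≤ K * Real.exp (-(2 * ε * t)))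
    (hL : L * A = B * L + D) {y : ℝ → ι → ℝ} (hy : Tempered ε y) (hLy : ∀ u, L *ᵥ y u = 0)
    (s : ℝ) :
    IntegrableOn (fun v => expm B (s - v) *ᵥ (D *ᵥ statePath A y v)) (Set.Iic s) ∧
    ∫ v in Set.Iic s, expm B (s - v) *ᵥ (D *ᵥ statePath A y v) = L *ᵥ statePath A y s := by
  have hK : 0 ≤ K := by have := (norm_nonneg _).trans (hA 0 le_rfl); simpa using this
  have hA' : ∀ t, 0 ≤ t → ‖expm A t‖ ≤ K * Real.exp (-(ε * t)) := fun t ht =>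
    (hA t ht).trans (mul_le_mul_of_nonneg_left (Real.exp_le_exp.2 (by nlinarith)) hK)
  have hB' : ∀ t, 0 ≤ t → ‖expm B t‖ ≤ K * Real.exp (-(ε * t)) := fun t ht =>
    (hB t ht).trans (mul_le_mul_of_nonneg_left (Real.exp_le_exp.2 (by nlinarith)) hK)
  set ν := volume.restrict (Set.Iic s) with hν
  have hcont : Continuous (Function.uncurry fun v u : ℝ => expm B (s - v) * (D * A * expm A (v - u))) :=
    ((continuous_expm B).comp (continuous_const.sub continuous_fst)).matrix_mul
      (continuous_uncurry_expm_sub A (D * A))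
  have hk : Integrable (Function.uncurry fun v u => (Set.Iic v).indicator
      (fun u => (expm B (s - v) * (D * A * expm A (v - u))) *ᵥ y u) u) (ν.prod ν) := by
    have hi1 : Integrable (fun v => Real.exp (-(ε * (s - v)))) ν := by
      have h := (integrableOn_exp_neg_mul_Ioi hε)
      rw [← integrableOn_Ici_iff_integrableOn_Ioi, ← integrable_indicator_iff measurableSet_Ici] at h
      rw [hν, ← IntegrableOn, ← integrable_indicator_iff measurableSet_Iic]
      refine (h.comp_sub_left s).congr (Eventually.of_forall fun r => ?_)
      simp only [Set.indicator, Set.mem_Ici, Set.mem_Iic, sub_nonneg]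
    have hi2 : Integrable (fun u => Real.exp (-(ε * (s - u))) * ‖y u‖) ν :=
      hy.integrable_comp_sub hε.le s
    have hdom := (hi1.mul_prod hi2).const_mul (K * ‖D * A‖ * K)
    refine hdom.mono' (measurable_indicator_triangle hcont hy.1).aestronglyMeasurable ?_
    have hmem : ∀ᵐ x ∂(ν.prod ν), x.1 ≤ s := by
      have := (ae_restrict_mem (μ := (volume : Measure ℝ)) (measurableSet_Iic (a := s)))
      exact Measure.quasiMeasurePreserving_fst.ae this
    filter_upwards [hmem] with x hx
    simp only [Function.uncurry, Set.indicator]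
    split_ifs with h
    · have h0 : 0 ≤ x.1 - x.2 := sub_nonneg.2 h
      refine (Matrix.linfty_opNorm_mulVec _ _).trans ?_
      have h1 : ‖expm B (s - x.1) * (D * A * expm A (x.1 - x.2))‖ ≤
          (K * Real.exp (-(2 * ε * (s - x.1)))) *
            (‖D * A‖ * (K * Real.exp (-(2 * ε * (x.1 - x.2))))) := by
        refine (Matrix.linfty_opNorm_mul _ _).trans (mul_le_mul (hB _ (sub_nonneg.2 hx)) ?_
          (norm_nonneg _) (by positivity))
        exact (Matrix.linfty_opNorm_mul _ _).trans
          (mul_le_mul_of_nonneg_left (hA _ h0) (norm_nonneg _))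
      refine (mul_le_mul_of_nonneg_right h1 (norm_nonneg _)).trans ?_
      -- For `u ≤ v ≤ s` the total decay `2ε(s - u)` is shared: one half weights the path at `u`,
      -- the other half is at least `ε(s - v)` and makes the integral over `v` converge.
      have h2 : Real.exp (-(2 * ε * (s - x.1))) * Real.exp (-(2 * ε * (x.1 - x.2))) ≤
          Real.exp (-(ε * (s - x.1))) * Real.exp (-(ε * (s - x.2))) := by
        rw [← Real.exp_add, ← Real.exp_add]
        exact Real.exp_le_exp.2 (by nlinarith)
      calc _ = (K * ‖D * A‖ * K) * (Real.exp (-(2 * ε * (s - x.1))) *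
            Real.exp (-(2 * ε * (x.1 - x.2)))) * ‖y x.2‖ := by ring
        _ ≤ (K * ‖D * A‖ * K) * (Real.exp (-(ε * (s - x.1))) * Real.exp (-(ε * (s - x.2)))) *
            ‖y x.2‖ := mul_le_mul_of_nonneg_right
              (mul_le_mul_of_nonneg_left h2 (by positivity)) (norm_nonneg _)
        _ = _ := by ring
    · rw [norm_zero]; positivity
  have hsw := integral_triangle_swap ν hk
  have hrest : ∀ v ∈ Set.Iic s,
      ∫ u in Set.Iic v, (expm B (s - v) * (D * A * expm A (v - u))) *ᵥ y u ∂ν =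
      expm B (s - v) *ᵥ (D *ᵥ (A *ᵥ filtered A y v)) := by
    intro v hv
    rw [hν, Measure.restrict_restrict measurableSet_Iic, Set.Iic_inter_Iic, min_eq_left hv,
      Matrix.mulVec_mulVec, Matrix.mulVec_mulVec, filtered,
      ← mulVec_integral _ (integrableOn_expm_sub_mulVec hε.le hA' hy v)]
    simp only [Matrix.mulVec_mulVec, Matrix.mul_assoc]
  have hrest2 : ∀ u ∈ Set.Iic s,
      ∫ v in Set.Ici u, (expm B (s - v) * (D * A * expm A (v - u))) *ᵥ y u ∂ν =
      L *ᵥ (A *ᵥ (expm A (s - u) *ᵥ y u)) - expm B (s - u) *ᵥ (D *ᵥ y u) := by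
    intro u hu
    -- Because `D = L A - B L`, the kernel is an exact derivative in `v`, and the inner integral
    -- reduces to boundary terms.
    have hder : ∀ v, HasDerivAt (fun v => expm B (s - v) *ᵥ (L *ᵥ (A *ᵥ (expm A (v - u) *ᵥ y u))))
        ((expm B (s - v) * (D * A * expm A (v - u))) *ᵥ y u) v := by
      intro v
      have hBd : HasDerivAt (fun v => expm B (s - v)) (-(expm B (s - v) * B)) v :=
        ((hasDerivAt_expm B (s - v)).scomp v
          ((hasDerivAt_id v).const_sub s)).congr_deriv (by rw [neg_one_smul])
      have hAd : HasDerivAt (fun v => L *ᵥ (A *ᵥ (expm A (v - u) *ᵥ y u)))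
          (L *ᵥ (A *ᵥ (expm A (v - u) *ᵥ (A *ᵥ y u)))) v :=
        ((mulVecCLM L).comp (mulVecCLM A)).hasFDerivAt.comp_hasDerivAt v
          ((hasDerivAt_expm_mulVec A (y u) (v - u)).comp_sub_const v u)
      refine (hBd.matrix_mulVec hAd).congr_deriv ?_
      have h1 : D = L * A - B * L := by rw [hL]; abel
      rw [h1]
      simp only [Matrix.mulVec_mulVec, ← Matrix.add_mulVec]
      congr 1
      rw [expm_mul_comm A]
      simp only [Matrix.sub_mul, Matrix.mul_sub, Matrix.neg_mul, Matrix.mul_assoc]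
      abel
    have hcu : Continuous fun v => (expm B (s - v) * (D * A * expm A (v - u))) *ᵥ y u :=
      (hcont.comp (Continuous.prodMk continuous_id continuous_const)).matrix_mulVec continuous_const
    rw [hν, Measure.restrict_restrict measurableSet_Ici, Set.Ici_inter_Iic,
      integral_Icc_eq_integral_Ioc, ← intervalIntegral.integral_of_le hu,
      intervalIntegral.integral_eq_sub_of_hasDerivAt (fun v _ => hder v)
        (hcu.intervalIntegrable _ _), sub_self, sub_self, expm_zero, expm_zero, Matrix.one_mulVec,
      Matrix.one_mulVec]
    -- In the boundary term at `v = u`, `L A y = B L y + D y` reduces to `D y` since `L y = 0`. It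
    -- cancels the direct contribution of `y` to the input.
    congr 2
    rw [Matrix.mulVec_mulVec, hL, Matrix.add_mulVec, ← Matrix.mulVec_mulVec, hLy,
      Matrix.mulVec_zero, zero_add]
  have hi0 : Integrable (fun v => expm B (s - v) *ᵥ (D *ᵥ y v)) ν :=
    integrableOn_expm_sub_mulVec hε.le hB' (hy.mulVec D) s
  have hi1 : Integrable (fun v => expm B (s - v) *ᵥ (D *ᵥ (A *ᵥ filtered A y v))) ν := by
    refine hk.integral_prod_left.congr ?_
    refine (ae_restrict_mem measurableSet_Iic).mono fun v hv => ?_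
    exact (integral_indicator measurableSet_Iic).trans (hrest v hv)
  have hi2 : Integrable (fun u => expm A (s - u) *ᵥ y u) ν :=
    integrableOn_expm_sub_mulVec hε.le hA' hy s
  have hG : ∀ v, expm B (s - v) *ᵥ (D *ᵥ statePath A y v) = expm B (s - v) *ᵥ (D *ᵥ y v) +
      expm B (s - v) *ᵥ (D *ᵥ (A *ᵥ filtered A y v)) := by
    intro v
    rw [statePath_eq hε hA' hy, Matrix.mulVec_add, Matrix.mulVec_add]
  simp only [hG]
  refine ⟨hi0.add hi1, ?_⟩
  have hsum : ∫ u in Set.Iic s, (L *ᵥ (A *ᵥ (expm A (s - u) *ᵥ y u)) -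
      expm B (s - u) *ᵥ (D *ᵥ y u)) = L *ᵥ (A *ᵥ filtered A y s) -
      ∫ u in Set.Iic s, expm B (s - u) *ᵥ (D *ᵥ y u) := by
    rw [integral_sub (integrable_mulVec L (integrable_mulVec A hi2)) hi0,
      mulVec_integral L (integrable_mulVec A hi2), mulVec_integral A hi2]
    rfl
  rw [integral_add hi0 hi1, ← setIntegral_congr_fun measurableSet_Iic hrest, hsw,
    setIntegral_congr_fun measurableSet_Iic hrest2, hsum, add_sub_cancel, statePath_eq hε hA' hy,
    Matrix.mulVec_add, hLy, zero_add]

end StateEquation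

/-! ### Conditional expectations -/

section CondExp

open Filter Topology

set_option linter.unusedSectionVars false

variable {α Ω E : Type*} [MeasurableSpace α] {m m₁ m₂ m0 : MeasurableSpace Ω} {μ : Measure Ω}
  [IsProbabilityMeasure μ] [NormedAddCommGroup E] [NormedSpace ℝ E] [CompleteSpace E]

/-- The conditional expectation is symmetric. -/
theorem setIntegral_condExp_eq_integral_smul (hm : m ≤ m0) {f : Ω → E} (hf : Integrable f μ)
    {S : Set Ω} (hS : MeasurableSet S) :
    ∫ ω in S, (μ[f | m]) ω ∂μ = ∫ ω, (μ[S.indicator (fun _ => (1 : ℝ)) | m]) ω • f ω ∂μ := by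
  set φ : Ω → ℝ := S.indicator fun _ => 1 with hφ
  have hφm : Measurable φ := measurable_const.indicator hS
  have hφb : ∀ ω, |φ ω| ≤ (1 : ℝ) := fun ω => by
    by_cases h : ω ∈ S <;> simp [hφ, h]
  have hφi : Integrable φ μ := (integrable_const (1 : ℝ)).indicator hS
  have hψb := ae_bdd_abs_condExp_of_ae_bdd_abs (m := m) (μ := μ) (Eventually.of_forall hφb)
  have h1 : Integrable (φ • μ[f | m]) μ :=
    (integrable_condExp (f := f) (m := m) (μ := μ)).bdd_smul 1 hφm.aestronglyMeasurable
      (Eventually.of_forall fun ω => by simpa using hφb ω)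
  have h2 : Integrable (μ[φ | m] • f) μ := hf.bdd_smul 1
    integrable_condExp.aestronglyMeasurable (hψb.mono fun ω h => by simpa using h)
  -- Pulling out the measurable factor on either side gives the same product of conditional
  -- expectations.
  have e1 := condExp_smul_of_aestronglyMeasurable_right hφi h1
    stronglyMeasurable_condExp.aestronglyMeasurable
  have e2 := condExp_smul_of_aestronglyMeasurable_left (m := m)
    (stronglyMeasurable_condExp (f := φ) (μ := μ)).aestronglyMeasurable h2 hf
  have e3 := integral_congr_ae (e1.trans e2.symm)
  rw [integral_condExp hm, integral_condExp hm] at e3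
  rw [← integral_indicator hS]
  refine Eq.trans (integral_congr_ae (Eventually.of_forall fun ω => ?_)) e3
  by_cases h : ω ∈ S <;> simp [hφ, h]

/-- Conditional expectations may be taken under an integral sign. -/
theorem condExp_integral (hm : m ≤ m0) {ν : Measure α} [SFinite ν] {Y W : α → Ω → E}
    (hY : Integrable (Function.uncurry Y) (ν.prod μ))
    (hW : AEStronglyMeasurable (Function.uncurry W) (ν.prod μ))
    (h : ∀ᵐ u ∂ν, W u =ᵐ[μ] μ[Y u | m]) :
    Integrable (Function.uncurry W) (ν.prod μ) ∧
      μ[fun ω => ∫ u, Y u ω ∂ν | m] =ᵐ[μ] fun ω => ∫ u, W u ω ∂ν := by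
  have hYi := (integrable_prod_iff hY.aestronglyMeasurable).1 hY
  -- Conditional expectation contracts the `L¹` norm for almost every `u`, so `W` inherits
  -- integrability from `Y`.
  have hWi : Integrable (Function.uncurry W) (ν.prod μ) := by
    refine (integrable_prod_iff hW).2 ⟨?_, ?_⟩
    · filter_upwards [h] with u hu
      exact (integrable_congr hu).2 integrable_condExp
    · refine hYi.2.mono' hW.norm.integral_prod_right' ?_
      filter_upwards [h] with u hu
      rw [Real.norm_of_nonneg (integral_nonneg fun _ => norm_nonneg _)]
      have : ∫ ω, ‖W u ω‖ ∂μ = ∫ ω, ‖(μ[Y u | m]) ω‖ ∂μ :=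
        integral_congr_ae (hu.mono fun ω hω => by simp only [hω])
      simp only [Function.uncurry_apply_pair, this]
      exact integral_norm_condExp_le _
  refine ⟨hWi, ?_⟩
  have hYint : Integrable (fun ω => ∫ u, Y u ω ∂ν) μ := hY.integral_prod_right
  -- The integral of `W` is not known to be measurable for `m`, so it is tested on all measurable
  -- sets. By symmetry the conditional expectation moves to the indicator, where it does not depend
  -- on `u`; Fubini applies, and it moves back for each `u`.
  refine Integrable.ae_eq_of_forall_setIntegral_eq _ _ integrable_condExp hWi.integral_prod_right
    fun S hS _ => ?_
  rw [setIntegral_condExp_eq_integral_smul hm hYint hS]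
  set φ : Ω → ℝ := S.indicator fun _ => 1 with hφ
  have hφb : ∀ ω, |φ ω| ≤ (1 : ℝ) := fun ω => by
    by_cases h : ω ∈ S <;> simp [hφ, h]
  have hψb := ae_bdd_abs_condExp_of_ae_bdd_abs (m := m) (μ := μ) (Eventually.of_forall hφb)
  have hψm : AEStronglyMeasurable (μ[φ | m]) μ := integrable_condExp.aestronglyMeasurable
  have hYψ : Integrable (Function.uncurry fun u ω => (μ[φ | m]) ω • Y u ω) (ν.prod μ) :=
    hY.bdd_smul (φ := fun x : α × Ω => (μ[φ | m]) x.2) 1 hψm.comp_snd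
      ((Measure.quasiMeasurePreserving_snd.ae hψb).mono fun x h => by simpa using h)
  simp_rw [← integral_smul]
  rw [← integral_integral_swap hYψ]
  have hWS : Integrable (Function.uncurry W) (ν.prod (μ.restrict S)) := by
    rw [← Measure.restrict_univ (μ := ν), Measure.prod_restrict]; exact hWi.restrict
  rw [← integral_integral_swap (f := W) hWS]
  refine integral_congr_ae ?_
  filter_upwards [h, hYi.1] with u hu hYu
  refine (setIntegral_condExp_eq_integral_smul hm hYu hS).symm.trans ?_
  exact setIntegral_congr_ae hS (hu.mono fun ω hω _ => hω.symm)

/-- An integral of functions that are measurable up to null sets is so as well. -/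
theorem aestronglyMeasurable_integral_of_forall (hm : m ≤ m0) {ν : Measure α} [SFinite ν]
    {Y : α → Ω → E} (hY : Integrable (Function.uncurry Y) (ν.prod μ))
    (h : ∀ᵐ u ∂ν, AEStronglyMeasurable[m] (Y u) μ) :
    AEStronglyMeasurable[m] (fun ω => ∫ u, Y u ω ∂ν) μ := by
  have hYi := (integrable_prod_iff hY.aestronglyMeasurable).1 hY
  refine ⟨_, stronglyMeasurable_condExp,
    (condExp_integral hm hY hY.aestronglyMeasurable ?_).2.symm⟩
  filter_upwards [h, hYi.1] with u hu hYu
  exact (condExp_of_aestronglyMeasurable' hm hu hYu).symm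

variable [MeasurableSpace E] [BorelSpace E]

theorem comap_le_eventuallyMeasurableSpace {f : Ω → E} (hf : AEStronglyMeasurable[m] f μ) :
    MeasurableSpace.comap f inferInstance ≤ eventuallyMeasurableSpace m (ae μ) := by
  rw [← measurable_iff_comap_le]
  obtain ⟨g, hg, hfg⟩ := hf
  exact Measurable.eventuallyMeasurable_of_eventuallyEq (m := m) hg.measurable hfg

/-- Conditional expectations do not change if the σ-algebra is changed by null sets. -/
theorem condExp_eq_of_le_eventuallyMeasurableSpace
    (h₁ : m₁ ≤ m₂) (h₂ : m₂ ≤ m0) (h : m₂ ≤ eventuallyMeasurableSpace m₁ (ae μ)) (f : Ω → E) :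
    μ[f | m₁] =ᵐ[μ] μ[f | m₂] := by
  by_cases hf : Integrable f μ
  · refine ae_eq_condExp_of_forall_setIntegral_eq h₂ hf
      (fun S _ _ => integrable_condExp.integrableOn) (fun S hS _ => ?_)
      (stronglyMeasurable_condExp.mono h₁).aestronglyMeasurable
    obtain ⟨T, hT, hST⟩ := h S hS
    rw [setIntegral_congr_set hST, setIntegral_congr_set hST,
      setIntegral_condExp (h₁.trans h₂) hf hT]
  · rw [condExp_of_not_integrable hf, condExp_of_not_integrable hf]

/-- Neither σ-algebra need contain the other, so both are compared with their join. -/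
theorem condExp_eq_of_eventuallyMeasurableSpace
    (h₁ : m₁ ≤ m0) (h₂ : m₂ ≤ m0) (h₁₂ : m₁ ≤ eventuallyMeasurableSpace m₂ (ae μ))
    (h₂₁ : m₂ ≤ eventuallyMeasurableSpace m₁ (ae μ)) (f : Ω → E) :
    μ[f | m₁] =ᵐ[μ] μ[f | m₂] :=
  (condExp_eq_of_le_eventuallyMeasurableSpace le_sup_left (sup_le h₁ h₂)
    (sup_le le_eventuallyMeasurableSpace h₂₁) f).trans
  (condExp_eq_of_le_eventuallyMeasurableSpace le_sup_right (sup_le h₁ h₂)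
    (sup_le h₁₂ le_eventuallyMeasurableSpace) f).symm

end CondExp

/-! ### Moments and continuity of the noise -/

section NoiseMoments

open Filter Topology

/-- Translation is continuous in `L¹`: dominated convergence settles continuous functions of compact
support, which are dense, and translation is isometric. -/
theorem tendsto_integral_norm_comp_add_sub {E : Type*} [NormedAddCommGroup E] [NormedSpace ℝ E]
    {f : ℝ → E} (hf : Integrable f) :
    Tendsto (fun r : ℝ => ∫ u, ‖f (u + r) - f u‖) (𝓝 0) (𝓝 0) := by
  rw [Metric.tendsto_nhds]
  intro ε hε
  obtain ⟨g, hgs, hgf, hgc, hgi⟩ := hf.exists_hasCompactSupport_integral_sub_le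
    (show (0 : ℝ) < ε / 4 by positivity)
  have hg : Tendsto (fun r : ℝ => ∫ u, ‖g (u + r) - g u‖) (𝓝 0) (𝓝 0) := by
    obtain ⟨C, hC⟩ := hgs.exists_bound_of_continuous hgc
    obtain ⟨R, hR⟩ := hgs.isCompact.isBounded.subset_closedBall 0
    have hg0 : ∀ u, R < |u| → g u = 0 := fun u hu => by
      by_contra h
      have := hR (subset_tsupport g h)
      rw [mem_closedBall_zero_iff, Real.norm_eq_abs] at this
      linarith
    suffices h : Tendsto (fun r : ℝ => ∫ u, ‖g (u + r) - g u‖) (𝓝 0)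
      (𝓝 (∫ u, ‖g (u + 0) - g u‖)) by simpa using h
    refine tendsto_integral_filter_of_dominated_convergence
      ((Set.Icc (-(R + 1)) (R + 1)).indicator fun _ => C + C) ?_ ?_ ?_ ?_
    · exact Eventually.of_forall fun r => Continuous.aestronglyMeasurable (by fun_prop)
    · filter_upwards [Metric.ball_mem_nhds (0 : ℝ) one_pos] with r hr
      rw [mem_ball_zero_iff, Real.norm_eq_abs] at hr
      refine Eventually.of_forall fun u => ?_
      rw [norm_norm]
      by_cases hu : u ∈ Set.Icc (-(R + 1)) (R + 1)
      · rw [Set.indicator_of_mem hu]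
        exact (norm_sub_le _ _).trans (add_le_add (hC _) (hC _))
      · rw [Set.indicator_of_notMem hu]
        have hu' : R + 1 < |u| := by
          by_contra h
          exact hu (abs_le.1 (not_lt.1 h))
        have h2 : R < |u + r| := by
          have := abs_sub_abs_le_abs_sub u (-r)
          rw [abs_neg, sub_neg_eq_add] at this
          linarith
        rw [hg0 u (by linarith), hg0 _ h2, sub_zero, norm_zero]
    · exact (integrable_indicator_iff measurableSet_Icc).2 (integrableOn_const (by simp))
    · exact Eventually.of_forall fun u => ((by fun_prop : Continuous fun r => ‖g (u + r) - g u‖).tendsto 0)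
  rw [Metric.tendsto_nhds] at hg
  filter_upwards [hg (ε / 2) (by positivity)] with r hr
  have hnn : ∀ φ : ℝ → E, 0 ≤ ∫ u, ‖φ (u + r) - φ u‖ := fun φ =>
    integral_nonneg fun _ => norm_nonneg _
  rw [Real.dist_0_eq_abs, abs_of_nonneg (hnn _)] at hr ⊢
  have i1 : Integrable fun u => ‖f u - g u‖ := (hf.sub hgi).norm
  have i2 : Integrable fun u => ‖f (u + r) - g (u + r)‖ := i1.comp_add_right r
  have i3 : Integrable fun u => ‖g (u + r) - g u‖ := ((hgi.comp_add_right r).sub hgi).norm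
  have e2 : ∫ u, ‖f (u + r) - g (u + r)‖ = ∫ u, ‖f u - g u‖ :=
    integral_add_right_eq_self (fun u => ‖f u - g u‖) r
  calc ∫ u, ‖f (u + r) - f u‖
      ≤ ∫ u, (‖f (u + r) - g (u + r)‖ + ‖g (u + r) - g u‖ + ‖f u - g u‖) := by
        refine integral_mono ((hf.comp_add_right r).sub hf).norm ((i2.add i3).add i1) fun u => ?_
        have : f (u + r) - f u = (f (u + r) - g (u + r)) + (g (u + r) - g u) - (f u - g u) := by
          abel
        simp only
        rw [this]
        exact (norm_sub_le _ _).trans (add_le_add_left (norm_add_le _ _) _)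
    _ = (∫ u, ‖f (u + r) - g (u + r)‖) + (∫ u, ‖g (u + r) - g u‖) + ∫ u, ‖f u - g u‖ := by
        rw [integral_add (f := fun u => ‖f (u + r) - g (u + r)‖ + ‖g (u + r) - g u‖) (i2.add i3) i1,
          integral_add i2 i3]
    _ < ε := by rw [e2]; linarith

theorem integrable_exp_neg_mul_abs {ε : ℝ} (hε : 0 < ε) :
    Integrable fun u : ℝ => Real.exp (-(ε * |u|)) := by
  rw [← integrableOn_univ, ← Set.Iic_union_Ioi (a := (0 : ℝ))]
  refine IntegrableOn.union ?_ ?_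
  · refine (integrableOn_exp_mul_Iic hε 0).congr_fun (fun u hu => ?_) measurableSet_Iic
    simp only [abs_of_nonpos (Set.mem_Iic.1 hu)]; congr 1; ring
  · refine (integrableOn_exp_neg_mul_Ioi hε).congr_fun (fun u hu => ?_) measurableSet_Ioi
    simp only [abs_of_pos (Set.mem_Ioi.1 hu)]

theorem integrable_exp_neg_mul_abs_mul {ε : ℝ} (hε : 0 < ε) :
    Integrable fun u : ℝ => Real.exp (-(ε * |u|)) * (1 + |u|) := by
  refine ((integrable_exp_neg_mul_abs (half_pos hε)).const_mul (1 + 2 / ε)).mono'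
    (Continuous.aestronglyMeasurable (by fun_prop)) (Eventually.of_forall fun u => ?_)
  rw [Real.norm_of_nonneg (by positivity)]
  have h1 : 1 + |u| ≤ (1 + 2 / ε) * Real.exp (ε / 2 * |u|) := by
    have h2 := Real.add_one_le_exp (ε / 2 * |u|)
    have h3 : |u| = 2 / ε * (ε / 2 * |u|) := by field_simp
    have h4 : 0 ≤ ε / 2 * |u| := by positivity
    have h5 : 0 < 2 / ε := by positivity
    calc 1 + |u| = 1 + 2 / ε * (ε / 2 * |u|) := by rw [← h3]
      _ ≤ (1 + 2 / ε) * (ε / 2 * |u| + 1) := by nlinarith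
      _ ≤ _ := mul_le_mul_of_nonneg_left h2 (by positivity)
  calc Real.exp (-(ε * |u|)) * (1 + |u|)
      ≤ Real.exp (-(ε * |u|)) * ((1 + 2 / ε) * Real.exp (ε / 2 * |u|)) :=
        mul_le_mul_of_nonneg_left h1 (Real.exp_nonneg _)
    _ = (1 + 2 / ε) * Real.exp (-(ε / 2 * |u|)) := by
        rw [mul_left_comm, ← Real.exp_add]; congr 2; ring

variable {Ω : Type*} [MeasurableSpace Ω] {μ : Measure Ω} {n : ℕ} {Z : ℝ → Ω → (Fin n → ℝ)}

/-- `E ‖Z_r - Z_0‖`. -/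
def incrNorm (μ : Measure Ω) (Z : ℝ → Ω → (Fin n → ℝ)) (r : ℝ) : ℝ := ∫ ω, ‖Z r ω - Z 0 ω‖ ∂μ

theorem incrNorm_nonneg (r : ℝ) : 0 ≤ incrNorm μ Z r := integral_nonneg fun _ => norm_nonneg _

namespace IsNoise

theorem measurable_apply (hZ : IsNoise μ Z) (t : ℝ) : Measurable (Z t) := hZ.measurable.of_uncurry_left

theorem measurable_path (hZ : IsNoise μ Z) (ω : Ω) : Measurable fun t => Z t ω :=
  hZ.measurable.of_uncurry_right

theorem identDistrib_comp (hZ : IsNoise μ Z) {β : Type*} [MeasurableSpace β]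
    {Φ : (ℝ → Fin n → ℝ) → β} (hΦ : Measurable Φ) (h h' : ℝ) :
    IdentDistrib (fun ω => Φ fun t => Z (t + h) ω - Z h ω)
      (fun ω => Φ fun t => Z (t + h') ω - Z h' ω) μ μ :=
  ((hZ.stationary_increments h).trans (hZ.stationary_increments h').symm).comp hΦ

theorem integral_norm_sub (hZ : IsNoise μ Z) (a b : ℝ) :
    ∫ ω, ‖Z a ω - Z b ω‖ ∂μ = incrNorm μ Z (a - b) := by
  have := (hZ.identDistrib_comp (Φ := fun z => ‖z (a - b)‖)
    ((measurable_pi_apply _).norm) b 0).integral_eq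
  simpa [incrNorm] using this

theorem integrable_sub (hZ : IsNoise μ Z) (a b : ℝ) : Integrable (fun ω => Z a ω - Z b ω) μ :=
  (hZ.integrable a).sub (hZ.integrable b)

theorem incrNorm_neg (hZ : IsNoise μ Z) (r : ℝ) : incrNorm μ Z (-r) = incrNorm μ Z r := by
  rw [← zero_sub, ← hZ.integral_norm_sub 0 r, incrNorm]
  simp only [norm_sub_rev]

theorem incrNorm_add_le (hZ : IsNoise μ Z) (a b : ℝ) :
    incrNorm μ Z (a + b) ≤ incrNorm μ Z a + incrNorm μ Z b := by
  have h1 := hZ.integral_norm_sub (a + b) b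
  rw [add_sub_cancel_right] at h1
  rw [← h1, incrNorm, incrNorm, ← integral_add (hZ.integrable_sub _ _).norm
    (hZ.integrable_sub _ _).norm]
  refine integral_mono (hZ.integrable_sub _ _).norm
    ((hZ.integrable_sub _ _).norm.add (hZ.integrable_sub _ _).norm) fun ω => ?_
  exact norm_sub_le_norm_sub_add_norm_sub _ _ _

theorem incrNorm_nsmul_le (hZ : IsNoise μ Z) (k : ℕ) (r : ℝ) :
    incrNorm μ Z (k * r) ≤ k * incrNorm μ Z r := by
  induction k with
  | zero => simp [incrNorm]
  | succ k ih =>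
    have := hZ.incrNorm_add_le (k * r) r
    push_cast
    rw [add_mul, add_mul, one_mul, one_mul]
    linarith

theorem measurable_incrNorm [SFinite μ] (hZ : IsNoise μ Z) : Measurable (incrNorm μ Z) := by
  have : StronglyMeasurable (Function.uncurry fun r ω => ‖Z r ω - Z 0 ω‖) :=
    (hZ.measurable.sub ((hZ.measurable_apply 0).comp measurable_snd)).norm.stronglyMeasurable
  exact this.integral_prod_right.measurable

/-- Steinhaus: some sublevel set of the measurable function `incrNorm` has positive measure, so its
differences fill a neighbourhood of `0`, where subadditivity and symmetry bound `incrNorm` by twice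
the level. -/
theorem exists_incrNorm_le_near [SFinite μ] (hZ : IsNoise μ Z) :
    ∃ C δ : ℝ, 0 < δ ∧ ∀ r, |r| ≤ δ → incrNorm μ Z r ≤ C := by
  have hm : ∀ N : ℕ, MeasurableSet {r | incrNorm μ Z r ≤ N} := fun N =>
    measurableSet_le hZ.measurable_incrNorm measurable_const
  have hU : ⋃ N : ℕ, {r | incrNorm μ Z r ≤ N} = Set.univ := by
    refine Set.eq_univ_of_forall fun r => Set.mem_iUnion.2 ?_
    exact exists_nat_ge (incrNorm μ Z r)
  obtain ⟨N, hN⟩ : ∃ N : ℕ, 0 < (volume : Measure ℝ) {r | incrNorm μ Z r ≤ N} := by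
    by_contra! h
    have : (volume : Measure ℝ) (⋃ N : ℕ, {r | incrNorm μ Z r ≤ N}) = 0 :=
      measure_iUnion_null fun N => le_antisymm (h N) zero_le
    rw [hU] at this
    simp at this
  obtain ⟨δ, hδ, hball⟩ := Metric.mem_nhds_iff.1
    (Measure.sub_mem_nhds_zero_of_addHaar_pos volume _ (hm N) hN)
  refine ⟨N + N, δ / 2, by positivity, fun r hr => ?_⟩
  obtain ⟨a, ha, b, hb, rfl⟩ := hball (show r ∈ Metric.ball 0 δ by
    rw [mem_ball_zero_iff, Real.norm_eq_abs]; linarith)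
  have := hZ.incrNorm_add_le a (-b)
  rw [hZ.incrNorm_neg] at this
  exact this.trans (add_le_add ha hb)

/-- An increment over `r` is cut into about `|r| / δ` pieces of length at most `δ`, on which the
local bound holds. -/
theorem exists_incrNorm_le [SFinite μ] (hZ : IsNoise μ Z) :
    ∃ C : ℝ, 0 ≤ C ∧ ∀ r, incrNorm μ Z r ≤ C * (1 + |r|) := by
  obtain ⟨C, δ, hδ, h⟩ := hZ.exists_incrNorm_le_near
  have hC : 0 ≤ C := (incrNorm_nonneg 0).trans (h 0 (by simpa using hδ.le))
  refine ⟨C * (1 + 1 / δ), by positivity, fun r => ?_⟩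
  set k : ℕ := ⌊|r| / δ⌋₊ + 1 with hk
  have hk0 : (0 : ℝ) < k := by rw [hk]; positivity
  have h1 : |r| / δ ≤ k := by
    rw [hk]; push_cast; exact (Nat.lt_floor_add_one _).le
  have h2 : (k : ℝ) ≤ |r| / δ + 1 := by
    rw [hk]; push_cast
    have := Nat.floor_le (show 0 ≤ |r| / δ by positivity)
    linarith
  have h3 := hZ.incrNorm_nsmul_le k (r / k)
  rw [mul_div_cancel₀ _ hk0.ne'] at h3
  have h4 : incrNorm μ Z (r / k) ≤ C := h _ (by
    rw [abs_div, Nat.abs_cast, div_le_iff₀ hk0]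
    rw [div_le_iff₀ hδ] at h1; linarith)
  calc incrNorm μ Z r ≤ k * C := h3.trans (mul_le_mul_of_nonneg_left h4 hk0.le)
    _ ≤ (|r| / δ + 1) * C := mul_le_mul_of_nonneg_right h2 hC
    _ ≤ C * (1 + 1 / δ) * (1 + |r|) := by
      have : 0 ≤ C * (|r| + 1 / δ) := by positivity
      calc (|r| / δ + 1) * C ≤ (|r| / δ + 1) * C + C * (|r| + 1 / δ) := by linarith
        _ = _ := by ring

theorem exists_integral_norm_le [SFinite μ] (hZ : IsNoise μ Z) :
    ∃ C : ℝ, 0 ≤ C ∧ ∀ u, ∫ ω, ‖Z u ω‖ ∂μ ≤ C * (1 + |u|) := by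
  obtain ⟨C, hC, h⟩ := hZ.exists_incrNorm_le
  have h0 : 0 ≤ ∫ ω, ‖Z 0 ω‖ ∂μ := integral_nonneg fun _ => norm_nonneg _
  refine ⟨C + ∫ ω, ‖Z 0 ω‖ ∂μ, add_nonneg hC h0, fun u => ?_⟩
  calc ∫ ω, ‖Z u ω‖ ∂μ ≤ ∫ ω, (‖Z u ω - Z 0 ω‖ + ‖Z 0 ω‖) ∂μ :=
        integral_mono (hZ.integrable u).norm
          ((hZ.integrable_sub u 0).norm.add (hZ.integrable 0).norm) fun ω => by
            simpa using norm_add_le (Z u ω - Z 0 ω) (Z 0 ω)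
    _ = incrNorm μ Z u + ∫ ω, ‖Z 0 ω‖ ∂μ :=
        integral_add (hZ.integrable_sub u 0).norm (hZ.integrable 0).norm
    _ ≤ _ := by nlinarith [h u, abs_nonneg u]

/-- The noise is integrable on `ℝ × Ω` with respect to suitable weights. -/
theorem integrable_prod [SFinite μ] (hZ : IsNoise μ Z) {ν : Measure ℝ} [SFinite ν] {w : ℝ → ℝ}
    (hw : Integrable (fun u => w u * (1 + |u|)) ν) {E : Type*} [NormedAddCommGroup E]
    {F : ℝ → Ω → E} (hF : AEStronglyMeasurable (Function.uncurry F) (ν.prod μ))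
    (hFw : ∀ᵐ u ∂ν, ∀ ω, ‖F u ω‖ ≤ w u * ‖Z u ω‖) :
    Integrable (Function.uncurry F) (ν.prod μ) := by
  obtain ⟨C, hC, h⟩ := hZ.exists_integral_norm_le
  refine (integrable_prod_iff hF).2 ⟨?_, (hw.norm.const_mul C).mono' hF.norm.integral_prod_right' ?_⟩
  · filter_upwards [hFw, hF.prodMk_left] with u hu hm
    exact ((hZ.integrable u).norm.const_mul (w u)).mono' hm (Eventually.of_forall hu)
  · filter_upwards [hFw, hF.prodMk_left] with u hu hm
    rw [Real.norm_of_nonneg (integral_nonneg fun _ => norm_nonneg _)]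
    calc ∫ ω, ‖F u ω‖ ∂μ ≤ ∫ ω, w u * ‖Z u ω‖ ∂μ :=
          integral_mono_of_nonneg (Eventually.of_forall fun _ => norm_nonneg _)
            ((hZ.integrable u).norm.const_mul _) (Eventually.of_forall hu)
      _ = w u * ∫ ω, ‖Z u ω‖ ∂μ := integral_const_mul _ _
      _ ≤ |w u| * ∫ ω, ‖Z u ω‖ ∂μ :=
          mul_le_mul_of_nonneg_right (le_abs_self _) (integral_nonneg fun _ => norm_nonneg _)
      _ ≤ |w u| * (C * (1 + |u|)) := mul_le_mul_of_nonneg_left (h u) (abs_nonneg _)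
      _ = C * ‖w u * (1 + |u|)‖ := by
          rw [norm_mul, Real.norm_eq_abs, Real.norm_of_nonneg (by positivity : 0 ≤ 1 + |u|)]; ring

theorem integrable_prod_restrict [SFinite μ] (hZ : IsNoise μ Z) (a b : ℝ) :
    Integrable (Function.uncurry Z) ((volume.restrict (Set.Icc a b)).prod μ) := by
  refine hZ.integrable_prod (w := fun _ => 1) ?_ hZ.measurable.aestronglyMeasurable
    (Eventually.of_forall fun u ω => by rw [one_mul])
  exact (Continuous.integrableOn_Icc (by fun_prop))

theorem ae_integrableOn [SFinite μ] (hZ : IsNoise μ Z) (a b : ℝ) :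
    ∀ᵐ ω ∂μ, IntegrableOn (fun u => Z u ω) (Set.Icc a b) :=
  (hZ.integrable_prod_restrict a b).prod_left_ae

/-- By stationarity `E‖Z_{u+r} - Z_u‖` does not depend on `u`, so it equals its average over `u ∈
[0, 1]`. After exchanging integrals, continuity of translation in `L¹` applies path by path. -/
theorem tendsto_incrNorm [IsProbabilityMeasure μ] (hZ : IsNoise μ Z) :
    Tendsto (incrNorm μ Z) (𝓝 0) (𝓝 0) := by
  -- The window `[-1, 2]` contains `u` and `u + r` whenever `u ∈ [0, 1]` and `|r| < 1`, so
  -- truncation is harmless there.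
  set f : Ω → ℝ → (Fin n → ℝ) := fun ω => (Set.Icc (-1) 2).indicator fun u => Z u ω with hf
  have hfi : ∀ᵐ ω ∂μ, Integrable (f ω) := by
    filter_upwards [hZ.ae_integrableOn (-1) 2] with ω hω
    exact (integrable_indicator_iff measurableSet_Icc).2 hω
  have hfn : Integrable (fun ω => ∫ u, ‖f ω u‖) μ := by
    refine ((hZ.integrable_prod_restrict (-1) 2).norm.integral_prod_right).congr
      (Eventually.of_forall fun ω => ?_)
    simp only [hf, norm_indicator_eq_indicator_norm, integral_indicator measurableSet_Icc,
      Function.uncurry_apply_pair]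
  have hZm : Measurable (Function.uncurry fun (ω : Ω) (u : ℝ) => Z u ω) :=
    hZ.measurable.comp measurable_swap
  have hfm : Measurable (Function.uncurry f) := by
    have : Function.uncurry f = (Prod.snd ⁻¹' Set.Icc (-1 : ℝ) 2).indicator
        (Function.uncurry fun (ω : Ω) (u : ℝ) => Z u ω) := by
      funext x; rfl
    rw [this]
    exact hZm.indicator (measurable_snd measurableSet_Icc)
  have h1 : Tendsto (fun r : ℝ => ∫ ω, (∫ u, ‖f ω (u + r) - f ω u‖) ∂μ) (𝓝 0) (𝓝 (∫ _, 0 ∂μ)) := by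
    refine tendsto_integral_filter_of_dominated_convergence (fun ω => 2 * ∫ u, ‖f ω u‖) ?_ ?_
      (hfn.const_mul 2) ?_
    · refine Eventually.of_forall fun r => ?_
      have : Measurable (Function.uncurry fun ω u => ‖f ω (u + r) - f ω u‖) :=
        ((hfm.comp (measurable_fst.prodMk (measurable_snd.add_const r))).sub hfm).norm
      exact this.stronglyMeasurable.integral_prod_right.aestronglyMeasurable
    · refine Eventually.of_forall fun r => ?_
      filter_upwards [hfi] with ω hω
      rw [Real.norm_of_nonneg (integral_nonneg fun _ => norm_nonneg _)]
      have e : ∫ u, ‖f ω (u + r)‖ = ∫ u, ‖f ω u‖ :=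
        integral_add_right_eq_self (fun u => ‖f ω u‖) r
      calc ∫ u, ‖f ω (u + r) - f ω u‖ ≤ ∫ u, (‖f ω (u + r)‖ + ‖f ω u‖) :=
            integral_mono ((hω.comp_add_right r).sub hω).norm
              ((hω.comp_add_right r).norm.add hω.norm) fun u => norm_sub_le _ _
        _ = _ := by rw [integral_add (hω.comp_add_right r).norm hω.norm, e, two_mul]
    · filter_upwards [hfi] with ω hω
      exact tendsto_integral_norm_comp_add_sub hω
  rw [integral_zero] at h1
  refine tendsto_of_tendsto_of_tendsto_of_le_of_le' tendsto_const_nhds h1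
    (Eventually.of_forall fun r => incrNorm_nonneg r) ?_
  filter_upwards [Metric.ball_mem_nhds (0 : ℝ) one_pos] with r hr
  rw [mem_ball_zero_iff, Real.norm_eq_abs, abs_lt] at hr
  have hpi : Integrable (Function.uncurry fun ω u => ‖f ω (u + r) - f ω u‖) (μ.prod volume) := by
    have h0 : Integrable (Function.uncurry f) (μ.prod volume) := by
      refine (integrable_prod_iff hfm.aestronglyMeasurable).2 ⟨hfi, hfn⟩
    have h2 : Integrable (Function.uncurry fun ω u => f ω (u + r)) (μ.prod volume) := by
      refine (integrable_prod_iff ?_).2 ⟨?_, ?_⟩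
      · exact (hfm.comp (measurable_fst.prodMk (measurable_snd.add_const r))).aestronglyMeasurable
      · filter_upwards [hfi] with ω hω
        exact hω.comp_add_right r
      · refine hfn.congr (Eventually.of_forall fun ω => ?_)
        exact (integral_add_right_eq_self (fun u => ‖f ω u‖) r).symm
    exact (h2.sub h0).norm
  rw [integral_integral_swap hpi]
  have e1 : incrNorm μ Z r = ∫ _ in Set.Icc (0 : ℝ) 1, incrNorm μ Z r := by simp
  rw [e1]
  have e2 : ∫ _ in Set.Icc (0 : ℝ) 1, incrNorm μ Z r =
      ∫ u in Set.Icc (0 : ℝ) 1, ∫ ω, ‖f ω (u + r) - f ω u‖ ∂μ := by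
    refine setIntegral_congr_fun measurableSet_Icc fun u hu => ?_
    have m1 : u ∈ Set.Icc (-1 : ℝ) 2 := ⟨by linarith [hu.1], by linarith [hu.2]⟩
    have m2 : u + r ∈ Set.Icc (-1 : ℝ) 2 := ⟨by linarith [hu.1], by linarith [hu.2]⟩
    simp only [hf, Set.indicator_of_mem m1, Set.indicator_of_mem m2]
    rw [hZ.integral_norm_sub, add_sub_cancel_left]
  rw [e2]
  exact setIntegral_le_integral hpi.integral_prod_right
    (Eventually.of_forall fun u => integral_nonneg fun _ => norm_nonneg _)

/-- The first moment grows at most linearly, so an exponential weight makes the noise integrable on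
`ℝ × Ω`, hence on almost every path. -/
theorem ae_tempered [SFinite μ] (hZ : IsNoise μ Z) {ε : ℝ} (hε : 0 < ε) :
    ∀ᵐ ω ∂μ, Tempered ε fun u => Z u ω := by
  have h : Integrable (Function.uncurry fun u ω => Real.exp (-(ε * |u|)) * ‖Z u ω‖)
      (volume.prod μ) := by
    refine hZ.integrable_prod (w := fun u => Real.exp (-(ε * |u|))) ?_ ?_
      (Eventually.of_forall fun u ω => ?_)
    · exact integrable_exp_neg_mul_abs_mul hε
    · exact ((by fun_prop : Measurable fun x : ℝ × Ω => Real.exp (-(ε * |x.1|))).mul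
        hZ.measurable.norm).aestronglyMeasurable
    · rw [norm_mul, norm_norm, Real.norm_eq_abs, Real.abs_exp]
  filter_upwards [h.prod_left_ae] with ω hω
  exact ⟨hZ.measurable_path ω, hω⟩

end IsNoise

end NoiseMoments

/-! ### Regular integrators -/

section RegularIntegrator

open Filter Topology

theorem InL1L2.comp_sub_left {f : ℝ → ℝ} (hf : InL1L2 f) (t : ℝ) : InL1L2 fun u => f (t - u) :=
  ⟨hf.1.comp_measurePreserving (Measure.measurePreserving_sub_left volume t),
    hf.2.comp_measurePreserving (Measure.measurePreserving_sub_left volume t)⟩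

theorem stepFun_of_neg {r x : ℝ} (hr : 0 < r) (hx : x < 0) : stepFun r x = 0 := by
  have h1 : ¬ (0 ≤ x) := not_le.2 hx
  have h2 : ¬ (0 ≤ x - r) := not_le.2 (by linarith)
  rw [stepFun, Set.indicator_of_notMem (by simpa using h2), Set.indicator_of_notMem
    (by simpa using h1), sub_zero]

theorem stepFun_of_nonneg {r x : ℝ} (hx : 0 ≤ x) :
    stepFun r x = -(Set.Ioi x).indicator (fun _ => 1) r := by
  rw [stepFun, Set.indicator_of_mem (Set.mem_Ici.2 hx)]
  by_cases h : r ≤ x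
  · rw [Set.indicator_of_mem (Set.mem_Ici.2 (sub_nonneg.2 h)),
      Set.indicator_of_notMem (by simpa using h)]; simp
  · rw [not_le] at h
    rw [Set.indicator_of_notMem (by simpa using h), Set.indicator_of_mem (by simpa using h)]; simp

theorem measurable_stepFun : Measurable (Function.uncurry stepFun) := by
  have h : Measurable ((Set.Ici (0 : ℝ)).indicator fun _ => (1 : ℝ)) :=
    measurable_const.indicator measurableSet_Ici
  exact (h.comp (measurable_snd.sub measurable_fst)).sub (h.comp measurable_snd)

theorem integral_mul_stepFun_of_neg (φ : ℝ → ℝ) {x : ℝ} (hx : x < 0) :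
    ∫ r in Set.Ioi (0 : ℝ), φ r * stepFun r x = 0 := by
  refine setIntegral_eq_zero_of_forall_eq_zero fun r hr => ?_
  rw [stepFun_of_neg hr hx, mul_zero]

theorem integral_mul_stepFun_of_nonneg (φ : ℝ → ℝ) {x : ℝ} (hx : 0 ≤ x) :
    ∫ r in Set.Ioi (0 : ℝ), φ r * stepFun r x = -∫ r in Set.Ioi x, φ r := by
  rw [← integral_neg, ← Set.inter_eq_self_of_subset_left (Set.Ioi_subset_Ioi hx),
    Set.inter_comm, ← setIntegral_indicator measurableSet_Ioi]
  congr 1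
  funext r
  rw [stepFun_of_nonneg hx]
  by_cases h : r ∈ Set.Ioi x <;> simp [h]

theorem integrableOn_exp_neg_mul_Ioi' {δ : ℝ} (hδ : 0 < δ) (x : ℝ) :
    IntegrableOn (fun t : ℝ => Real.exp (-(δ * t))) (Set.Ioi x) := by
  simpa [neg_mul] using exp_neg_integrableOn_Ioi x hδ

theorem inL1L2_integral_mul_stepFun {δ C : ℝ} (hδ : 0 < δ) {φ : ℝ → ℝ} (hφm : Measurable φ)
    (hφ : ∀ r, 0 < r → |φ r| ≤ C * Real.exp (-(δ * r))) :
    InL1L2 fun x => ∫ r in Set.Ioi (0 : ℝ), φ r * stepFun r x := by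
  refine inL1L2_of_abs_le hδ (C := C / δ) ?_ fun x => ?_
  · have : Measurable (Function.uncurry fun x r : ℝ => φ r * stepFun r x) :=
      (hφm.comp measurable_snd).mul (measurable_stepFun.comp measurable_swap)
    exact this.stronglyMeasurable.integral_prod_right.measurable
  · rcases lt_or_ge x 0 with h | h
    · rw [integral_mul_stepFun_of_neg _ h, Set.indicator_of_notMem (by simpa using h), abs_zero]
    · rw [integral_mul_stepFun_of_nonneg _ h, Set.indicator_of_mem (Set.mem_Ici.2 h), abs_neg]
      have h1 : ∫ r in Set.Ioi x, C * Real.exp (-(δ * r)) = C / δ * Real.exp (-(δ * x)) := by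
        rw [integral_const_mul]
        have := integral_exp_mul_Ioi (neg_lt_zero.2 hδ) x
        simp only [neg_mul] at this
        rw [this]; field_simp
      rw [← h1, ← Real.norm_eq_abs]
      refine norm_integral_le_of_norm_le ((integrableOn_exp_neg_mul_Ioi' hδ x).const_mul C)
        ((ae_restrict_mem measurableSet_Ioi).mono fun r hr => hφ r (h.trans_lt hr))

variable {Ω : Type*} [MeasurableSpace Ω] {μ : Measure Ω} {Y : ℝ → Ω → ℝ} {I : (ℝ → ℝ) → Ω → ℝ}

namespace IsRegularIntegrator

theorem zero (hI : IsRegularIntegrator μ Y I) : I (fun _ => 0) =ᵐ[μ] fun _ => 0 := by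
  have := hI.smul 0 (fun _ => 0) ⟨MemLp.zero, MemLp.zero⟩
  simpa using this

theorem inL1L2_indicator_Ioc (a b : ℝ) : InL1L2 ((Set.Ioc a b).indicator fun _ => 1) :=
  ⟨memLp_indicator_const 1 measurableSet_Ioc 1 (Or.inr (by simp)),
    memLp_indicator_const 2 measurableSet_Ioc 1 (Or.inr (by simp))⟩

/-- As a function of `u` the step function is `-1` on `(t - r, t]` for `r > 0` and `1` on `(t, t -
r]` for `r < 0`. The half-open intervals match exactly, with no change on null sets. -/
theorem stepFun_ae (hI : IsRegularIntegrator μ Y I) (t r : ℝ) :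
    (fun ω => Y (t - r) ω - Y t ω) =ᵐ[μ] I (fun u => stepFun r (t - u)) := by
  rcases lt_trichotomy r 0 with h | rfl | h
  · have e : (fun u => stepFun r (t - u)) = (Set.Ioc t (t - r)).indicator fun _ => 1 := by
      funext u
      simp only [stepFun, Set.indicator, Set.mem_Ici, Set.mem_Ioc]
      grind
    rw [e]
    exact (hI.indicator t (t - r) (by linarith)).symm
  · have e : (fun u => stepFun 0 (t - u)) = fun _ => 0 := by
      funext u; simp [stepFun]
    rw [e]
    refine EventuallyEq.trans (Eventually.of_forall fun ω => ?_) hI.zero.symm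
    simp
  · have e : (fun u => stepFun r (t - u)) =
        fun u => (-1) * (Set.Ioc (t - r) t).indicator (fun _ => 1) u := by
      funext u
      simp only [stepFun, Set.indicator, Set.mem_Ici, Set.mem_Ioc]
      grind
    rw [e]
    filter_upwards [hI.indicator (t - r) t (by linarith), hI.smul (-1) _
      (inL1L2_indicator_Ioc (t - r) t)] with ω h1 h2
    rw [h2, h1]; ring

/-- The integral of a superposition of step functions with a positive density. -/
theorem integral_mul_stepFun_of_nonneg (hI : IsRegularIntegrator μ Y I)
    (hY : Measurable (Function.uncurry Y)) {δ C : ℝ} (hδ : 0 < δ) {φ : ℝ → ℝ} (hφm : Measurable φ)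
    (hφ0 : ∀ r, 0 ≤ φ r) (hφ : ∀ r, 0 < r → |φ r| ≤ C * Real.exp (-(δ * r))) (t : ℝ) :
    I (fun u => ∫ r in Set.Ioi (0 : ℝ), φ r * stepFun r (t - u)) =ᵐ[μ]
      fun ω => ∫ r in Set.Ioi (0 : ℝ), φ r * (Y (t - r) ω - Y t ω) := by
  set ν := (volume.restrict (Set.Ioi (0 : ℝ))).withDensity fun r => ENNReal.ofReal (φ r) with hν
  have hint : ∀ f : ℝ → ℝ, ∫ r, f r ∂ν = ∫ r in Set.Ioi (0 : ℝ), φ r * f r := fun f => by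
    rw [hν, integral_withDensity_eq_integral_toReal_smul hφm.ennreal_ofReal
      (Eventually.of_forall fun _ => ENNReal.ofReal_lt_top)]
    simp only [ENNReal.toReal_ofReal (hφ0 _), smul_eq_mul]
  have hφi : IntegrableOn φ (Set.Ioi 0) :=
    ((integrableOn_exp_neg_mul_Ioi hδ).const_mul C).mono' hφm.aestronglyMeasurable
      ((ae_restrict_mem measurableSet_Ioi).mono fun r hr => hφ r hr)
  have hfin : IsFiniteMeasure ν := isFiniteMeasure_withDensity_ofReal hφi.2
  have hmom : Integrable (fun r : ℝ => r) ν := by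
    rw [hν, integrable_withDensity_iff_integrable_smul' hφm.ennreal_ofReal
      (Eventually.of_forall fun _ => ENNReal.ofReal_lt_top)]
    simp only [ENNReal.toReal_ofReal (hφ0 _), smul_eq_mul]
    refine ((integrable_exp_neg_mul_abs_mul hδ).integrableOn.const_mul C).mono'
      (hφm.mul measurable_id).aestronglyMeasurable
      ((ae_restrict_mem measurableSet_Ioi).mono fun r hr => ?_)
    have h1 := hφ r hr
    have hC : 0 ≤ C * Real.exp (-(δ * r)) := (abs_nonneg _).trans h1
    rw [norm_mul, Real.norm_eq_abs, Real.norm_eq_abs, abs_of_pos (Set.mem_Ioi.1 hr), ← mul_assoc]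
    have hr' : (0 : ℝ) < r := hr
    exact mul_le_mul h1 (by linarith) hr'.le hC
  have := hI.fubini ν hfin hmom t (fun r ω => Y (t - r) ω - Y t ω) ?_ fun r => hI.stepFun_ae t r
  · simpa only [hint] using this
  · exact (hY.comp ((measurable_const.sub measurable_fst).prodMk measurable_snd)).sub
      (hY.of_uncurry_left.comp measurable_snd)

/-- The integral of a superposition of step functions. -/
theorem integral_mul_stepFun (hI : IsRegularIntegrator μ Y I)
    (hY : Measurable (Function.uncurry Y)) {δ C : ℝ} (hδ : 0 < δ) {φ : ℝ → ℝ} (hφm : Measurable φ)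
    (hφ : ∀ r, 0 < r → |φ r| ≤ C * Real.exp (-(δ * r))) (t : ℝ)
    (hYi : ∀ᵐ ω ∂μ, IntegrableOn (fun r => Real.exp (-(δ * r)) * (Y (t - r) ω - Y t ω))
      (Set.Ioi 0)) :
    I (fun u => ∫ r in Set.Ioi (0 : ℝ), φ r * stepFun r (t - u)) =ᵐ[μ]
      fun ω => ∫ r in Set.Ioi (0 : ℝ), φ r * (Y (t - r) ω - Y t ω) := by
  -- The Fubini property is stated for positive measures, so the density is split by sign and
  -- recombined by linearity of `I`.
  set φ₁ : ℝ → ℝ := fun r => max (φ r) 0 with hφ₁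
  set φ₂ : ℝ → ℝ := fun r => max (-φ r) 0 with hφ₂
  have hm₁ : Measurable φ₁ := hφm.max measurable_const
  have hm₂ : Measurable φ₂ := hφm.neg.max measurable_const
  have hb₁ : ∀ r, 0 < r → |φ₁ r| ≤ C * Real.exp (-(δ * r)) := fun r hr => by
    refine le_trans ?_ (hφ r hr)
    rw [abs_of_nonneg (le_max_right _ _)]
    exact max_le (le_abs_self _) (abs_nonneg _)
  have hb₂ : ∀ r, 0 < r → |φ₂ r| ≤ C * Real.exp (-(δ * r)) := fun r hr => by
    refine le_trans ?_ (hφ r hr)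
    rw [abs_of_nonneg (le_max_right _ _)]
    exact max_le (neg_le_abs _) (abs_nonneg _)
  have hsub : ∀ r, φ r = φ₁ r - φ₂ r := fun r => (max_zero_sub_max_neg_zero_eq_self (φ r)).symm
  have key : ∀ f : ℝ → ℝ, Measurable f →
      IntegrableOn (fun r => Real.exp (-(δ * r)) * f r) (Set.Ioi 0) →
      ∫ r in Set.Ioi (0 : ℝ), φ r * f r = (∫ r in Set.Ioi (0 : ℝ), φ₁ r * f r) +
        (-1) * ∫ r in Set.Ioi (0 : ℝ), φ₂ r * f r := by
    intro f hf hfi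
    have aux : ∀ ψ : ℝ → ℝ, Measurable ψ → (∀ r, 0 < r → |ψ r| ≤ C * Real.exp (-(δ * r))) →
        IntegrableOn (fun r => ψ r * f r) (Set.Ioi 0) := fun ψ hψ hψb => by
      refine (hfi.norm.const_mul C).mono' (hψ.mul hf).aestronglyMeasurable
        ((ae_restrict_mem measurableSet_Ioi).mono fun r hr => ?_)
      rw [norm_mul, norm_mul, ← mul_assoc, Real.norm_eq_abs (Real.exp _), Real.abs_exp]
      exact mul_le_mul_of_nonneg_right (hψb r hr) (norm_nonneg _)
    rw [neg_one_mul, ← sub_eq_add_neg, ← integral_sub (aux _ hm₁ hb₁) (aux _ hm₂ hb₂)]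
    simp only [← sub_mul, ← hsub]
  have hstep : ∀ x : ℝ, IntegrableOn (fun r => Real.exp (-(δ * r)) * stepFun r x) (Set.Ioi 0) := by
    intro x
    refine ((integrableOn_exp_neg_mul_Ioi hδ).const_mul 2).mono'
      ((Continuous.measurable (by fun_prop)).mul
        (measurable_stepFun.of_uncurry_right)).aestronglyMeasurable
      (Eventually.of_forall fun r => ?_)
    rw [norm_mul, Real.norm_eq_abs, Real.abs_exp, mul_comm]
    refine mul_le_mul_of_nonneg_right ?_ (Real.exp_nonneg _)
    simp only [stepFun, Set.indicator]
    split_ifs <;> norm_num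
  have e : (fun u => ∫ r in Set.Ioi (0 : ℝ), φ r * stepFun r (t - u)) = fun u =>
      (∫ r in Set.Ioi (0 : ℝ), φ₁ r * stepFun r (t - u)) +
        (-1) * ∫ r in Set.Ioi (0 : ℝ), φ₂ r * stepFun r (t - u) := by
    funext u
    exact key _ (measurable_stepFun.of_uncurry_right) (hstep _)
  have i₁ := (inL1L2_integral_mul_stepFun hδ hm₁ hb₁).comp_sub_left t
  have i₂ := (inL1L2_integral_mul_stepFun hδ hm₂ hb₂).comp_sub_left t
  have i₂' : InL1L2 fun u => (-1) * ∫ r in Set.Ioi (0 : ℝ), φ₂ r * stepFun r (t - u) :=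
    ⟨i₂.1.const_mul (-1), i₂.2.const_mul (-1)⟩
  rw [e]
  filter_upwards [hI.add _ _ i₁ i₂', hI.smul (-1) _ i₂, hYi,
    hI.integral_mul_stepFun_of_nonneg hY hδ hm₁ (fun r => le_max_right _ _) hb₁ t,
    hI.integral_mul_stepFun_of_nonneg hY hδ hm₂ (fun r => le_max_right _ _) hb₂ t]
    with ω h1 h2 h3 h4 h5
  rw [h1, h2, h4, h5, key _ ?_ h3]
  exact (hY.of_uncurry_right.comp (measurable_const.sub measurable_id)).sub measurable_const

end IsRegularIntegrator

end RegularIntegrator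

/-! ### The state space representation -/

section StateSpace

open Filter Topology

set_option linter.unusedSectionVars false

attribute [local instance] Matrix.linftyOpNormedAddCommGroup Matrix.linftyOpNormedSpace
  Matrix.linftyOpNormedRing Matrix.linftyOpNormedAlgebra

variable {ι κ : Type*} [Fintype ι] [DecidableEq ι] [Fintype κ] [DecidableEq κ]

theorem integrableOn_statePath {A : Matrix ι ι ℝ} {K ε : ℝ} (hε : 0 < ε)
    (hA : ∀ t, 0 ≤ t → ‖expm A t‖ ≤ K * Real.exp (-(ε * t)))
    {y : ℝ → ι → ℝ} (hy : Tempered ε y) (v : ℝ) :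
    IntegrableOn (fun r => expm A r *ᵥ (A *ᵥ (y (v - r) - y v))) (Set.Ioi 0) := by
  have h1 := integrableOn_Iic_comp_sub (integrableOn_expm_sub_mulVec hε.le hA (hy.mulVec A) v)
  simp only [sub_sub_cancel] at h1
  refine (h1.sub (integrableOn_expm_mulVec hε hA (A *ᵥ y v))).congr
    (Eventually.of_forall fun r => ?_)
  simp only [Pi.sub_apply, Matrix.mulVec_sub]

variable {n d : ℕ} {M N : (Matrix (Fin n) (Fin n) ℝ)[X]} {K δ : ℝ}

/-- The derivative of the kernel on `(0, ∞)`. -/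
def stateKernelDeriv (d : ℕ) (M N : (Matrix (Fin n) (Fin n) ℝ)[X]) (t : ℝ) :
    Matrix (Fin n) (Fin n) ℝ :=
  firstBlock n d * expm (companion d M) t * companion d M * inputBlocks d M N

theorem stateKernelDeriv_apply (t : ℝ) (a b : Fin n) : stateKernelDeriv d M N t a b =
    (firstBlock n d *ᵥ (expm (companion d M) t *ᵥ
      (companion d M *ᵥ (inputBlocks d M N).col b))) a := by
  rw [Matrix.mulVec_mulVec, Matrix.mulVec_mulVec, stateKernelDeriv, Matrix.mul_apply']; rfl

theorem continuous_stateKernelDeriv (a b : Fin n) :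
    Continuous fun t => stateKernelDeriv d M N t a b := by
  simp only [stateKernelDeriv_apply]
  exact (continuous_apply a).comp
    ((mulVecCLM (firstBlock n d)).continuous.comp (continuous_expm_mulVec _ _))

theorem exists_abs_stateKernelDeriv_le
    (hA : ∀ t, 0 ≤ t → ‖expm (companion d M) t‖ ≤ K * Real.exp (-(δ * t))) (a b : Fin n) :
    ∃ C, ∀ t, 0 ≤ t → |stateKernelDeriv d M N t a b| ≤ C * Real.exp (-(δ * t)) := by
  refine ⟨‖firstBlock n d‖ * (K * ‖companion d M *ᵥ (inputBlocks d M N).col b‖), fun t ht => ?_⟩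
  rw [stateKernelDeriv_apply, ← Real.norm_eq_abs]
  refine (norm_le_pi_norm _ a).trans ((Matrix.linfty_opNorm_mulVec _ _).trans ?_)
  rw [mul_assoc]
  exact mul_le_mul_of_nonneg_left (norm_expm_mulVec_le hA ht _) (norm_nonneg _)

theorem hasDerivAt_stateKernel_branch (a b : Fin n) (t : ℝ) :
    HasDerivAt (fun t => (firstBlock n d *ᵥ
      (expm (companion d M) t *ᵥ (inputBlocks d M N).col b)) a) (stateKernelDeriv d M N t a b) t := by
  rw [stateKernelDeriv_apply]
  exact hasDerivAt_pi.1 ((mulVecCLM (firstBlock n d)).hasFDerivAt.comp_hasDerivAt t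
    (hasDerivAt_expm_mulVec (companion d M) ((inputBlocks d M N).col b) t)) a

theorem integrableOn_stateKernelDeriv (hδ : 0 < δ)
    (hA : ∀ t, 0 ≤ t → ‖expm (companion d M) t‖ ≤ K * Real.exp (-(δ * t))) (a b : Fin n) {x : ℝ}
    (hx : 0 ≤ x) : IntegrableOn (fun t => stateKernelDeriv d M N t a b) (Set.Ioi x) := by
  obtain ⟨C, hC⟩ := exists_abs_stateKernelDeriv_le (N := N) hA a b
  exact ((integrableOn_exp_neg_mul_Ioi' hδ x).const_mul C).mono'
    (continuous_stateKernelDeriv a b).aestronglyMeasurable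
    ((ae_restrict_mem measurableSet_Ioi).mono fun t ht => hC t (hx.trans (le_of_lt ht)))

theorem tendsto_stateKernel_branch (hδ : 0 < δ)
    (hA : ∀ t, 0 ≤ t → ‖expm (companion d M) t‖ ≤ K * Real.exp (-(δ * t))) (a b : Fin n) :
    Tendsto (fun t => (firstBlock n d *ᵥ
      (expm (companion d M) t *ᵥ (inputBlocks d M N).col b)) a) atTop (𝓝 0) := by
  obtain ⟨C, hC⟩ := exists_abs_stateKernel_le (N := N) hA a b
  refine squeeze_zero_norm' (eventually_atTop.2 ⟨0, fun t ht => ?_⟩)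
    (tendsto_const_mul_exp_neg_atTop hδ C)
  have := hC t
  rwa [stateKernel_apply_of_nonneg ht, Set.indicator_of_mem (Set.mem_Ici.2 ht)] at this

/-- The kernel is a superposition of step functions. -/
theorem stateKernel_eq_integral_stepFun (hδ : 0 < δ)
    (hA : ∀ t, 0 ≤ t → ‖expm (companion d M) t‖ ≤ K * Real.exp (-(δ * t))) (a b : Fin n) (x : ℝ) :
    stateKernel d M N x a b =
      ∫ r in Set.Ioi (0 : ℝ), stateKernelDeriv d M N r a b * stepFun r x := by
  rcases lt_or_ge x 0 with h | h
  · rw [integral_mul_stepFun_of_neg _ h, stateKernel_of_neg h]; rfl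
  · rw [integral_mul_stepFun_of_nonneg _ h, integral_Ioi_of_hasDerivAt_of_tendsto'
      (fun t _ => hasDerivAt_stateKernel_branch a b t) (integrableOn_stateKernelDeriv hδ hA a b h)
      (tendsto_stateKernel_branch hδ hA a b), stateKernel_apply_of_nonneg h]
    simp

theorem Tempered.integrableOn_exp_mul_sub {ε : ℝ} (hε : 0 < ε) {y : ℝ → ι → ℝ} (hy : Tempered ε y)
    (v : ℝ) : IntegrableOn (fun r => Real.exp (-(ε * r)) * ‖y (v - r) - y v‖) (Set.Ioi 0) := by
  have h1 := integrableOn_Iic_comp_sub (hy.integrable_comp_sub hε.le v)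
  simp only [sub_sub_cancel] at h1
  refine (h1.add ((integrableOn_exp_neg_mul_Ioi hε).mul_const ‖y v‖)).mono' ?_
    (Eventually.of_forall fun r => ?_)
  · exact ((Continuous.measurable (by fun_prop)).mul
      ((hy.1.comp (measurable_const.sub measurable_id)).sub measurable_const).norm).aestronglyMeasurable
  · rw [norm_mul, norm_norm, Real.norm_eq_abs, Real.abs_exp, Pi.add_apply, ← mul_add]
    exact mul_le_mul_of_nonneg_left (norm_sub_le _ _) (Real.exp_nonneg _)

variable {Ω : Type*} [MeasurableSpace Ω] {μ : Measure Ω} {Z X : ℝ → Ω → (Fin n → ℝ)}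
  {I : Fin n → (ℝ → ℝ) → Ω → ℝ} {p q : ℕ} {P Q : (Matrix (Fin n) (Fin n) ℝ)[X]}

/-- An MCARMA process is the output of the state equation driven by the noise. -/
theorem IsMCARMA.ae_eq_statePath [SFinite μ] [Nontrivial (Matrix (Fin n) (Fin n) ℝ)] (hP : P.Monic)
    (hp : P.natDegree = p) (hQ : Q.Monic) (hq : Q.natDegree = q) (hqp : q < p)
    (hPdet : ∀ z : ℂ, 0 ≤ z.re → (matEval P z).det ≠ 0) (hZ : IsNoise μ Z)
    (hI : ∀ k, IsRegularIntegrator μ (fun t ω => Z t ω k) (I k)) (hX : IsMCARMA μ P Q I X) (t : ℝ) :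
    X t =ᵐ[μ] fun ω =>
      firstBlock n p *ᵥ statePath (matA p P) (fun u => matE p P Q *ᵥ Z u ω) t := by
  obtain ⟨K, δ, -, hδ, hA⟩ := exists_norm_expm_companion_le hP hp hPdet
  obtain ⟨-, g, hg, hgF, hgX⟩ := hX
  -- The kernel of the process is given only by its Fourier transform. Uniqueness identifies it with
  -- the state-space kernel almost everywhere, which is all that `I` sees.
  have hge : ∀ j k, (fun u => g u j k) =ᵐ[volume] fun u => stateKernel p P Q u j k := fun j k => by
    refine ae_eq_of_fourier_eq (memLp_one_iff_integrable.1 (hg j k).1)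
      (memLp_one_iff_integrable.1 (inL1L2_stateKernel hδ hA j k).1) fun y => ?_
    rw [hgF, integral_exp_mul_stateKernel hP hp (degree_Q_lt hQ hq hqp) hPdet]
  have hIk : ∀ j k, I k (fun u => g (t - u) j k) =ᵐ[μ] fun ω =>
      ∫ r in Set.Ioi (0 : ℝ), stateKernelDeriv p P Q r j k * (Z (t - r) ω k - Z t ω k) := by
    intro j k
    obtain ⟨C, hC⟩ := exists_abs_stateKernelDeriv_le (N := Q) hA j k
    have h1 := (hI k).congr (fun u => g (t - u) j k) (fun u => stateKernel p P Q (t - u) j k)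
      ((hg j k).comp_sub_left t)
      ((Measure.measurePreserving_sub_left volume t).quasiMeasurePreserving.ae (hge j k))
    simp only [stateKernel_eq_integral_stepFun hδ hA j k] at h1
    refine h1.trans ((hI k).integral_mul_stepFun ((measurable_pi_apply k).comp hZ.measurable) hδ
      (continuous_stateKernelDeriv j k).measurable (fun r hr => hC r hr.le) t ?_)
    filter_upwards [hZ.ae_tempered hδ] with ω hω
    refine (hω.integrableOn_exp_mul_sub hδ t).mono' ?_ (Eventually.of_forall fun r => ?_)
    · have hm := (measurable_pi_apply k).comp (hZ.measurable_path ω)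
      exact ((Continuous.measurable (by fun_prop)).mul ((hm.comp
        (measurable_const.sub measurable_id)).sub measurable_const)).aestronglyMeasurable
    · rw [norm_mul, Real.norm_eq_abs, Real.abs_exp]
      exact mul_le_mul_of_nonneg_left (norm_le_pi_norm (Z (t - r) ω - Z t ω) k) (Real.exp_nonneg _)
  have hall : ∀ᵐ ω ∂μ, ∀ j, X t ω j = ∑ k, ∫ r in Set.Ioi (0 : ℝ),
      stateKernelDeriv p P Q r j k * (Z (t - r) ω k - Z t ω k) := by
    rw [ae_all_iff]
    intro j
    have h2 : ∀ᵐ ω ∂μ, ∀ k, I k (fun u => g (t - u) j k) ω = ∫ r in Set.Ioi (0 : ℝ),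
      stateKernelDeriv p P Q r j k * (Z (t - r) ω k - Z t ω k) := ae_all_iff.2 (hIk j)
    filter_upwards [h2, hgX t j] with ω h3 h4
    rw [h4]
    exact Finset.sum_congr rfl fun k _ => h3 k
  filter_upwards [hall, hZ.ae_tempered hδ] with ω h1 h2
  have hy := h2.mulVec (matE p P Q)
  have hint := integrableOn_statePath (A := matA p P) hδ hA hy t
  funext j
  rw [h1 j, statePath, ← mulVec_integral _ hint]
  have hint2 := integrable_mulVec (firstBlock n p) hint
  rw [← ContinuousLinearMap.proj_apply (R := ℝ) (φ := fun _ : Fin n => ℝ) j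
    (∫ r in Set.Ioi (0 : ℝ), _), ← ContinuousLinearMap.integral_comp_comm _ hint2]
  rw [← integral_finsetSum]
  · refine integral_congr_ae (Eventually.of_forall fun r => ?_)
    simp only [ContinuousLinearMap.proj_apply]
    rw [← Matrix.mulVec_sub]
    simp only [Matrix.mulVec_mulVec, ← Matrix.mul_assoc]
    rfl
  · intro k _
    obtain ⟨C, hC⟩ := exists_abs_stateKernelDeriv_le (N := Q) hA j k
    refine ((h2.integrableOn_exp_mul_sub hδ t).const_mul C).mono' ?_
      ((ae_restrict_mem measurableSet_Ioi).mono fun r hr => ?_)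
    · have hm := (measurable_pi_apply k).comp (hZ.measurable_path ω)
      exact ((continuous_stateKernelDeriv j k).measurable.mul ((hm.comp
        (measurable_const.sub measurable_id)).sub measurable_const)).aestronglyMeasurable
    · rw [norm_mul, ← mul_assoc]
      refine mul_le_mul (hC r (le_of_lt hr)) (norm_le_pi_norm (Z (t - r) ω - Z t ω) k)
        (norm_nonneg _) ((abs_nonneg _).trans (hC r (le_of_lt hr)))

end StateSpace

/-! ### Lebesgue points of the noise at fixed times -/

section LebesguePoints

open Filter Topology

/-- The left end of the cell of the grid of mesh `1 / m` that contains `x`. -/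
def gridPt (m : ℕ) (x : ℝ) : ℝ := ⌊m * x⌋ / m

theorem gridPt_le {m : ℕ} (hm : 0 < m) (x : ℝ) : gridPt m x ≤ x := by
  have hm' : (0 : ℝ) < m := by exact_mod_cast hm
  rw [gridPt, div_le_iff₀ hm', mul_comm]; exact Int.floor_le _

theorem abs_sub_gridPt_le {m : ℕ} (hm : 0 < m) (x : ℝ) : |x - gridPt m x| ≤ 1 / m := by
  have hm' : (0 : ℝ) < m := by exact_mod_cast hm
  rw [abs_of_nonneg (sub_nonneg.2 (gridPt_le hm x)), gridPt, sub_le_iff_le_add, ← add_div,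
    le_div_iff₀ hm', mul_comm, add_comm]
  exact (Int.lt_floor_add_one _).le

/-- A function of a parameter, evaluated on a grid, is jointly measurable. -/
theorem measurable_comp_gridPt {β E : Type*} [MeasurableSpace β] [MeasurableSpace E]
    {f : ℝ → β → E} (hf : ∀ x, Measurable (f x)) (m : ℕ) :
    Measurable (Function.uncurry fun x b => f (gridPt m x) b) := by
  have h1 : Measurable fun y : ℤ × β => f ((y.1 : ℝ) / m) y.2 :=
    measurable_from_prod_countable_right fun i => hf ((i : ℝ) / m)
  exact h1.comp (((Int.measurable_floor.comp (measurable_const.mul measurable_fst)).prodMk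
    measurable_snd))

/-- The closed interval of radius `2⁻ᵏ` around `0`. -/
def dyadicBall (k : ℕ) : Set ℝ := Metric.closedBall 0 ((1 / 2) ^ k)

/-- The mean of the norm over the interval of radius `2⁻ᵏ` around `0`. -/
def ballMean {E : Type*} [NormedAddCommGroup E] (k : ℕ) (z : ℝ → E) : ENNReal :=
  (∫⁻ x in dyadicBall k, ‖z x‖ₑ) / volume (dyadicBall k)

theorem measurable_ballMean {β E : Type*} [MeasurableSpace β] [NormedAddCommGroup E]
    [MeasurableSpace E] [OpensMeasurableSpace E] {f : β → ℝ → E}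
    (hf : Measurable (Function.uncurry f)) (k : ℕ) : Measurable fun b => ballMean k (f b) := by
  have h : Measurable fun b => ∫⁻ x, ‖Function.uncurry f (b, x)‖ₑ ∂(volume.restrict (dyadicBall k)) :=
    hf.enorm.lintegral_prod_right'
  exact h.div_const _

theorem tendsto_one_half_pow_nhdsGT : Tendsto (fun k : ℕ => ((1 : ℝ) / 2) ^ k) atTop (𝓝[>] 0) :=
  tendsto_nhdsWithin_iff.2 ⟨tendsto_pow_atTop_nhds_zero_of_lt_one (by norm_num) (by norm_num),
    Eventually.of_forall fun k => by simp⟩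

theorem ballMean_comp_add {E : Type*} [NormedAddCommGroup E] (k : ℕ) (f : ℝ → E) (r : ℝ) (c : E) :
    ballMean k (fun x => f (x + r) - c) = (∫⁻ y in Metric.closedBall r ((1 / 2) ^ k), ‖f y - c‖ₑ) /
      volume (Metric.closedBall r ((1 / 2 : ℝ) ^ k)) := by
  have h := (measurePreserving_add_right (volume : Measure ℝ) r).setLIntegral_comp_preimage_emb
    (measurableEmbedding_addRight r) (fun y => ‖f y - c‖ₑ) (Metric.closedBall r ((1 / 2) ^ k))
  have hs : (fun x => x + r) ⁻¹' Metric.closedBall r ((1 / 2) ^ k) = dyadicBall k := by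
    ext x; simp [dyadicBall]
  rw [← h, hs, ballMean, dyadicBall, Real.volume_closedBall, Real.volume_closedBall]

theorem ae_tendsto_ballMean {E : Type*} [NormedAddCommGroup E] {f : ℝ → E}
    (hf : LocallyIntegrable f) :
    ∀ᵐ r, Tendsto (fun k => ballMean k fun x => f (x + r) - f r) atTop (𝓝 0) := by
  filter_upwards [(IsUnifLocDoublingMeasure.vitaliFamily (volume : Measure ℝ)
    1).ae_tendsto_lintegral_enorm_sub_div hf] with r hr
  simp only [ballMean_comp_add]
  refine hr.comp (IsUnifLocDoublingMeasure.tendsto_closedBall_filterAt volume (fun _ => r)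
    (fun k : ℕ => (1 / 2) ^ k) tendsto_one_half_pow_nhdsGT (Eventually.of_forall fun k => ?_))
  simp

theorem ballMean_le_add {E : Type*} [NormedAddCommGroup E] (k : ℕ) {z w : ℝ → E}
    (hw : AEMeasurable (fun x => ‖w x‖ₑ) (volume.restrict (dyadicBall k))) :
    ballMean k z ≤ ballMean k w + ballMean k fun x => z x - w x := by
  rw [ballMean, ballMean, ballMean, ← ENNReal.add_div, ← lintegral_add_left' hw]
  refine ENNReal.div_le_div_right (lintegral_mono fun x => ?_) _
  calc ‖z x‖ₑ = ‖w x + (z x - w x)‖ₑ := by rw [add_sub_cancel]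
    _ ≤ _ := enorm_add_le _ _

theorem ballMean_sub_comm {E : Type*} [NormedAddCommGroup E] (k : ℕ) (z w : ℝ → E) :
    ballMean k (fun x => z x - w x) = ballMean k fun x => w x - z x := by
  simp only [ballMean, ← enorm_neg (z _ - w _), neg_sub]

set_option linter.unusedSectionVars false

variable {Ω : Type*} [MeasurableSpace Ω] {μ : Measure Ω} [IsProbabilityMeasure μ] {n : ℕ}
  {Z : ℝ → Ω → (Fin n → ℝ)}

namespace IsNoise

/-- Grids on which the noise changes little. -/
theorem exists_grid (hZ : IsNoise μ Z) : ∃ m : ℕ → ℕ, (∀ k, 0 < m k) ∧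
    ∀ k x, incrNorm μ Z (x - gridPt (m k) x) ≤ (1 / 2) ^ k := by
  have h : ∀ k : ℕ, ∃ m : ℕ, 0 < m ∧ ∀ x, incrNorm μ Z (x - gridPt m x) ≤ (1 / 2) ^ k := by
    intro k
    obtain ⟨δ, hδ, h⟩ := Metric.eventually_nhds_iff.1
      (hZ.tendsto_incrNorm.eventually (ge_mem_nhds (show (0 : ℝ) < (1 / 2) ^ k by positivity)))
    obtain ⟨m, hm⟩ := exists_nat_one_div_lt hδ
    refine ⟨m + 1, m.succ_pos, fun x => h ?_⟩
    rw [Real.dist_0_eq_abs]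
    refine (abs_sub_gridPt_le m.succ_pos x).trans_lt ?_
    exact_mod_cast hm
  choose m hm using h
  exact ⟨m, fun k => (hm k).1, fun k => (hm k).2⟩

theorem lintegral_enorm_sub (hZ : IsNoise μ Z) (a b : ℝ) :
    ∫⁻ ω, ‖Z a ω - Z b ω‖ₑ ∂μ = ENNReal.ofReal (incrNorm μ Z (a - b)) := by
  rw [← hZ.integral_norm_sub, ofReal_integral_norm_eq_lintegral_enorm (hZ.integrable_sub a b)]

theorem measurable_comp_gridPt (hZ : IsNoise μ Z) (m : ℕ) (r : ℝ) :
    Measurable (Function.uncurry fun x ω => Z (gridPt m x + r) ω) :=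
  MCARMA.measurable_comp_gridPt (f := fun x ω => Z (x + r) ω) (fun _ => hZ.measurable_apply _) m

theorem measurable_comp_add (hZ : IsNoise μ Z) (r : ℝ) :
    Measurable (Function.uncurry fun x ω => Z (x + r) ω) :=
  hZ.measurable.comp ((measurable_fst.add_const r).prodMk measurable_snd)

/-- The expected means are at most `2⁻ᵏ`; being summable, they force almost sure convergence. -/
theorem ae_tendsto_ballMean_sub (hZ : IsNoise μ Z) {m : ℕ → ℕ}
    (hm : ∀ k x, incrNorm μ Z (x - gridPt (m k) x) ≤ (1 / 2) ^ k) (r : ℝ) :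
    ∀ᵐ ω ∂μ, Tendsto (fun k => ballMean k fun x => Z (x + r) ω - Z (gridPt (m k) x + r) ω)
      atTop (𝓝 0) := by
  have hmeas : ∀ k, Measurable (Function.uncurry fun (ω : Ω) (x : ℝ) =>
      Z (x + r) ω - Z (gridPt (m k) x + r) ω) := fun k =>
    ((hZ.measurable_comp_add r).sub (hZ.measurable_comp_gridPt (m k) r)).comp measurable_swap
  have hmeas' : ∀ k, Measurable fun ω =>
      ballMean k fun x => Z (x + r) ω - Z (gridPt (m k) x + r) ω := fun k =>
    measurable_ballMean (hmeas k) k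
  have hbound : ∀ k, ∫⁻ ω, ballMean k (fun x => Z (x + r) ω - Z (gridPt (m k) x + r) ω) ∂μ ≤
      ENNReal.ofReal ((1 / 2) ^ k) := by
    intro k
    simp only [ballMean, div_eq_mul_inv]
    have h1 : Measurable fun ω => ∫⁻ x in dyadicBall k,
        ‖Z (x + r) ω - Z (gridPt (m k) x + r) ω‖ₑ :=
      (hmeas k).enorm.lintegral_prod_right' (ν := volume.restrict (dyadicBall k))
    rw [lintegral_mul_const _ h1, lintegral_lintegral_swap (f := fun ω x =>
      ‖Z (x + r) ω - Z (gridPt (m k) x + r) ω‖ₑ) (hmeas k).enorm.aemeasurable]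
    simp only [hZ.lintegral_enorm_sub, add_sub_add_right_eq_sub]
    rw [← div_eq_mul_inv]
    refine ENNReal.div_le_of_le_mul ?_
    rw [← setLIntegral_const]
    exact lintegral_mono fun x => ENNReal.ofReal_le_ofReal (hm k x)
  have hsum : ∫⁻ ω, ∑' k, ballMean k (fun x => Z (x + r) ω - Z (gridPt (m k) x + r) ω) ∂μ ≠ ⊤ := by
    rw [lintegral_tsum fun k => (hmeas' k).aemeasurable]
    refine ne_top_of_le_ne_top ?_ (ENNReal.tsum_le_tsum hbound)
    exact (summable_geometric_of_lt_one (by norm_num) (by norm_num)).tsum_ofReal_ne_top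
  filter_upwards [ae_lt_top (Measurable.tsum hmeas') hsum] with ω hω
  exact ENNReal.tendsto_atTop_zero_of_tsum_ne_top hω.ne

/-- Every fixed time is almost surely a Lebesgue point of the noise. -/
theorem ae_tendsto_ballMean (hZ : IsNoise μ Z) (r : ℝ) :
    ∀ᵐ ω ∂μ, Tendsto (fun k => ballMean k fun x => Z (x + r) ω - Z r ω) atTop (𝓝 0) := by
  obtain ⟨m, -, hm⟩ := hZ.exists_grid
  -- Evaluating the noise on grids does not change the limit, and the Lebesgue point property then
  -- involves only countably many values of the increments.
  have hiff : ∀ r, ∀ᵐ ω ∂μ,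
      (Tendsto (fun k => ballMean k fun x => Z (x + r) ω - Z r ω) atTop (𝓝 0) ↔
      Tendsto (fun k => ballMean k fun x => Z (gridPt (m k) x + r) ω - Z r ω) atTop (𝓝 0)) := by
    intro r
    filter_upwards [hZ.ae_tendsto_ballMean_sub hm r] with ω hω
    have m1 : Measurable fun x => Z (x + r) ω - Z r ω :=
      (hZ.measurable_comp_add r).of_uncurry_right.sub_const _
    have m2 : ∀ k, Measurable fun x => Z (gridPt (m k) x + r) ω - Z r ω := fun k =>
      (hZ.measurable_comp_gridPt (m k) r).of_uncurry_right.sub_const _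
    constructor
    · intro h
      refine tendsto_of_tendsto_of_tendsto_of_le_of_le tendsto_const_nhds
        (by simpa using h.add hω) (fun _ => zero_le) fun k => ?_
      refine (ballMean_le_add k m1.enorm.aemeasurable).trans ?_
      refine add_le_add_right (le_of_eq ?_) _
      rw [ballMean_sub_comm]
      simp only [sub_sub_sub_cancel_right]
    · intro h
      refine tendsto_of_tendsto_of_tendsto_of_le_of_le tendsto_const_nhds
        (by simpa using h.add hω) (fun _ => zero_le) fun k => ?_
      refine (ballMean_le_add k (m2 k).enorm.aemeasurable).trans ?_
      refine add_le_add_right (le_of_eq ?_) _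
      simp only [sub_sub_sub_cancel_right]
  -- The grid makes the mean a measurable functional for the product σ-algebra on paths, as required
  -- to compare laws.
  have hmeasD : ∀ k, Measurable fun z : ℝ → Fin n → ℝ => ballMean k fun x => z (gridPt (m k) x) :=
    fun k => by
      refine measurable_ballMean (f := fun (z : ℝ → Fin n → ℝ) x => z (gridPt (m k) x)) ?_ k
      exact (MCARMA.measurable_comp_gridPt (f := fun x (z : ℝ → Fin n → ℝ) => z x)
        (fun x => measurable_pi_apply x) (m k)).comp measurable_swap
  have hset : MeasurableSet {z : ℝ → Fin n → ℝ |
      Tendsto (fun k => ballMean k fun x => z (gridPt (m k) x)) atTop (𝓝 0)} :=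
    measurableSet_tendsto _ hmeasD
  -- Lebesgue differentiation along each path, with the quantifiers exchanged by Fubini, provides
  -- one good time; stationarity of increments then carries the property to every time.
  obtain ⟨r₀, hr₀⟩ : ∃ r₀, ∀ᵐ ω ∂μ,
      Tendsto (fun k => ballMean k fun x => Z (x + r₀) ω - Z r₀ ω) atTop (𝓝 0) := by
    have h1 : ∀ᵐ ω ∂μ, ∀ᵐ r,
        Tendsto (fun k => ballMean k fun x => Z (x + r) ω - Z r ω) atTop (𝓝 0) := by
      have h2 : ∀ᵐ ω ∂μ, ∀ N : ℕ, IntegrableOn (fun u => Z u ω) (Set.Icc (-N) N) :=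
        ae_all_iff.2 fun N => hZ.ae_integrableOn _ _
      filter_upwards [h2] with ω hω
      refine MCARMA.ae_tendsto_ballMean (f := fun u => Z u ω) ?_
      refine (locallyIntegrable_iff).2 fun K hK => ?_
      obtain ⟨R, hR⟩ := hK.isBounded.subset_closedBall 0
      obtain ⟨N, hN⟩ := exists_nat_ge R
      refine (hω N).mono_set fun x hx => abs_le.1 ?_
      have := hR hx
      rw [mem_closedBall_zero_iff, Real.norm_eq_abs] at this
      exact this.trans hN
    have hm2 : MeasurableSet {y : ℝ × Ω |
        Tendsto (fun k => ballMean k fun x => Z (x + y.1) y.2 - Z y.1 y.2) atTop (𝓝 0)} := by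
      refine measurableSet_tendsto _ fun k => ?_
      refine measurable_ballMean (f := fun (y : ℝ × Ω) x => Z (x + y.1) y.2 - Z y.1 y.2) ?_ k
      exact (hZ.measurable.comp ((measurable_snd.add (measurable_fst.comp measurable_fst)).prodMk
        (measurable_snd.comp measurable_fst))).sub (hZ.measurable.comp measurable_fst)
    have h3 := (Measure.ae_ae_comm (μ := (volume : Measure ℝ)) (ν := μ) (p := fun r ω =>
      Tendsto (fun k => ballMean k fun x => Z (x + r) ω - Z r ω) atTop (𝓝 0)) hm2).2 h1
    exact h3.exists
  have h4 := (hiff r₀).and hr₀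
  have h5 : ∀ᵐ ω ∂μ, Tendsto
      (fun k => ballMean k fun x => Z (gridPt (m k) x + r) ω - Z r ω) atTop (𝓝 0) :=
    (hZ.identDistrib_comp (Φ := id) measurable_id r₀ r).ae_snd hset (h4.mono fun ω h => h.1.1 h.2)
  filter_upwards [hiff r, h5] with ω h6 h7
  exact h6.2 h7

end IsNoise

end LebesguePoints

/-! ### Derivatives of an MCARMA process -/

section Derivatives

open Filter Topology

set_option linter.unusedSectionVars false

/-- Almost sure limits of functions that are measurable up to null sets. -/
theorem aestronglyMeasurable_of_tendsto {Ω : Type*} {m m0 : MeasurableSpace Ω}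
    {μ : Measure Ω} {E : Type*} [NormedAddCommGroup E] [CompleteSpace E] {f : ℕ → Ω → E} {g : Ω → E}
    (hf : ∀ k, AEStronglyMeasurable[m] (f k) μ)
    (h : ∀ᵐ ω ∂μ, Tendsto (fun k => f k ω) atTop (𝓝 (g ω))) : AEStronglyMeasurable[m] g μ := by
  refine ⟨fun ω => limUnder atTop fun k => (hf k).mk (f k) ω,
    @StronglyMeasurable.limUnder _ _ _ m _ _ _ _ _ _ _ fun k => (hf k).stronglyMeasurable_mk, ?_⟩
  filter_upwards [h, ae_all_iff.2 fun k => (hf k).ae_eq_mk] with ω h1 h2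
  exact (h1.congr h2).limUnder_eq.symm

/-- Dyadic radii suffice. If `2^{-k-1} < |t - r| ≤ 2⁻ᵏ`, the interval between `r` and `t` lies in
the ball of radius `2⁻ᵏ`, whose length is at most `4|t - r|`; hence the constant `c / 4`. -/
theorem hasDerivAt_integral_of_tendsto_ballMean {E : Type*} [NormedAddCommGroup E]
    [NormedSpace ℝ E] [CompleteSpace E] {z : ℝ → E} {r : ℝ}
    (hz : ∀ t, IntervalIntegrable z volume r t)
    (h : Tendsto (fun k => ballMean k fun x => z (x + r) - z r) atTop (𝓝 0)) :
    HasDerivAt (fun t => ∫ u in r..t, z u) (z r) r := by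
  rw [hasDerivAt_iff_isLittleO, Asymptotics.isLittleO_iff]
  intro c hc
  obtain ⟨N, hN⟩ := eventually_atTop.1 (h.eventually (ge_mem_nhds
    (show (0 : ENNReal) < ENNReal.ofReal (c / 4) by positivity)))
  filter_upwards [Metric.closedBall_mem_nhds r (show (0 : ℝ) < (1 / 2) ^ N by positivity)] with t ht
  rw [Metric.mem_closedBall, Real.dist_eq] at ht
  rcases eq_or_ne t r with rfl | hne
  · simp
  have hpos : 0 < |t - r| := abs_pos.2 (sub_ne_zero.2 hne)
  obtain ⟨k, hk1, hk2⟩ := exists_nat_pow_near_of_lt_one hpos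
    (ht.trans (pow_le_one₀ (by norm_num) (by norm_num))) (show (0 : ℝ) < 1 / 2 by norm_num)
    (by norm_num)
  have hNk : N ≤ k := by
    by_contra hlt
    have := pow_le_pow_of_le_one (show (0 : ℝ) ≤ 1 / 2 by norm_num) (by norm_num)
      (show k + 1 ≤ N by omega)
    linarith
  have h1 := hN k hNk
  rw [ballMean_comp_add, Real.volume_closedBall, ENNReal.div_le_iff (by simp) ENNReal.ofReal_ne_top,
    ← ENNReal.ofReal_mul (by positivity)] at h1
  have e1 : (∫ u in r..t, z u) - (∫ u in r..r, z u) - (t - r) • z r = ∫ u in r..t, (z u - z r) := by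
    rw [intervalIntegral.integral_sub (hz t) intervalIntegrable_const,
      intervalIntegral.integral_const, intervalIntegral.integral_same, sub_zero]
  rw [e1]
  have hsub : Set.uIoc r t ⊆ Metric.closedBall r ((1 / 2) ^ k) := fun u hu => by
    rw [Metric.mem_closedBall, Real.dist_eq]
    refine le_trans ?_ hk2
    have := Set.abs_sub_left_of_mem_uIcc (Set.uIoc_subset_uIcc hu)
    exact this
  have h2 : ‖∫ u in r..t, (z u - z r)‖ₑ ≤ ENNReal.ofReal (c / 4 * (2 * (1 / 2) ^ k)) := by
    rw [← ofReal_norm, intervalIntegral.norm_integral_eq_norm_integral_uIoc,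
      ofReal_norm]
    exact (enorm_integral_le_lintegral_enorm _).trans ((lintegral_mono_set hsub).trans h1)
  rw [← ofReal_norm, ENNReal.ofReal_le_ofReal_iff (by positivity)] at h2
  refine h2.trans ?_
  rw [Real.norm_eq_abs]
  have h3 : ((1 : ℝ) / 2) ^ (k + 1) = (1 / 2) ^ k / 2 := by ring
  rw [h3] at hk1
  nlinarith

attribute [local instance] Matrix.linftyOpNormedAddCommGroup Matrix.linftyOpNormedSpace
  Matrix.linftyOpNormedRing Matrix.linftyOpNormedAlgebra

variable {ι κ : Type*} [Fintype ι] [DecidableEq ι] [Fintype κ] [DecidableEq κ]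

theorem Tempered.intervalIntegrable {ε : ℝ} (hε : 0 ≤ ε) {y : ℝ → ι → ℝ} (hy : Tempered ε y)
    (s t : ℝ) : IntervalIntegrable y volume s t :=
  ⟨hy.integrableOn_Ioc hε s t, hy.integrableOn_Ioc hε t s⟩

variable {A : Matrix ι ι ℝ} {K ε : ℝ} {y : ℝ → ι → ℝ}

theorem filtered_eq_add_integral (hε : 0 < ε)
    (hA : ∀ t, 0 ≤ t → ‖expm A t‖ ≤ K * Real.exp (-(ε * t))) (hy : Tempered ε y) (s t : ℝ) :
    IntervalIntegrable (statePath A y) volume s t ∧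
      filtered A y t = filtered A y s + ∫ v in s..t, statePath A y v := by
  rcases le_total s t with h | h
  · obtain ⟨h1, h2⟩ := filtered_sub_filtered hε hA hy h
    exact ⟨h1, by rw [← h2]; abel⟩
  · obtain ⟨h1, h2⟩ := filtered_sub_filtered hε hA hy h
    exact ⟨h1.symm, by rw [intervalIntegral.integral_symm, ← h2]; abel⟩

theorem continuous_filtered (hε : 0 < ε)
    (hA : ∀ t, 0 ≤ t → ‖expm A t‖ ≤ K * Real.exp (-(ε * t))) (hy : Tempered ε y) :
    Continuous (filtered A y) := by
  have h : filtered A y = fun t => filtered A y 0 + ∫ v in (0 : ℝ)..t, statePath A y v :=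
    funext fun t => (filtered_eq_add_integral hε hA hy 0 t).2
  rw [h]
  exact continuous_const.add
    (intervalIntegral.continuous_primitive (fun a b => (filtered_eq_add_integral hε hA hy a b).1) 0)

/-- At Lebesgue points of the input, the state equation holds in differential form. -/
theorem hasDerivAt_filtered (hε : 0 < ε)
    (hA : ∀ t, 0 ≤ t → ‖expm A t‖ ≤ K * Real.exp (-(ε * t))) (hy : Tempered ε y) {r : ℝ}
    (h : Tendsto (fun k => ballMean k fun x => y (x + r) - y r) atTop (𝓝 0)) :
    HasDerivAt (filtered A y) (statePath A y r) r := by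
  have hc : Continuous fun v => A *ᵥ filtered A y v :=
    (mulVecCLM A).continuous.comp (continuous_filtered hε hA hy)
  have e : filtered A y = fun t => filtered A y r +
      ((∫ v in r..t, y v) + ∫ v in r..t, A *ᵥ filtered A y v) := by
    funext t
    rw [(filtered_eq_add_integral hε hA hy r t).2, ← intervalIntegral.integral_add
      (hy.intervalIntegrable hε.le r t) (hc.intervalIntegrable r t)]
    simp only [statePath_eq hε hA hy]
  have h2 : HasDerivAt (fun t => ∫ v in r..t, A *ᵥ filtered A y v) (A *ᵥ filtered A y r) r :=
    intervalIntegral.integral_hasDerivAt_right (hc.intervalIntegrable r r)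
      (hc.stronglyMeasurableAtFilter _ _) hc.continuousAt
  rw [statePath_eq hε hA hy]
  refine HasDerivAt.congr_of_eventuallyEq (f := fun t => filtered A y r +
      ((∫ v in r..t, y v) + ∫ v in r..t, A *ᵥ filtered A y v)) ?_ (Eventually.of_forall fun t => congrFun e t)
  exact ((hasDerivAt_integral_of_tendsto_ballMean (hy.intervalIntegrable hε.le r) h).add
    h2).const_add _

theorem tendsto_ballMean_mulVec (S : Matrix ι κ ℝ) {z : ℝ → κ → ℝ} {r : ℝ}
    (h : Tendsto (fun k => ballMean k fun x => z (x + r) - z r) atTop (𝓝 0)) :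
    Tendsto (fun k => ballMean k fun x => S *ᵥ z (x + r) - S *ᵥ z r) atTop (𝓝 0) := by
  refine tendsto_of_tendsto_of_tendsto_of_le_of_le tendsto_const_nhds
    (?_ : Tendsto (fun k => ENNReal.ofReal ‖S‖ * ballMean k fun x => z (x + r) - z r) atTop (𝓝 0))
    (fun _ => zero_le) fun k => ?_
  · have := ENNReal.Tendsto.const_mul h (Or.inr (ENNReal.ofReal_ne_top (r := ‖S‖)))
    rwa [mul_zero] at this
  · simp only
    rw [ballMean, ballMean, ← mul_div_assoc, ← lintegral_const_mul' _ _ ENNReal.ofReal_ne_top]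
    refine ENNReal.div_le_div_right (lintegral_mono fun x => ?_) _
    rw [← Matrix.mulVec_sub, ← ofReal_norm, ← ofReal_norm,
      ← ENNReal.ofReal_mul (norm_nonneg _)]
    exact ENNReal.ofReal_le_ofReal (Matrix.linfty_opNorm_mulVec _ _)

variable {n p q : ℕ} {P Q : (Matrix (Fin n) (Fin n) ℝ)[X]}

/-- The state of the process. -/
def state (p : ℕ) (P Q : (Matrix (Fin n) (Fin n) ℝ)[X]) (z : ℝ → Fin n → ℝ) (t : ℝ) :
    Fin p × Fin n → ℝ :=
  statePath (matA p P) (fun u => matE p P Q *ᵥ z u) t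

/-- The derivatives of the output, in terms of the state. -/
def outputDeriv (p : ℕ) (P Q : (Matrix (Fin n) (Fin n) ℝ)[X]) (j : ℕ) (z : ℝ → Fin n → ℝ) (t : ℝ) :
    Fin n → ℝ :=
  (firstBlock n p * matA p P ^ j) *ᵥ state p P Q z t

/-- Below the top order the Markov parameter `e₁ᵀ Aʲ E` vanishes, so the noise drops out of
`statePath_eq`. The output is then a linear function of `filtered`, which is differentiable at
Lebesgue points. -/
theorem hasDerivAt_outputDeriv [Nontrivial (Matrix (Fin n) (Fin n) ℝ)] (hP : P.Monic)
    (hp : P.natDegree = p) (hQ : Q.Monic) (hq : Q.natDegree = q) (hqp : q < p) (hε : 0 < ε)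
    (hA : ∀ t, 0 ≤ t → ‖expm (matA p P) t‖ ≤ K * Real.exp (-(ε * t))) {z : ℝ → Fin n → ℝ}
    (hz : Tempered ε z) {r : ℝ}
    (h : Tendsto (fun k => ballMean k fun x => z (x + r) - z r) atTop (𝓝 0)) {j : ℕ}
    (hj : j + 1 < p - q) :
    HasDerivAt (outputDeriv p P Q j z) (outputDeriv p P Q (j + 1) z r) r := by
  have hy := hz.mulVec (matE p P Q)
  have e : outputDeriv p P Q j z = fun t =>
      (firstBlock n p * matA p P ^ (j + 1)) *ᵥ
        filtered (matA p P) (fun u => matE p P Q *ᵥ z u) t := by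
    funext t
    rw [outputDeriv, state, statePath_eq hε hA hy, Matrix.mulVec_add, Matrix.mulVec_mulVec,
      Matrix.mul_assoc, firstBlock_mul_pow_mul_matE, markov_of_lt hP hp hQ hq hqp (by omega),
      Matrix.zero_mulVec, zero_add, Matrix.mulVec_mulVec, Matrix.mul_assoc, ← pow_succ]
  rw [e]
  exact (mulVecCLM (firstBlock n p * matA p P ^ (j + 1))).hasFDerivAt.comp_hasDerivAt r
    (hasDerivAt_filtered hε hA hy (tendsto_ballMean_mulVec _ h))

variable {Ω : Type*} [MeasurableSpace Ω] {μ : Measure Ω} [IsProbabilityMeasure μ]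
  {Z X : ℝ → Ω → (Fin n → ℝ)} {I : Fin n → (ℝ → ℝ) → Ω → ℝ}

theorem IsMCARMA.isDerivFamily [Nontrivial (Matrix (Fin n) (Fin n) ℝ)] (hP : P.Monic)
    (hp : P.natDegree = p) (hQ : Q.Monic) (hq : Q.natDegree = q) (hqp : q < p)
    (hPdet : ∀ z : ℂ, 0 ≤ z.re → (matEval P z).det ≠ 0) (hZ : IsNoise μ Z)
    (hI : ∀ k, IsRegularIntegrator μ (fun t ω => Z t ω k) (I k)) (hX : IsMCARMA μ P Q I X) :
    IsDerivFamily μ (p - q) X fun j t ω => outputDeriv p P Q j (fun u => Z u ω) t := by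
  obtain ⟨K, δ, -, hδ, hA⟩ := exists_norm_expm_companion_le hP hp hPdet
  refine ⟨fun t => ?_, fun j hj t => ?_⟩
  · refine EventuallyEq.trans (Eventually.of_forall fun ω => ?_)
      (hX.ae_eq_statePath hP hp hQ hq hqp hPdet hZ hI t).symm
    simp only [outputDeriv, pow_zero, Matrix.mul_one, state]
  · filter_upwards [hZ.ae_tempered hδ, hZ.ae_tendsto_ballMean t] with ω h1 h2
    exact hasDerivAt_outputDeriv hP hp hQ hq hqp hδ hA h1 h2 hj

/-- A sequence of left difference quotients involves countably many times, none after `t`. The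
derivatives are therefore unique up to null sets and determined by the past. -/
theorem tendsto_slope_left {E : Type*} [NormedAddCommGroup E] [NormedSpace ℝ E] {f : ℝ → E}
    {f' : E} {t : ℝ} (h : HasDerivAt f f' t) :
    Tendsto (fun k : ℕ => (-((k : ℝ) + 1)) • (f (t - 1 / ((k : ℝ) + 1)) - f t)) atTop (𝓝 f') := by
  have h1 : Tendsto (fun k : ℕ => t - 1 / ((k : ℝ) + 1)) atTop (𝓝[≠] t) := by
    refine tendsto_nhdsWithin_iff.2 ⟨?_, Eventually.of_forall fun k => ?_⟩
    · simpa using (tendsto_const_nhds (x := t)).sub tendsto_one_div_add_atTop_nhds_zero_nat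
    · have : (0 : ℝ) < 1 / ((k : ℝ) + 1) := by positivity
      simp only [Set.mem_compl_iff, Set.mem_singleton_iff]
      linarith
  refine ((hasDerivAt_iff_tendsto_slope.1 h).comp h1).congr fun k => ?_
  simp only [Function.comp_apply, slope_def_module, sub_sub_cancel_left]
  congr 1
  rw [one_div, inv_neg, inv_inv]

/-- The derivatives of a process are determined up to null sets. -/
theorem IsDerivFamily.ae_eq {m : ℕ} {D D' : ℕ → ℝ → Ω → (Fin n → ℝ)}
    (hD : IsDerivFamily μ m X D) (hD' : IsDerivFamily μ m X D') {j : ℕ} (hj : j < m) (t : ℝ) :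
    D j t =ᵐ[μ] D' j t := by
  induction j generalizing t with
  | zero => exact (hD.1 t).trans (hD'.1 t).symm
  | succ j ih =>
    have h1 : ∀ᵐ ω ∂μ, ∀ k : ℕ, D j (t - 1 / ((k : ℝ) + 1)) ω = D' j (t - 1 / ((k : ℝ) + 1)) ω :=
      ae_all_iff.2 fun k => ih (by omega) _
    filter_upwards [h1, ih (by omega) t, hD.2 j hj t, hD'.2 j hj t] with ω h2 h3 h4 h5
    refine tendsto_nhds_unique (tendsto_slope_left h4)
      ((tendsto_slope_left h5).congr fun k => ?_)
    rw [h2, h3]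

/-- The derivatives up to a given time are determined by the past up to null sets. -/
theorem IsDerivFamily.aestronglyMeasurable {m : ℕ} {D : ℕ → ℝ → Ω → (Fin n → ℝ)}
    (hD : IsDerivFamily μ m X D) {s : ℝ} {j : ℕ} (hj : j < m) {u : ℝ} (hu : u ≤ s) :
    AEStronglyMeasurable[pastSigma X s] (D j u) μ := by
  induction j generalizing u with
  | zero =>
    have h1 : Measurable[pastSigma X s] (X u) :=
      (comap_measurable (X u)).mono (le_iSup (fun v : Set.Iic s =>
        MeasurableSpace.comap (X v) inferInstance) ⟨u, hu⟩) le_rfl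
    exact (h1.stronglyMeasurable).aestronglyMeasurable.congr (hD.1 u).symm
  | succ j ih =>
    refine aestronglyMeasurable_of_tendsto (f := fun (k : ℕ) ω =>
      (-((k : ℝ) + 1)) • (D j (u - 1 / ((k : ℝ) + 1)) ω - D j u ω)) (fun k => ?_) ?_
    · refine ((ih (by omega) ?_).sub (ih (by omega) hu)).const_smul (-((k : ℝ) + 1))
      have : (0 : ℝ) < 1 / ((k : ℝ) + 1) := by positivity
      linarith
    · filter_upwards [hD.2 j hj u] with ω h
      exact tendsto_slope_left h

end Derivatives

/-! ### Measurable versions of the predicted noise -/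

section NoisePrediction

open Filter Topology

set_option linter.unusedSectionVars false

variable {Ω : Type*} {m m0 : MeasurableSpace Ω} {μ : Measure Ω} [IsProbabilityMeasure μ] {n : ℕ}
  {X Z : ℝ → Ω → (Fin n → ℝ)}

theorem pastSigma_le (hX : ∀ t, Measurable (X t)) (s : ℝ) : pastSigma X s ≤ m0 :=
  iSup_le fun u => (hX u).comap_le

namespace IsNoise

theorem pastIncrSigma_le (hZ : IsNoise μ Z) (s : ℝ) : pastIncrSigma Z s ≤ m0 :=
  iSup_le fun r => ((hZ.measurable_apply s).sub (hZ.measurable_apply r)).comap_le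

/-- The conditional expectations of the increments of the noise have a measurable version. -/
theorem exists_measurable_condExp (hZ : IsNoise μ Z) (hm : m ≤ m0)
    (s : ℝ) : ∃ W : ℝ → Ω → (Fin n → ℝ), Measurable (Function.uncurry W) ∧
      ∀ u, W u =ᵐ[μ] μ[fun ω => Z u ω - Z s ω | m] := by
  obtain ⟨N, -, hN⟩ := hZ.exists_grid
  -- Only countably many conditional expectations enter each `V k`, which makes it jointly
  -- measurable. By `L¹` contraction it lies within `2⁻ᵏ` of the target for every `u`, so the
  -- pointwise limit is a version.
  let V : ℕ → ℝ → Ω → (Fin n → ℝ) := fun k u =>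
    μ[fun ω => Z (gridPt (N k) u) ω - Z s ω | m]
  have hV : ∀ k, Measurable (Function.uncurry (V k)) := fun k =>
    MCARMA.measurable_comp_gridPt (f := fun x => μ[fun ω => Z x ω - Z s ω | m])
      (fun x => (stronglyMeasurable_condExp.mono hm).measurable) (N k)
  have hlim : StronglyMeasurable fun y => limUnder atTop fun k => Function.uncurry (V k) y :=
    StronglyMeasurable.limUnder fun k => (hV k).stronglyMeasurable
  refine ⟨fun u ω => limUnder atTop fun k => V k u ω, hlim.measurable, fun u => ?_⟩
  set Y := μ[fun ω => Z u ω - Z s ω | m] with hY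
  have hmeas : ∀ k, Measurable fun ω => ‖V k u ω - Y ω‖ₑ := fun k =>
    (((hV k).of_uncurry_left (x := u)).sub (stronglyMeasurable_condExp.mono hm).measurable).enorm
  have hbound : ∀ k, ∫⁻ ω, ‖V k u ω - Y ω‖ₑ ∂μ ≤ ENNReal.ofReal ((1 / 2) ^ k) := by
    intro k
    have hae : (fun ω => V k u ω - Y ω) =ᵐ[μ]
        μ[fun ω => Z (gridPt (N k) u) ω - Z u ω | m] := by
      have h := condExp_sub (hZ.integrable_sub (gridPt (N k) u) s) (hZ.integrable_sub u s) m
      refine h.symm.trans (condExp_congr_ae (Eventually.of_forall fun ω => ?_))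
      simp
    have hint : Integrable (fun ω => V k u ω - Y ω) μ :=
      (integrable_condExp).sub integrable_condExp
    rw [← ofReal_integral_norm_eq_lintegral_enorm hint]
    refine ENNReal.ofReal_le_ofReal ?_
    calc ∫ ω, ‖V k u ω - Y ω‖ ∂μ
        = ∫ ω, ‖(μ[fun ω => Z (gridPt (N k) u) ω - Z u ω | m]) ω‖ ∂μ :=
          integral_congr_ae (hae.mono fun ω h => by simp only [h])
      _ ≤ ∫ ω, ‖Z (gridPt (N k) u) ω - Z u ω‖ ∂μ := integral_norm_condExp_le _
      _ = ∫ ω, ‖Z u ω - Z (gridPt (N k) u) ω‖ ∂μ := by simp only [norm_sub_rev]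
      _ ≤ (1 / 2) ^ k := by rw [hZ.integral_norm_sub]; exact hN k u
  have hsum : ∫⁻ ω, ∑' k, ‖V k u ω - Y ω‖ₑ ∂μ ≠ ⊤ := by
    rw [lintegral_tsum fun k => (hmeas k).aemeasurable]
    refine ne_top_of_le_ne_top ?_ (ENNReal.tsum_le_tsum hbound)
    exact (summable_geometric_of_lt_one (by norm_num) (by norm_num)).tsum_ofReal_ne_top
  filter_upwards [ae_lt_top (Measurable.tsum hmeas) hsum] with ω hω
  refine Tendsto.limUnder_eq ?_
  rw [tendsto_iff_edist_tendsto_0]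
  simpa only [edist_eq_enorm_sub] using ENNReal.tendsto_atTop_zero_of_tsum_ne_top hω.ne

theorem exists_isNoisePrediction (hZ : IsNoise μ Z) (s : ℝ) :
    ∃ Zhat, IsNoisePrediction μ Z s Zhat := by
  obtain ⟨W, hW, h⟩ := hZ.exists_measurable_condExp (hZ.pastIncrSigma_le s) s
  exact ⟨W, hW, fun u _ => h u⟩

end IsNoise

end NoisePrediction

/-! ### Lebesgue-Stieltjes measures of piecewise smooth functions -/

section Stieltjes

open Filter Topology

/-- Each increment of `φ` is the measure of a half-open interval, bounded by the variation there;
consecutive intervals are disjoint. -/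
theorem boundedVariationOn_of_vectorMeasure {φ : ℝ → ℝ} {V : VectorMeasure ℝ ℝ}
    (hV : V.variation Set.univ ≠ ⊤) (h : ∀ x, V (Set.Iic x) = φ x) :
    BoundedVariationOn φ Set.univ := by
  refine ne_top_of_le_ne_top hV (iSup_le ?_)
  rintro ⟨N, u, hu, _⟩
  have hIoc : ∀ i, edist (φ (u (i + 1))) (φ (u i)) ≤ V.variation (Set.Ioc (u i) (u (i + 1))) := by
    intro i
    have h1 := V.of_union (Set.Iic_disjoint_Ioc (le_refl (u i))) measurableSet_Iic
      (measurableSet_Ioc (b := u (i + 1)))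
    rw [Set.Iic_union_Ioc_eq_Iic (hu i.le_succ), h, h] at h1
    rw [edist_eq_enorm_sub, h1, add_sub_cancel_left]
    exact V.enorm_measure_le_variation _
  refine (Finset.sum_le_sum fun i _ => hIoc i).trans ?_
  rw [← measure_biUnion_finset]
  · exact measure_mono (Set.subset_univ _)
  · intro i _ j _ hij
    exact hu.pairwise_disjoint_on_Ioc_succ hij
  · exact fun i _ => measurableSet_Ioc

/-- Right continuity and the limit `0` at `-∞` make the two measures agree on all lower half-lines,
a generating π-system; the total masses agree by passing to the limit. -/
theorem stieltjes_eq_of_forall_Iic {φ : ℝ → ℝ} {V : VectorMeasure ℝ ℝ}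
    (hV : V.variation Set.univ ≠ ⊤) (h : ∀ x, V (Set.Iic x) = φ x)
    (hr : ∀ x, ContinuousWithinAt φ (Set.Ioi x) x) (hbot : Tendsto φ atBot (𝓝 0)) :
    stieltjes φ = V := by
  have hφ := boundedVariationOn_of_vectorMeasure hV h
  rw [stieltjes, dif_pos hφ]
  have hIic : ∀ x, hφ.vectorMeasure (Set.Iic x) = V (Set.Iic x) := by
    intro x
    rw [hφ.vectorMeasure_Iic, hbot.limUnder_eq, sub_zero, h, rightLim_eq_of_tendsto (hr x)]
  refine VectorMeasure.ext_of_generateFrom (Set.range Set.Iic) ?_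
    (borel_eq_generateFrom_Iic ℝ) isPiSystem_Iic ?_
  · rintro _ ⟨x, rfl⟩
    exact hIic x
  · have huniv : (Set.univ : Set ℝ) = ⋃ N : ℕ, Set.Iic (N : ℝ) := by
      refine (Set.iUnion_eq_univ_iff.2 fun x => ?_).symm
      exact exists_nat_ge x
    have hmono : Monotone fun N : ℕ => Set.Iic (N : ℝ) := fun i j hij =>
      Set.Iic_subset_Iic.2 (Nat.cast_le.2 hij)
    rw [huniv]
    refine tendsto_nhds_unique (hφ.vectorMeasure.tendsto_vectorMeasure_iUnion_atTop_nat hmono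
      fun _ => measurableSet_Iic) ?_
    simp only [hIic]
    exact V.tendsto_vectorMeasure_iUnion_atTop_nat hmono fun _ => measurableSet_Iic

theorem restrict_withDensityᵥ {α : Type*} {mα : MeasurableSpace α} {ν : Measure α} {ψ : α → ℝ}
    (hψ : Integrable ψ ν) {S : Set α} (hS : MeasurableSet S) :
    (ν.withDensityᵥ ψ).restrict S = (ν.restrict S).withDensityᵥ ψ := by
  ext i hi
  rw [VectorMeasure.restrict_apply _ hS hi, withDensityᵥ_apply hψ (hi.inter hS),
    withDensityᵥ_apply hψ.restrict hi, Measure.restrict_restrict hi]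

theorem integral_lsmul_toSignedMeasure {α : Type*} {mα : MeasurableSpace α} {ν : Measure α}
    [IsFiniteMeasure ν] (f : α → ℝ) : ∫ᵛ x, f x ∂•ν.toSignedMeasure = ∫ x, f x ∂ν := by
  have : ContinuousLinearMap.lsmul ℝ ℝ = (ContinuousLinearMap.lsmul ℝ ℝ (E := ℝ)).flip := by
    ext; simp
  rw [this, VectorMeasure.integral_toSignedMeasure]

theorem integral_withDensityᵥ {α : Type*} {mα : MeasurableSpace α} {ν : Measure α}
    {f ψ : α → ℝ} (hf : AEStronglyMeasurable f ν) (hψ : Integrable ψ ν)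
    (hfψ : Integrable (fun x => f x * ψ x) ν) :
    (ν.withDensityᵥ ψ).Integrable f ∧
      ∫ᵛ x, f x ∂•(ν.withDensityᵥ ψ) = ∫ x, f x * ψ x ∂ν := by
  have hlt : ∀ g : α → ℝ, ∀ᵐ x ∂ν, ENNReal.ofReal (g x) < ⊤ := fun g =>
    Eventually.of_forall fun x => ENNReal.ofReal_lt_top
  have hpos : ∀ g : α → ℝ, Integrable g ν → (∀ x, g x = ψ x ∨ g x = -ψ x) →
      Integrable (fun x => (ENNReal.ofReal (g x)).toReal • f x) ν := by
    intro g hg hgψ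
    refine hfψ.mono (hg.1.aemeasurable.ennreal_ofReal.ennreal_toReal.aestronglyMeasurable.smul hf)
      (Eventually.of_forall fun x => ?_)
    rw [norm_smul, norm_mul, mul_comm]
    refine mul_le_mul_of_nonneg_left ?_ (norm_nonneg _)
    rw [ENNReal.toReal_ofReal', Real.norm_eq_abs, Real.norm_eq_abs,
      abs_of_nonneg (le_max_right _ _)]
    refine max_le ?_ (abs_nonneg _)
    rcases hgψ x with h | h <;> rw [h]
    exacts [le_abs_self _, neg_le_abs _]
  have h1 := hpos ψ hψ fun x => Or.inl rfl
  have h2 := hpos (fun x => -ψ x) hψ.neg fun x => Or.inr rfl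
  have hm1 := hψ.1.aemeasurable.ennreal_ofReal
  have hm2 : AEMeasurable (fun x => ENNReal.ofReal (-ψ x)) ν := hψ.neg.1.aemeasurable.ennreal_ofReal
  have : IsFiniteMeasure (ν.withDensity fun x => ENNReal.ofReal (ψ x)) :=
    isFiniteMeasure_withDensity_ofReal hψ.2
  have : IsFiniteMeasure (ν.withDensity fun x => ENNReal.ofReal (-ψ x)) :=
    isFiniteMeasure_withDensity_ofReal hψ.neg.2
  have i1 : (ν.withDensity fun x => ENNReal.ofReal (ψ x)).toSignedMeasure.Integrable f := by
    rw [VectorMeasure.Integrable, Measure.variation_toSignedMeasure]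
    exact (integrable_withDensity_iff_integrable_smul₀' hm1 (hlt _)).2 h1
  have i2 : (ν.withDensity fun x => ENNReal.ofReal (-ψ x)).toSignedMeasure.Integrable f := by
    rw [VectorMeasure.Integrable, Measure.variation_toSignedMeasure]
    exact (integrable_withDensity_iff_integrable_smul₀' hm2 (hlt _)).2 h2
  rw [withDensityᵥ_eq_withDensity_pos_part_sub_withDensity_neg_part hψ]
  refine ⟨i1.sub_vectorMeasure i2, ?_⟩
  rw [VectorMeasure.integral_sub_vectorMeasure i1 i2, integral_lsmul_toSignedMeasure,
    integral_lsmul_toSignedMeasure, integral_withDensity_eq_integral_toReal_smul₀ hm1 (hlt _),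
    integral_withDensity_eq_integral_toReal_smul₀ hm2 (hlt _), ← integral_sub h1 h2]
  refine integral_congr_ae (Eventually.of_forall fun x => ?_)
  simp only [smul_eq_mul, ENNReal.toReal_ofReal', ← sub_mul]
  rw [max_zero_sub_eq_self, mul_comm]

variable {c ψ φ : ℝ → ℝ}

theorem signedMeasure_Iic (hc : ∀ x, HasDerivAt c (ψ x) x) (hψc : Continuous ψ)
    (hψ : IntegrableOn ψ (Set.Ioi 0)) (x : ℝ) :
    (VectorMeasure.dirac 0 (c 0) + (volume.restrict (Set.Ioi 0)).withDensityᵥ ψ :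
      VectorMeasure ℝ ℝ) (Set.Iic x) =
      if 0 ≤ x then c x else 0 := by
  rw [_root_.add_apply, withDensityᵥ_apply hψ measurableSet_Iic,
    Measure.restrict_restrict measurableSet_Iic, Set.inter_comm, Set.Ioi_inter_Iic]
  split_ifs with hx
  · rw [VectorMeasure.dirac_apply_of_mem measurableSet_Iic hx,
      ← intervalIntegral.integral_of_le hx, intervalIntegral.integral_eq_sub_of_hasDerivAt
        (fun y _ => hc y) (hψc.intervalIntegrable _ _), add_sub_cancel]
  · rw [VectorMeasure.dirac_apply_of_notMem (s := Set.Iic x) hx, Set.Ioc_eq_empty (by linarith),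
      setIntegral_empty, add_zero]

theorem variation_dirac_add_withDensityᵥ_ne_top (hψ : IntegrableOn ψ (Set.Ioi 0)) :
    (VectorMeasure.dirac 0 (c 0) + (volume.restrict (Set.Ioi 0)).withDensityᵥ ψ).variation
      Set.univ ≠ ⊤ := by
  refine ne_top_of_le_ne_top ?_ (VectorMeasure.variation_add_le _)
  rw [Measure.add_apply, VectorMeasure.variation_dirac, Measure.variation_withDensityᵥ hψ,
    withDensity_apply _ MeasurableSet.univ, Measure.restrict_univ]
  refine ENNReal.add_ne_top.2 ⟨?_, hψ.2.ne⟩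
  simp

theorem boundedVariationOn_of_hasDerivAt (hc : ∀ x, HasDerivAt c (ψ x) x) (hψc : Continuous ψ)
    (hψ : IntegrableOn ψ (Set.Ioi 0)) (hφ : ∀ x, φ x = if 0 ≤ x then c x else 0) :
    BoundedVariationOn φ Set.univ :=
  boundedVariationOn_of_vectorMeasure (variation_dirac_add_withDensityᵥ_ne_top (c := c) hψ)
    fun x => (signedMeasure_Iic hc hψc hψ x).trans (hφ x).symm

theorem stieltjes_eq_of_hasDerivAt (hc : ∀ x, HasDerivAt c (ψ x) x) (hψc : Continuous ψ)
    (hψ : IntegrableOn ψ (Set.Ioi 0)) (hφ : ∀ x, φ x = if 0 ≤ x then c x else 0) :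
    stieltjes φ =
      VectorMeasure.dirac 0 (c 0) + (volume.restrict (Set.Ioi 0)).withDensityᵥ ψ := by
  refine stieltjes_eq_of_forall_Iic (variation_dirac_add_withDensityᵥ_ne_top (c := c) hψ)
    (fun x => (signedMeasure_Iic hc hψc hψ x).trans (hφ x).symm) (fun x => ?_) ?_
  · rcases le_or_gt 0 x with hx | hx
    · refine ((hc x).continuousAt.continuousWithinAt (s := Set.Ioi x)).congr (fun y hy => ?_) ?_
      · rw [hφ, if_pos (hx.trans (le_of_lt hy))]
      · rw [hφ, if_pos hx]
    · refine ContinuousAt.continuousWithinAt ?_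
      refine (continuousAt_const (y := (0 : ℝ))).congr ?_
      filter_upwards [Iio_mem_nhds hx] with y hy
      rw [hφ, if_neg (not_le.2 hy)]
  · refine tendsto_const_nhds.congr' ?_
    filter_upwards [Iio_mem_atBot (0 : ℝ)] with y hy
    rw [hφ, if_neg (not_le.2 hy)]

/-- The jump of `φ` at `0` is an atom of mass `c 0`, which `[0, T)` includes; beyond it the measure
has density `ψ`. -/
theorem setIntegral_stieltjes (hc : ∀ x, HasDerivAt c (ψ x) x) (hψc : Continuous ψ)
    (hψ : IntegrableOn ψ (Set.Ioi 0)) (hφ : ∀ x, φ x = if 0 ≤ x then c x else 0)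
    {f : ℝ → ℝ} (hf : Measurable f) {T : ℝ} (hT : 0 < T)
    (hfT : IntegrableOn (fun v => f v * ψ v) (Set.Ioo 0 T)) :
    ∫ᵛ v in Set.Ico 0 T, f v ∂•(stieltjes φ) =
      f 0 * c 0 + ∫ v in Set.Ioo 0 T, f v * ψ v := by
  have hset : Set.Ico 0 T ∩ Set.Ioi 0 = Set.Ioo 0 T := by
    ext v; simp only [Set.mem_inter_iff, Set.mem_Ico, Set.mem_Ioi, Set.mem_Ioo]; grind
  have hd := integral_withDensityᵥ (ν := volume.restrict (Set.Ioo 0 T)) hf.aestronglyMeasurable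
    (hψ.mono_set Set.Ioo_subset_Ioi_self) hfT
  rw [stieltjes_eq_of_hasDerivAt hc hψc hψ hφ, VectorMeasure.restrict_add,
    restrict_withDensityᵥ hψ measurableSet_Ico, Measure.restrict_restrict measurableSet_Ico, hset,
    VectorMeasure.restrict_dirac_of_mem measurableSet_Ico ⟨le_refl _, hT⟩,
    VectorMeasure.integral_add_vectorMeasure ?_ hd.1, VectorMeasure.integral_dirac, hd.2]
  · simp
  · rw [VectorMeasure.Integrable, VectorMeasure.variation_dirac]
    exact (integrable_dirac (by simp)).smul_measure (by simp)

end Stieltjes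

/-! ### Convolution with the Lebesgue-Stieltjes measure of the kernel -/

section StieltjesConv

open Filter Topology

set_option linter.unusedSectionVars false

attribute [local instance] Matrix.linftyOpNormedAddCommGroup Matrix.linftyOpNormedSpace
  Matrix.linftyOpNormedRing Matrix.linftyOpNormedAlgebra

theorem aestronglyMeasurable_mulVec {κ ι α : Type*} [Fintype κ] [Fintype ι] [MeasurableSpace α]
    {ν : Measure α} {M : ℝ → Matrix κ ι ℝ} {f : α → ℝ} {w : α → ι → ℝ} (hM : Continuous M)
    (hf : Measurable f) (hw : AEStronglyMeasurable w ν) :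
    AEStronglyMeasurable (fun v => M (f v) *ᵥ w v) ν := by
  have h : Continuous fun y : ℝ × (ι → ℝ) => M y.1 *ᵥ y.2 :=
    (hM.comp continuous_fst).matrix_mulVec continuous_snd
  exact h.comp_aestronglyMeasurable (hf.aestronglyMeasurable.prodMk hw)

theorem integrableOn_mulVec_of_continuous {κ ι : Type*} [Fintype κ] [Fintype ι]
    {M : ℝ → Matrix κ ι ℝ} (hM : Continuous M) {w : ℝ → ι → ℝ} {s t : ℝ}
    (hw : IntegrableOn w (Set.Ioc s t)) :
    IntegrableOn (fun v => M v *ᵥ w v) (Set.Ioc s t) := by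
  obtain ⟨C, hC⟩ := (isCompact_Icc (a := s) (b := t)).exists_bound_of_continuousOn hM.continuousOn
  refine (hw.norm.const_mul C).mono' (aestronglyMeasurable_mulVec hM measurable_id hw.1) ?_
  refine (ae_restrict_mem measurableSet_Ioc).mono fun v hv => ?_
  exact (Matrix.linfty_opNorm_mulVec _ _).trans
    (mul_le_mul_of_nonneg_right (hC v (Set.Ioc_subset_Icc_self hv)) (norm_nonneg _))

variable {n p q : ℕ} {P Q : (Matrix (Fin n) (Fin n) ℝ)[X]} {K δ : ℝ}

theorem boundedVariationOn_gTilde (hδ : 0 < δ)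
    (hA : ∀ t, 0 ≤ t → ‖expm (companion p P) t‖ ≤ K * Real.exp (-(δ * t))) (a b : Fin n) :
    BoundedVariationOn (fun u => gTilde p P Q u a b) Set.univ := by
  refine boundedVariationOn_of_hasDerivAt
    (fun x => hasDerivAt_stateKernel_branch (d := p) (M := P) (N := Q) a b x)
    (continuous_stateKernelDeriv a b) (integrableOn_stateKernelDeriv hδ hA a b le_rfl) fun x => ?_
  split_ifs with hx
  · exact stateKernel_apply_of_nonneg hx a b
  · exact congrFun (congrFun (stateKernel_of_neg (not_le.1 hx)) a) b

theorem stateKernelDeriv_sub_mulVec (u t : ℝ) (z : Fin n → ℝ) :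
    stateKernelDeriv p P Q (t - u) *ᵥ z = (firstBlock n p * matA p P * expm (matA p P) t) *ᵥ
      (expm (matA p P) (-u) *ᵥ (matE p P Q *ᵥ z)) := by
  have h := expm_mul_comm (matA p P) (t - u)
  rw [Matrix.mulVec_mulVec, Matrix.mulVec_mulVec, Matrix.mul_assoc _ (expm _ t) (expm _ _),
    ← expm_add, ← sub_eq_add_neg, Matrix.mul_assoc (firstBlock n p), ← h, ← Matrix.mul_assoc]
  rfl

theorem firstBlock_mul_matE [Nontrivial (Matrix (Fin n) (Fin n) ℝ)] (hP : P.Monic)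
    (hp : P.natDegree = p) (hQ : Q.Monic) (hq : Q.natDegree = q) (hqp : q < p) :
    firstBlock n p * matE p P Q = if p = q + 1 then 1 else 0 := by
  have h := firstBlock_mul_pow_mul_matE (p := p) (P := P) (Q := Q) 0
  rw [pow_zero, Matrix.one_mul] at h
  rw [h]
  split_ifs with hpq
  · have h1 := markov_top hP hp hQ hq hqp
    rwa [show p - q - 1 = 0 by omega] at h1
  · exact markov_of_lt hP hp hQ hq hqp (by omega)

/-- The convolution with the Lebesgue-Stieltjes measure of the kernel. -/
theorem stieltjesConv_gTilde (hδ : 0 < δ)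
    (hA : ∀ t, 0 ≤ t → ‖expm (companion p P) t‖ ≤ K * Real.exp (-(δ * t)))
    {z : ℝ → Fin n → ℝ} (hz : Measurable z) {s t : ℝ} (hst : s < t)
    (hint : IntegrableOn z (Set.Ioc s t)) :
    stieltjesConv (gTilde p P Q) z s t = (firstBlock n p * matE p P Q) *ᵥ z t +
      (firstBlock n p * matA p P * expm (matA p P) t) *ᵥ
        ∫ v in s..t, expm (matA p P) (-v) *ᵥ (matE p P Q *ᵥ z v) := by
  have hint1 : IntegrableOn (fun v => expm (matA p P) (-v) *ᵥ (matE p P Q *ᵥ z v))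
      (Set.Ioc s t) := by
    refine integrableOn_mulVec_of_continuous ((continuous_expm _).comp continuous_neg) ?_
    exact integrable_mulVec _ hint
  have hint2 : IntegrableOn (fun u => stateKernelDeriv p P Q (t - u) *ᵥ z u) (Set.Ioc s t) := by
    simp only [stateKernelDeriv_sub_mulVec]
    exact integrable_mulVec _ hint1
  have hint3 : ∀ j k, IntegrableOn (fun v => z (t - v) k * stateKernelDeriv p P Q v j k)
      (Set.Ioo 0 (t - s)) := by
    intro j k
    have h1 : IntervalIntegrable (fun u => z u k) volume s t :=
      (intervalIntegrable_iff_integrableOn_Ioc_of_le hst.le).2 (hint.eval k)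
    have h2 := (h1.comp_sub_left t).symm
    rw [sub_self] at h2
    have h3 := h2.mul_continuousOn (continuous_stateKernelDeriv (d := p) (M := P) (N := Q) j k).continuousOn
    exact ((intervalIntegrable_iff_integrableOn_Ioc_of_le (sub_pos.2 hst).le).1 h3).mono_set
      Set.Ioo_subset_Ioc_self
  rw [intervalIntegral.integral_of_le hst.le, ← mulVec_integral _ hint1]
  simp only [← stateKernelDeriv_sub_mulVec]
  funext j
  rw [Pi.add_apply, eval_integral fun k => hint2.eval k, ← intervalIntegral.integral_of_le hst.le]
  have hsub := intervalIntegral.integral_comp_sub_left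
    (a := 0) (b := t - s) (fun u => (stateKernelDeriv p P Q (t - u) *ᵥ z u) j) t
  simp only [sub_sub_cancel, sub_zero] at hsub
  rw [← hsub, intervalIntegral.integral_of_le (sub_pos.2 hst).le, integral_Ioc_eq_integral_Ioo]
  -- The atom at `v = 0` evaluates `z` at time `t`; its mass is the jump `e₁ᵀ E` of the kernel.
  have hterm : ∀ k, ∫ᵛ v in Set.Ico 0 (t - s), z (t - v) k ∂•(stieltjes fun u =>
      gTilde p P Q u j k) = z t k * (firstBlock n p * matE p P Q) j k +
        ∫ v in Set.Ioo 0 (t - s), z (t - v) k * stateKernelDeriv p P Q v j k := by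
    intro k
    rw [setIntegral_stieltjes (f := fun v => z (t - v) k)
      (fun x => hasDerivAt_stateKernel_branch (d := p) (M := P) (N := Q) j k x)
      (continuous_stateKernelDeriv j k) (integrableOn_stateKernelDeriv hδ hA j k le_rfl)
      (fun x => ?_) ((measurable_pi_apply k).comp (hz.comp (measurable_const.sub measurable_id)))
      (sub_pos.2 hst) (hint3 j k)]
    · simp only [sub_zero, expm_zero, Matrix.one_mulVec]
      rfl
    · split_ifs with hx
      · exact stateKernel_apply_of_nonneg hx j k
      · exact congrFun (congrFun (stateKernel_of_neg (not_le.1 hx)) j) k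
  simp only [stieltjesConv, hterm]
  rw [Finset.sum_add_distrib, ← integral_finsetSum _ fun k _ => hint3 j k]
  simp only [Matrix.mulVec, dotProduct, mul_comm]

end StieltjesConv

/-! ### The state process -/

section StateProcess

open Filter Topology

set_option linter.unusedSectionVars false

attribute [local instance] Matrix.linftyOpNormedAddCommGroup Matrix.linftyOpNormedSpace
  Matrix.linftyOpNormedRing Matrix.linftyOpNormedAlgebra

variable {Ω : Type*} {m0 : MeasurableSpace Ω} {μ : Measure Ω} [IsProbabilityMeasure μ]
  {n p q : ℕ} {P Q : (Matrix (Fin n) (Fin n) ℝ)[X]} {X Z : ℝ → Ω → (Fin n → ℝ)} {K δ : ℝ}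
  {κ : Type*} [Fintype κ]

theorem measurable_mulVec {α : Type*} [MeasurableSpace α] {M : ℝ → Matrix κ (Fin n) ℝ}
    (hM : Continuous M) {f : α → ℝ} {w : α → Fin n → ℝ} (hf : Measurable f) (hw : Measurable w) :
    Measurable fun v => M (f v) *ᵥ w v := by
  have h : Continuous fun y : ℝ × (Fin n → ℝ) => M y.1 *ᵥ y.2 :=
    (hM.comp continuous_fst).matrix_mulVec continuous_snd
  exact h.measurable.comp (hf.prodMk hw)

theorem IsNoise.measurable_comp (hZ : IsNoise μ Z) {α : Type*} [MeasurableSpace α] {f : α → ℝ}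
    {g : α → Ω} (hf : Measurable f) (hg : Measurable g) : Measurable fun x => Z (f x) (g x) :=
  hZ.measurable.comp (hf.prodMk hg)

theorem IsNoise.integral_norm_mulVec_sub_le (hZ : IsNoise μ Z) (S : Matrix κ (Fin n) ℝ) (a b : ℝ) :
    ∫ ω, ‖S *ᵥ (Z a ω - Z b ω)‖ ∂μ ≤ ‖S‖ * incrNorm μ Z (a - b) := by
  rw [← hZ.integral_norm_sub, ← integral_const_mul]
  exact integral_mono (integrable_mulVec S (hZ.integrable_sub a b)).norm
    ((hZ.integrable_sub a b).norm.const_mul _) fun ω => Matrix.linfty_opNorm_mulVec _ _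

theorem IsNoise.integrable_prod_mulVec_sub (hZ : IsNoise μ Z) {M : ℝ → Matrix κ (Fin n) ℝ}
    (hM : Continuous M) {a b : ℝ → ℝ} (ha : Measurable a) (hb : Measurable b) {ν : Measure ℝ}
    [SFinite ν] (hν : Integrable (fun r => ‖M r‖ * (1 + |a r - b r|)) ν) :
    Integrable (Function.uncurry fun r ω => M r *ᵥ (Z (a r) ω - Z (b r) ω)) (ν.prod μ) := by
  have hmeas : Measurable (Function.uncurry fun r ω => M r *ᵥ (Z (a r) ω - Z (b r) ω)) :=
    measurable_mulVec hM measurable_fst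
      ((hZ.measurable_comp (ha.comp measurable_fst) measurable_snd).sub
        (hZ.measurable_comp (hb.comp measurable_fst) measurable_snd))
  obtain ⟨C, hC, hCr⟩ := hZ.exists_incrNorm_le
  have hω : ∀ r, Integrable (fun ω => M r *ᵥ (Z (a r) ω - Z (b r) ω)) μ := fun r =>
    integrable_mulVec (M r) (hZ.integrable_sub (a r) (b r))
  refine (integrable_prod_iff hmeas.aestronglyMeasurable).2 ⟨Eventually.of_forall hω, ?_⟩
  refine (hν.const_mul C).mono' hmeas.aestronglyMeasurable.norm.integral_prod_right'
    (Eventually.of_forall fun r => ?_)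
  rw [Real.norm_of_nonneg (integral_nonneg fun ω => norm_nonneg _)]
  refine (hZ.integral_norm_mulVec_sub_le (M r) (a r) (b r)).trans ?_
  rw [mul_left_comm]
  exact mul_le_mul_of_nonneg_left (hCr _) (norm_nonneg _)

theorem aestronglyMeasurable_sub_pastIncrSigma {s a b : ℝ} (ha : a ≤ s) (hb : b ≤ s) :
    AEStronglyMeasurable[pastIncrSigma Z s] (fun ω => Z a ω - Z b ω) μ := by
  have h : ∀ r ≤ s, AEStronglyMeasurable[pastIncrSigma Z s] (fun ω => Z s ω - Z r ω) μ := by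
    intro r hr
    rcases hr.lt_or_eq with hr | rfl
    · exact ((comap_measurable _).mono (le_iSup (fun r : Set.Iio s =>
        MeasurableSpace.comap (fun ω => Z s ω - Z r ω) inferInstance) ⟨r, hr⟩)
        le_rfl).stronglyMeasurable.aestronglyMeasurable
    · simp only [sub_self]
      exact aestronglyMeasurable_const
  refine ((h b hb).sub (h a ha)).congr (Eventually.of_forall fun ω => ?_)
  simp

/-- The kernel of the state with respect to the increments of the noise. -/
def stateGain (p : ℕ) (P Q : (Matrix (Fin n) (Fin n) ℝ)[X]) (r : ℝ) :
    Matrix (Fin p × Fin n) (Fin n) ℝ := expm (matA p P) r * (matA p P * matE p P Q)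

theorem continuous_stateGain : Continuous (stateGain p P Q) :=
  (continuous_expm _).matrix_mul continuous_const

theorem state_eq_integral (z : ℝ → Fin n → ℝ) (v : ℝ) :
    state p P Q z v = ∫ r in Set.Ioi (0 : ℝ), stateGain p P Q r *ᵥ (z (v - r) - z v) := by
  simp only [state, statePath, stateGain, ← Matrix.mulVec_mulVec, Matrix.mulVec_sub]

theorem integrableOn_stateGain (hδ : 0 < δ)
    (hA : ∀ t, 0 ≤ t → ‖expm (matA p P) t‖ ≤ K * Real.exp (-(δ * t))) :
    IntegrableOn (fun r => ‖stateGain p P Q r‖ * (1 + |r|)) (Set.Ioi 0) := by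
  refine ((integrable_exp_neg_mul_abs_mul hδ).const_mul
    (K * ‖matA p P * matE p P Q‖)).integrableOn.mono' ?_ ?_
  · exact ((continuous_stateGain.norm).mul (by fun_prop)).aestronglyMeasurable
  · refine (ae_restrict_mem measurableSet_Ioi).mono fun r hr => ?_
    rw [norm_mul, norm_norm, Real.norm_of_nonneg (by positivity : 0 ≤ 1 + |r|), ← mul_assoc,
      mul_right_comm K]
    refine mul_le_mul_of_nonneg_right ((Matrix.linfty_opNorm_mul _ _).trans ?_) (by positivity)
    refine mul_le_mul_of_nonneg_right ?_ (norm_nonneg _)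
    rw [abs_of_pos hr]
    exact hA r (le_of_lt hr)

theorem IsNoise.measurable_state (hZ : IsNoise μ Z) :
    Measurable (Function.uncurry fun v ω => state p P Q (fun u => Z u ω) v) := by
  simp only [state_eq_integral]
  refine StronglyMeasurable.measurable ?_
  refine StronglyMeasurable.integral_prod_right (ν := volume.restrict (Set.Ioi (0 : ℝ)))
    (f := fun (y : ℝ × Ω) r => stateGain p P Q r *ᵥ (Z (y.1 - r) y.2 - Z y.1 y.2)) ?_
  refine Measurable.stronglyMeasurable ?_
  exact measurable_mulVec continuous_stateGain measurable_snd
    ((hZ.measurable_comp ((measurable_fst.comp measurable_fst).sub measurable_snd)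
      (measurable_snd.comp measurable_fst)).sub
      (hZ.measurable_comp (measurable_fst.comp measurable_fst) (measurable_snd.comp measurable_fst)))

theorem IsNoise.integrable_prod_stateGain (hZ : IsNoise μ Z) (hδ : 0 < δ)
    (hA : ∀ t, 0 ≤ t → ‖expm (matA p P) t‖ ≤ K * Real.exp (-(δ * t))) (v : ℝ) :
    Integrable (Function.uncurry fun r ω => stateGain p P Q r *ᵥ (Z (v - r) ω - Z v ω))
      ((volume.restrict (Set.Ioi 0)).prod μ) := by
  refine hZ.integrable_prod_mulVec_sub continuous_stateGain (a := fun r => v - r) (b := fun _ => v)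
    (by fun_prop) (by fun_prop) ?_
  have h := integrableOn_stateGain (P := P) (Q := Q) hδ hA
  simpa [IntegrableOn] using h

theorem IsNoise.integrable_state (hZ : IsNoise μ Z) (hδ : 0 < δ)
    (hA : ∀ t, 0 ≤ t → ‖expm (matA p P) t‖ ≤ K * Real.exp (-(δ * t))) (v : ℝ) :
    Integrable (fun ω => state p P Q (fun u => Z u ω) v) μ := by
  simp only [state_eq_integral]
  exact (hZ.integrable_prod_stateGain hδ hA v).integral_prod_right

/-- The state is an integral of increments ending at `v`, whose moments do not depend on `v`; so the
bound is uniform although `Z` itself may grow. -/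
theorem IsNoise.exists_integral_norm_state_le (hZ : IsNoise μ Z) (hδ : 0 < δ)
    (hA : ∀ t, 0 ≤ t → ‖expm (matA p P) t‖ ≤ K * Real.exp (-(δ * t))) :
    ∃ C, ∀ v, ∫ ω, ‖state p P Q (fun u => Z u ω) v‖ ∂μ ≤ C := by
  obtain ⟨C, hC, hCr⟩ := hZ.exists_incrNorm_le
  have hint := (integrableOn_stateGain (P := P) (Q := Q) hδ hA).const_mul C
  refine ⟨∫ r in Set.Ioi (0 : ℝ), C * (‖stateGain p P Q r‖ * (1 + |r|)), fun v => ?_⟩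
  have h := hZ.integrable_prod_stateGain (Q := Q) hδ hA v
  calc ∫ ω, ‖state p P Q (fun u => Z u ω) v‖ ∂μ
      ≤ ∫ ω, (∫ r in Set.Ioi (0 : ℝ), ‖stateGain p P Q r *ᵥ (Z (v - r) ω - Z v ω)‖) ∂μ := by
        refine integral_mono (hZ.integrable_state hδ hA v).norm h.norm.integral_prod_right
          fun ω => ?_
        simp only [state_eq_integral]
        exact norm_integral_le_integral_norm _
    _ = ∫ r in Set.Ioi (0 : ℝ), ∫ ω, ‖stateGain p P Q r *ᵥ (Z (v - r) ω - Z v ω)‖ ∂μ :=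
        (integral_integral_swap (f := fun (r : ℝ) ω => ‖stateGain p P Q r *ᵥ (Z (v - r) ω - Z v ω)‖)
          h.norm).symm
    _ ≤ _ := by
        refine integral_mono h.norm.integral_prod_left hint fun r => ?_
        refine (hZ.integral_norm_mulVec_sub_le _ _ _).trans ?_
        rw [sub_sub_cancel_left, hZ.incrNorm_neg, mul_left_comm]
        exact mul_le_mul_of_nonneg_left (hCr _) (norm_nonneg _)

theorem IsNoise.integrable_prod_mulVec_state (hZ : IsNoise μ Z) (hδ : 0 < δ)
    (hA : ∀ t, 0 ≤ t → ‖expm (matA p P) t‖ ≤ K * Real.exp (-(δ * t)))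
    {M : ℝ → Matrix κ (Fin p × Fin n) ℝ} (hM : Continuous M) {ν : Measure ℝ} [SFinite ν]
    (hν : Integrable (fun v => ‖M v‖) ν) :
    Integrable (Function.uncurry fun v ω => M v *ᵥ state p P Q (fun u => Z u ω) v) (ν.prod μ) := by
  have hmeas : AEStronglyMeasurable
      (Function.uncurry fun v ω => M v *ᵥ state p P Q (fun u => Z u ω) v) (ν.prod μ) :=
    aestronglyMeasurable_mulVec hM measurable_fst hZ.measurable_state.aestronglyMeasurable
  obtain ⟨C, hC⟩ := hZ.exists_integral_norm_state_le (Q := Q) hδ hA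
  refine (integrable_prod_iff hmeas).2
    ⟨Eventually.of_forall fun r => integrable_mulVec (M r) (hZ.integrable_state hδ hA r), ?_⟩
  refine (hν.mul_const C).mono' hmeas.norm.integral_prod_right' (Eventually.of_forall fun v => ?_)
  rw [Real.norm_of_nonneg (integral_nonneg fun ω => norm_nonneg _)]
  refine le_trans ?_ (mul_le_mul_of_nonneg_left (hC v) (norm_nonneg _))
  rw [← integral_const_mul]
  exact integral_mono (integrable_mulVec (M v) (hZ.integrable_state hδ hA v)).norm
    ((hZ.integrable_state hδ hA v).norm.const_mul _) fun ω => Matrix.linfty_opNorm_mulVec _ _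

theorem aestronglyMeasurable_const_mulVec {m : MeasurableSpace Ω} {ι : Type*} [Fintype ι]
    (S : Matrix κ ι ℝ) {f : Ω → ι → ℝ} (hf : AEStronglyMeasurable[m] f μ) :
    AEStronglyMeasurable[m] (fun ω => S *ᵥ f ω) μ :=
  (mulVecCLM S).continuous.comp_aestronglyMeasurable hf

/-- The state is a function of the past increments of the noise. -/
theorem IsNoise.aestronglyMeasurable_state (hZ : IsNoise μ Z) (hδ : 0 < δ)
    (hA : ∀ t, 0 ≤ t → ‖expm (matA p P) t‖ ≤ K * Real.exp (-(δ * t))) {s v : ℝ} (hv : v ≤ s) :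
    AEStronglyMeasurable[pastIncrSigma Z s] (fun ω => state p P Q (fun u => Z u ω) v) μ := by
  simp only [state_eq_integral]
  refine aestronglyMeasurable_integral_of_forall (hZ.pastIncrSigma_le s)
    (hZ.integrable_prod_stateGain hδ hA v) ((ae_restrict_mem measurableSet_Ioi).mono fun r hr => ?_)
  exact aestronglyMeasurable_const_mulVec _
    (aestronglyMeasurable_sub_pastIncrSigma (by linarith [Set.mem_Ioi.1 hr]) hv)

end StateProcess

/-! ### The past of the process and the past of the noise -/

section PastInformation

open Filter Topology

set_option linter.unusedSectionVars false

attribute [local instance] Matrix.linftyOpNormedAddCommGroup Matrix.linftyOpNormedSpace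
  Matrix.linftyOpNormedRing Matrix.linftyOpNormedAlgebra

theorem exp_rate_mono {f : ℝ → ℝ} {K K' δ δ' : ℝ} (hK : 0 ≤ K') (hKK' : K ≤ K') (hδ : δ' ≤ δ)
    (h : ∀ t, 0 ≤ t → f t ≤ K * Real.exp (-(δ * t))) :
    ∀ t, 0 ≤ t → f t ≤ K' * Real.exp (-(δ' * t)) := fun t ht =>
  (h t ht).trans (mul_le_mul hKK' (Real.exp_le_exp.2 (by nlinarith)) (Real.exp_nonneg _) hK)

variable {Ω : Type*} {m0 : MeasurableSpace Ω} {μ : Measure Ω} [IsProbabilityMeasure μ]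
  {n p q : ℕ} {P Q : (Matrix (Fin n) (Fin n) ℝ)[X]} {X Z : ℝ → Ω → (Fin n → ℝ)} {K ε : ℝ}

/-- The rate is written as `2 * ε` so that half of it can be spent on tempered paths, as
`integral_expm_mulVec_statePath` requires. -/
theorem exists_common_rate (hP : P.Monic) (hp : P.natDegree = p) (hQ : Q.Monic)
    (hq : Q.natDegree = q) (hPdet : ∀ z : ℂ, 0 ≤ z.re → (matEval P z).det ≠ 0)
    (hQdet : ∀ z : ℂ, 0 ≤ z.re → (matEval Q z).det ≠ 0) :
    ∃ K ε : ℝ, 0 ≤ K ∧ 0 < ε ∧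
      (∀ t, 0 ≤ t → ‖expm (matA p P) t‖ ≤ K * Real.exp (-(2 * ε * t))) ∧
      ∀ t, 0 ≤ t → ‖expm (companion q Q) t‖ ≤ K * Real.exp (-(2 * ε * t)) := by
  obtain ⟨K₁, δ₁, hK₁, hδ₁, h₁⟩ := exists_norm_expm_companion_le hP hp hPdet
  obtain ⟨K₂, δ₂, hK₂, hδ₂, h₂⟩ := exists_norm_expm_companion_le hQ hq hQdet
  have hK : 0 ≤ max K₁ K₂ := hK₁.le.trans (le_max_left _ _)
  refine ⟨max K₁ K₂, min δ₁ δ₂ / 2, hK, by positivity, ?_, ?_⟩ <;> rw [mul_div_cancel₀ _ two_ne_zero]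
  · exact exp_rate_mono hK (le_max_left _ _) (min_le_left _ _) h₁
  · exact exp_rate_mono hK (le_max_right _ _) (min_le_right _ _) h₂

theorem matGamma_mulVec_state (z : ℝ → Fin n → ℝ) (v : ℝ) :
    matGamma p q P Q *ᵥ state p P Q z v =
      ∑ k ∈ Finset.range (p - q), (polyR P Q).coeff (k + 1) *ᵥ outputDeriv p P Q k z v := by
  simp only [matGamma, Matrix.sum_mulVec, outputDeriv, Matrix.mulVec_mulVec]

theorem outputDeriv_zero (z : ℝ → Fin n → ℝ) (v : ℝ) :
    outputDeriv p P Q 0 z v = firstBlock n p *ᵥ state p P Q z v := by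
  rw [outputDeriv, pow_zero, Matrix.mul_one]

variable [Nontrivial (Matrix (Fin n) (Fin n) ℝ)]

/-- The increments of the noise are recovered from the state. -/
theorem Tempered.sub_eq_state (hP : P.Monic) (hp : P.natDegree = p) (hQ : Q.Monic)
    (hq : Q.natDegree = q) (hqp : q < p) (hε : 0 < ε)
    (hA : ∀ t, 0 ≤ t → ‖expm (matA p P) t‖ ≤ K * Real.exp (-(ε * t))) {z : ℝ → Fin n → ℝ}
    (hz : Tempered ε z) {r s : ℝ} (hrs : r ≤ s) :
    z s - z r = matGamma p q P Q *ᵥ state p P Q z s - matGamma p q P Q *ᵥ state p P Q z r -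
      ∫ v in Set.Ioc r s, (firstBlock n q * matL p q P Q - (polyR P Q).coeff 0 * firstBlock n p) *ᵥ
        state p P Q z v := by
  have hy := hz.mulVec (matE p P Q)
  obtain ⟨h1, h2⟩ := filtered_eq_add_integral hε hA hy r s
  -- `Γ E = 1` isolates the noise; the remainder is `Γ A` applied to `filtered`, whose increments
  -- are integrals of the state.
  have h3 : ∀ v, matGamma p q P Q *ᵥ state p P Q z v = z v +
      (firstBlock n q * matL p q P Q - (polyR P Q).coeff 0 * firstBlock n p) *ᵥ
        filtered (matA p P) (fun u => matE p P Q *ᵥ z u) v := by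
    intro v
    rw [state, statePath_eq hε hA hy v, Matrix.mulVec_add, Matrix.mulVec_mulVec,
      Matrix.mulVec_mulVec, matGamma_mul_matE hP hp hQ hq hqp, matGamma_mul_matA hP hp hQ hq hqp,
      Matrix.one_mulVec]
  rw [h3, h3, h2, Matrix.mulVec_add, intervalIntegral.integral_of_le hrs]
  simp only [state]
  rw [mulVec_integral _ ((intervalIntegrable_iff_integrableOn_Ioc_of_le hrs).1 h1)]
  abel

/-- The state of the whitening filter is a function of the past of the output. -/
theorem Tempered.matL_mulVec_state (hP : P.Monic) (hp : P.natDegree = p) (hQ : Q.Monic)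
    (hq : Q.natDegree = q) (hqp : q < p) (hε : 0 < ε)
    (hA : ∀ t, 0 ≤ t → ‖expm (matA p P) t‖ ≤ K * Real.exp (-(2 * ε * t)))
    (hB : ∀ t, 0 ≤ t → ‖expm (companion q Q) t‖ ≤ K * Real.exp (-(2 * ε * t)))
    {z : ℝ → Fin n → ℝ} (hz : Tempered ε z) (v : ℝ) :
    IntegrableOn (fun w => expm (companion q Q) (v - w) *ᵥ (inputBlocks q Q (remPoly P Q) *ᵥ
      (firstBlock n p *ᵥ state p P Q z w))) (Set.Iic v) ∧
    ∫ w in Set.Iic v, expm (companion q Q) (v - w) *ᵥ (inputBlocks q Q (remPoly P Q) *ᵥ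
      (firstBlock n p *ᵥ state p P Q z w)) = matL p q P Q *ᵥ state p P Q z v := by
  have h := integral_expm_mulVec_statePath hε hA hB (matL_mul_matA hP hp hQ hq hqp)
    (hz.mulVec (matE p P Q)) (fun u => by
      rw [Matrix.mulVec_mulVec, matL_mul_matE hP hp hQ hq hqp, Matrix.zero_mulVec]) v
  simpa only [state, Matrix.mulVec_mulVec] using h

theorem IsNoise.aestronglyMeasurable_output (hP : P.Monic) (hp : P.natDegree = p) (hQ : Q.Monic)
    (hq : Q.natDegree = q) (hqp : q < p) (hPdet : ∀ z : ℂ, 0 ≤ z.re → (matEval P z).det ≠ 0)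
    (hZ : IsNoise μ Z) {I : Fin n → (ℝ → ℝ) → Ω → ℝ}
    (hI : ∀ k, IsRegularIntegrator μ (fun t ω => Z t ω k) (I k)) (hX : IsMCARMA μ P Q I X)
    {s v : ℝ} (hv : v ≤ s) : AEStronglyMeasurable[pastSigma X s]
      (fun ω => firstBlock n p *ᵥ state p P Q (fun u => Z u ω) v) μ := by
  have h := (hX.isDerivFamily hP hp hQ hq hqp hPdet hZ hI).aestronglyMeasurable
    (j := 0) (by omega) hv
  simpa only [outputDeriv_zero] using h

/-- By `Tempered.matL_mulVec_state` this part of the state is a convergent integral of outputs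
before `v`; stability of `Q` enters here. -/
theorem IsNoise.aestronglyMeasurable_matL_state (hP : P.Monic) (hp : P.natDegree = p)
    (hQ : Q.Monic) (hq : Q.natDegree = q) (hqp : q < p)
    (hPdet : ∀ z : ℂ, 0 ≤ z.re → (matEval P z).det ≠ 0)
    (hQdet : ∀ z : ℂ, 0 ≤ z.re → (matEval Q z).det ≠ 0)
    (hZ : IsNoise μ Z) {I : Fin n → (ℝ → ℝ) → Ω → ℝ}
    (hI : ∀ k, IsRegularIntegrator μ (fun t ω => Z t ω k) (I k)) (hX : IsMCARMA μ P Q I X)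
    {s v : ℝ} (hv : v ≤ s) : AEStronglyMeasurable[pastSigma X s]
      (fun ω => matL p q P Q *ᵥ state p P Q (fun u => Z u ω) v) μ := by
  obtain ⟨K, ε, hK, hε, hA, hB⟩ := exists_common_rate hP hp hQ hq hPdet hQdet
  have hae : (fun ω => ∫ w in Set.Iic v, expm (companion q Q) (v - w) *ᵥ
      (inputBlocks q Q (remPoly P Q) *ᵥ (firstBlock n p *ᵥ state p P Q (fun u => Z u ω) w))) =ᵐ[μ]
      fun ω => matL p q P Q *ᵥ state p P Q (fun u => Z u ω) v := by
    filter_upwards [hZ.ae_tempered hε] with ω hω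
    exact (hω.matL_mulVec_state hP hp hQ hq hqp hε hA hB v).2
  refine AEStronglyMeasurable.congr ?_ hae
  refine aestronglyMeasurable_integral_of_forall (pastSigma_le (fun _ => hX.1.of_uncurry_left) s) ?_
    ((ae_restrict_mem measurableSet_Iic).mono fun w hw => aestronglyMeasurable_const_mulVec _
      (aestronglyMeasurable_const_mulVec _ (hZ.aestronglyMeasurable_output hP hp hQ hq hqp hPdet hI
        hX (le_trans hw hv))))
  simp only [Matrix.mulVec_mulVec]
  refine hZ.integrable_prod_mulVec_state (δ := 2 * ε) (by positivity) hA
    (M := fun w => expm (companion q Q) (v - w) *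
      (inputBlocks q Q (remPoly P Q) * firstBlock n p)) ?_ ?_
  · exact ((continuous_expm _).comp (continuous_const.sub continuous_id)).matrix_mul
      continuous_const
  · refine (((integrableOn_exp_mul_Iic (a := 2 * ε) (by positivity) v).const_mul
      (K * Real.exp (-(2 * ε * v)) * ‖inputBlocks q Q (remPoly P Q) * firstBlock n p‖))).mono' ?_ ?_
    · exact (((continuous_expm _).comp (continuous_const.sub continuous_id)).matrix_mul
        continuous_const).norm.aestronglyMeasurable
    · refine (ae_restrict_mem measurableSet_Iic).mono fun w hw => ?_
      rw [norm_norm]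
      refine (Matrix.linfty_opNorm_mul _ _).trans ?_
      rw [mul_right_comm, mul_assoc K, ← Real.exp_add]
      refine mul_le_mul_of_nonneg_right ?_ (norm_nonneg _)
      refine (hB _ (sub_nonneg.2 hw)).trans (le_of_eq ?_)
      ring_nf

/-- The past of the process is a function of the past increments of the noise. -/
theorem IsNoise.pastSigma_le_eventuallyMeasurableSpace (hP : P.Monic) (hp : P.natDegree = p)
    (hQ : Q.Monic) (hq : Q.natDegree = q) (hqp : q < p)
    (hPdet : ∀ z : ℂ, 0 ≤ z.re → (matEval P z).det ≠ 0)
    (hZ : IsNoise μ Z) {I : Fin n → (ℝ → ℝ) → Ω → ℝ}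
    (hI : ∀ k, IsRegularIntegrator μ (fun t ω => Z t ω k) (I k)) (hX : IsMCARMA μ P Q I X)
    (s : ℝ) : pastSigma X s ≤ eventuallyMeasurableSpace (pastIncrSigma Z s) (ae μ) := by
  obtain ⟨K, δ, -, hδ, hA⟩ := exists_norm_expm_companion_le hP hp hPdet
  refine iSup_le fun u => comap_le_eventuallyMeasurableSpace ?_
  exact (aestronglyMeasurable_const_mulVec (firstBlock n p)
    (hZ.aestronglyMeasurable_state (Q := Q) hδ hA u.2)).congr
    (hX.ae_eq_statePath hP hp hQ hq hqp hPdet hZ hI u).symm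

/-- The past increments of the noise are functions of the past of the process. -/
theorem IsNoise.pastIncrSigma_le_eventuallyMeasurableSpace (hP : P.Monic) (hp : P.natDegree = p)
    (hQ : Q.Monic) (hq : Q.natDegree = q) (hqp : q < p)
    (hPdet : ∀ z : ℂ, 0 ≤ z.re → (matEval P z).det ≠ 0)
    (hQdet : ∀ z : ℂ, 0 ≤ z.re → (matEval Q z).det ≠ 0)
    (hZ : IsNoise μ Z) {I : Fin n → (ℝ → ℝ) → Ω → ℝ}
    (hI : ∀ k, IsRegularIntegrator μ (fun t ω => Z t ω k) (I k)) (hX : IsMCARMA μ P Q I X)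
    (s : ℝ) : pastIncrSigma Z s ≤ eventuallyMeasurableSpace (pastSigma X s) (ae μ) := by
  obtain ⟨K, δ, -, hδ, hA⟩ := exists_norm_expm_companion_le hP hp hPdet
  refine iSup_le fun r => comap_le_eventuallyMeasurableSpace ?_
  -- `Γ` times the state is a combination of derivatives of `X`, which are limits of left difference
  -- quotients.
  have hΓ : ∀ v ≤ s, AEStronglyMeasurable[pastSigma X s]
      (fun ω => matGamma p q P Q *ᵥ state p P Q (fun u => Z u ω) v) μ := by
    intro v hv
    simp only [matGamma_mulVec_state]
    have hk : ∀ k ∈ Finset.range (p - q), AEStronglyMeasurable[pastSigma X s] (fun ω =>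
        (polyR P Q).coeff (k + 1) *ᵥ outputDeriv p P Q k (fun u => Z u ω) v) μ := fun k hk =>
      aestronglyMeasurable_const_mulVec _ ((hX.isDerivFamily hP hp hQ hq hqp hPdet hZ
        hI).aestronglyMeasurable (Finset.mem_range.1 hk) hv)
    have h := Finset.sum_induction _ (fun f : Ω → Fin n → ℝ =>
      AEStronglyMeasurable[pastSigma X s] f μ) (fun _ _ => AEStronglyMeasurable.add)
      aestronglyMeasurable_zero hk
    exact h.congr (Eventually.of_forall fun ω => Finset.sum_apply _ _ _)
  have hae : (fun ω => matGamma p q P Q *ᵥ state p P Q (fun u => Z u ω) s -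
      matGamma p q P Q *ᵥ state p P Q (fun u => Z u ω) r - ∫ v in Set.Ioc (r : ℝ) s,
        (firstBlock n q * matL p q P Q - (polyR P Q).coeff 0 * firstBlock n p) *ᵥ
          state p P Q (fun u => Z u ω) v) =ᵐ[μ] fun ω => Z s ω - Z r ω := by
    filter_upwards [hZ.ae_tempered hδ] with ω hω
    exact (hω.sub_eq_state hP hp hQ hq hqp hδ hA (le_of_lt r.2)).symm
  refine AEStronglyMeasurable.congr (((hΓ s le_rfl).sub (hΓ r (le_of_lt r.2))).sub ?_) hae
  refine aestronglyMeasurable_integral_of_forall (pastSigma_le (fun _ => hX.1.of_uncurry_left) s)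
    (hZ.integrable_prod_mulVec_state hδ hA continuous_const (integrable_const _))
    ((ae_restrict_mem measurableSet_Ioc).mono fun v hv => ?_)
  simp only [Matrix.sub_mulVec, ← Matrix.mulVec_mulVec]
  exact (aestronglyMeasurable_const_mulVec _ (hZ.aestronglyMeasurable_matL_state hP hp hQ hq hqp
    hPdet hQdet hI hX hv.2)).sub (aestronglyMeasurable_const_mulVec _
      (hZ.aestronglyMeasurable_output hP hp hQ hq hqp hPdet hI hX hv.2))

/-- Conditioning on the past of the process is conditioning on the past increments of the noise. -/
theorem IsNoise.condExp_pastSigma (hP : P.Monic) (hp : P.natDegree = p)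
    (hQ : Q.Monic) (hq : Q.natDegree = q) (hqp : q < p)
    (hPdet : ∀ z : ℂ, 0 ≤ z.re → (matEval P z).det ≠ 0)
    (hQdet : ∀ z : ℂ, 0 ≤ z.re → (matEval Q z).det ≠ 0)
    (hZ : IsNoise μ Z) {I : Fin n → (ℝ → ℝ) → Ω → ℝ}
    (hI : ∀ k, IsRegularIntegrator μ (fun t ω => Z t ω k) (I k)) (hX : IsMCARMA μ P Q I X)
    (s : ℝ) (f : Ω → Fin n → ℝ) : μ[f | pastSigma X s] =ᵐ[μ] μ[f | pastIncrSigma Z s] :=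
  condExp_eq_of_eventuallyMeasurableSpace (pastSigma_le (fun _ => hX.1.of_uncurry_left) s)
    (hZ.pastIncrSigma_le s)
    (hZ.pastSigma_le_eventuallyMeasurableSpace hP hp hQ hq hqp hPdet hI hX s)
    (hZ.pastIncrSigma_le_eventuallyMeasurableSpace hP hp hQ hq hqp hPdet hQdet hI hX s) f

end PastInformation

/-! ### Prediction -/

section Prediction

open Filter Topology

set_option linter.unusedSectionVars false

attribute [local instance] Matrix.linftyOpNormedAddCommGroup Matrix.linftyOpNormedSpace
  Matrix.linftyOpNormedRing Matrix.linftyOpNormedAlgebra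

variable {Ω : Type*} {m0 : MeasurableSpace Ω} {μ : Measure Ω} [IsProbabilityMeasure μ]
  {n p q : ℕ} {P Q : (Matrix (Fin n) (Fin n) ℝ)[X]} {X Z Zhat : ℝ → Ω → (Fin n → ℝ)} {K ε δ : ℝ}
  {s t : ℝ}

theorem IsNoise.integrable_prod_sub (hZ : IsNoise μ Z) (s t : ℝ) :
    Integrable (Function.uncurry fun u ω => Z u ω - Z s ω)
      ((volume.restrict (Set.Ioc s t)).prod μ) := by
  have h := hZ.integrable_prod_mulVec_sub (M := fun _ => (1 : Matrix (Fin n) (Fin n) ℝ))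
    continuous_const (a := fun u => u) (b := fun _ => s) (ν := volume.restrict (Set.Ioc s t))
    measurable_id measurable_const ?_
  · simpa only [Matrix.one_mulVec] using h
  · exact ((by fun_prop : Continuous fun r : ℝ =>
      ‖(1 : Matrix (Fin n) (Fin n) ℝ)‖ * (1 + |r - s|)).integrableOn_Icc).mono_set
        Set.Ioc_subset_Icc_self

theorem IsNoisePrediction.ae_integrableOn (hZ : IsNoise μ Z) (h : IsNoisePrediction μ Z s Zhat)
    (t : ℝ) : ∀ᵐ ω ∂μ, IntegrableOn (fun u => Zhat u ω) (Set.Ioc s t) :=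
  (condExp_integral (hZ.pastIncrSigma_le s) (hZ.integrable_prod_sub s t)
    h.1.aestronglyMeasurable ((ae_restrict_mem measurableSet_Ioc).mono fun u hu => h.2 u hu.1)
    ).1.prod_left_ae

theorem condExp_mulVec {m : MeasurableSpace Ω} {ι κ : Type*} [Fintype ι] [Fintype κ]
    (S : Matrix κ ι ℝ) {f : Ω → ι → ℝ} (hf : Integrable f μ) :
    μ[fun ω => S *ᵥ f ω | m] =ᵐ[μ] fun ω => S *ᵥ (μ[f | m]) ω :=
  ((mulVecCLM S).comp_condExp_comm hf).symm

theorem continuous_stateKernelDeriv_matrix : Continuous (stateKernelDeriv p P Q) :=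
  ((continuous_const.matrix_mul (continuous_expm _)).matrix_mul continuous_const).matrix_mul
    continuous_const

/-- The prediction of the future increments. -/
theorem IsNoisePrediction.condExp_integral_stateKernelDeriv (hZ : IsNoise μ Z)
    (h : IsNoisePrediction μ Z s Zhat) (t : ℝ) :
    Integrable (fun ω => ∫ u in Set.Ioc s t, stateKernelDeriv p P Q (t - u) *ᵥ (Z u ω - Z s ω)) μ ∧
    μ[fun ω => ∫ u in Set.Ioc s t, stateKernelDeriv p P Q (t - u) *ᵥ (Z u ω - Z s ω) |
        pastIncrSigma Z s] =ᵐ[μ]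
      fun ω => ∫ u in Set.Ioc s t, stateKernelDeriv p P Q (t - u) *ᵥ Zhat u ω := by
  have hcont : Continuous fun u => stateKernelDeriv p P Q (t - u) :=
    continuous_stateKernelDeriv_matrix.comp (continuous_const.sub continuous_id)
  have hY := hZ.integrable_prod_mulVec_sub hcont (a := fun u => u) (b := fun _ => s)
    (ν := volume.restrict (Set.Ioc s t)) measurable_id measurable_const
    (((hcont.norm.mul (by fun_prop : Continuous fun r : ℝ => 1 + |r - s|)).integrableOn_Icc).mono_set
        Set.Ioc_subset_Icc_self)
  refine ⟨hY.integral_prod_right, (condExp_integral (hZ.pastIncrSigma_le s) hY ?_ ?_).2⟩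
  · exact aestronglyMeasurable_mulVec (M := fun u => stateKernelDeriv p P Q (t - u)) hcont
      (f := Prod.fst) measurable_fst h.1.aestronglyMeasurable
  · refine (ae_restrict_mem measurableSet_Ioc).mono fun u hu => ?_
    filter_upwards [h.2 u hu.1, condExp_mulVec (m := pastIncrSigma Z s)
      (stateKernelDeriv p P Q (t - u)) (hZ.integrable_sub u s)] with ω h1 h2
    rw [h2, h1]

/-- Variation of constants from time `s`, with increments after `s` only, so that each term can be
conditioned separately. -/
theorem Tempered.output_eq (hε : 0 < ε)
    (hA : ∀ t, 0 ≤ t → ‖expm (matA p P) t‖ ≤ K * Real.exp (-(ε * t))) {z : ℝ → Fin n → ℝ}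
    (hz : Tempered ε z) (hst : s ≤ t) :
    firstBlock n p *ᵥ state p P Q z t =
      (firstBlock n p * expm (matA p P) (t - s)) *ᵥ state p P Q z s +
      (firstBlock n p * matE p P Q) *ᵥ (z t - z s) +
      ∫ u in Set.Ioc s t, stateKernelDeriv p P Q (t - u) *ᵥ (z u - z s) := by
  have hy := hz.mulVec (matE p P Q)
  have hint : IntegrableOn (fun u => expm (matA p P) (t - u) *ᵥ
      (matE p P Q *ᵥ z u - matE p P Q *ᵥ z s)) (Set.Ioc s t) := by
    refine integrableOn_mulVec_of_continuous
      ((continuous_expm _).comp (continuous_const.sub continuous_id)) ?_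
    exact (hy.integrableOn_Ioc hε.le s t).sub (integrable_const _)
  rw [state, statePath_eq_add hε hA hy hst, Matrix.mulVec_add, Matrix.mulVec_add,
    Matrix.mulVec_mulVec, Matrix.mulVec_mulVec, ← Matrix.mulVec_sub, Matrix.mulVec_mulVec,
    intervalIntegral.integral_of_le hst, ← mulVec_integral _ hint]
  congr 1
  refine integral_congr_ae (Eventually.of_forall fun u => ?_)
  simp only [← Matrix.mulVec_sub, Matrix.mulVec_mulVec, stateKernelDeriv]
  congr 1
  have h := expm_mul_comm (matA p P) (t - u)
  rw [Matrix.mul_assoc (firstBlock n p), ← Matrix.mul_assoc (matA p P), ← h]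
  simp only [Matrix.mul_assoc]
  rfl

variable [Nontrivial (Matrix (Fin n) (Fin n) ℝ)]

/-- In `Tempered.output_eq` the state at `s` is known from the past increments, and conditioning
passes through the matrix and through the integral over later times. -/
theorem condExp_output (hZ : IsNoise μ Z) (h : IsNoisePrediction μ Z s Zhat)
    (hP : P.Monic) (hp : P.natDegree = p)
    (hPdet : ∀ z : ℂ, 0 ≤ z.re → (matEval P z).det ≠ 0) (hst : s < t) :
    μ[fun ω => firstBlock n p *ᵥ state p P Q (fun u => Z u ω) t | pastIncrSigma Z s] =ᵐ[μ] fun ω =>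
      (firstBlock n p * expm (matA p P) (t - s)) *ᵥ state p P Q (fun u => Z u ω) s +
      (firstBlock n p * matE p P Q) *ᵥ Zhat t ω +
      ∫ u in Set.Ioc s t, stateKernelDeriv p P Q (t - u) *ᵥ Zhat u ω := by
  obtain ⟨K, δ, -, hδ, hA⟩ := exists_norm_expm_companion_le hP hp hPdet
  have hm := hZ.pastIncrSigma_le s
  set S₁ := firstBlock n p * expm (matA p P) (t - s)
  set S₂ := firstBlock n p * matE p P Q
  have hi1 : Integrable (fun ω => S₁ *ᵥ state p P Q (fun u => Z u ω) s) μ :=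
    integrable_mulVec _ (hZ.integrable_state hδ hA s)
  have hi2 : Integrable (fun ω => S₂ *ᵥ (Z t ω - Z s ω)) μ :=
    integrable_mulVec _ (hZ.integrable_sub t s)
  obtain ⟨hi3, hc3⟩ := h.condExp_integral_stateKernelDeriv (p := p) (P := P) (Q := Q) hZ t
  have hae : (fun ω => firstBlock n p *ᵥ state p P Q (fun u => Z u ω) t) =ᵐ[μ]
      (fun ω => S₁ *ᵥ state p P Q (fun u => Z u ω) s) + (fun ω => S₂ *ᵥ (Z t ω - Z s ω)) +
      fun ω => ∫ u in Set.Ioc s t, stateKernelDeriv p P Q (t - u) *ᵥ (Z u ω - Z s ω) := by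
    filter_upwards [hZ.ae_tempered hδ] with ω hω
    exact hω.output_eq hδ hA hst.le
  have hc1 : μ[fun ω => S₁ *ᵥ state p P Q (fun u => Z u ω) s | pastIncrSigma Z s] =ᵐ[μ]
      fun ω => S₁ *ᵥ state p P Q (fun u => Z u ω) s :=
    condExp_of_aestronglyMeasurable' hm (aestronglyMeasurable_const_mulVec _
      (hZ.aestronglyMeasurable_state hδ hA le_rfl)) hi1
  filter_upwards [condExp_congr_ae hae (m := pastIncrSigma Z s),
    condExp_add (hi1.add hi2) hi3 (pastIncrSigma Z s), condExp_add hi1 hi2 (pastIncrSigma Z s),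
    hc1, hc3, condExp_mulVec (m := pastIncrSigma Z s) S₂ (hZ.integrable_sub t s), h.2 t hst]
    with ω h1 h2 h3 h4 h5 h6 h7
  rw [h1, h2, Pi.add_apply, h3, Pi.add_apply, h4, h5, h6, h7]

/-- The contribution of the past of the process to the prediction. -/
theorem Tempered.firstBlock_mul_expm_mulVec_state (hP : P.Monic) (hp : P.natDegree = p)
    (hQ : Q.Monic) (hq : Q.natDegree = q) (hqp : q < p) (hε : 0 < ε)
    (hA : ∀ t, 0 ≤ t → ‖expm (matA p P) t‖ ≤ K * Real.exp (-(2 * ε * t)))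
    (hB : ∀ t, 0 ≤ t → ‖expm (companion q Q) t‖ ≤ K * Real.exp (-(2 * ε * t)))
    {z : ℝ → Fin n → ℝ} (hz : Tempered ε z) (hst : s ≤ t) {x : ℝ → Fin n → ℝ}
    (hx : ∀ᵐ v, x v = firstBlock n p *ᵥ state p P Q z v) :
    IntegrableOn (fun v => pastKernel p q P Q s t v *ᵥ x v) (Set.Iic s) ∧
    (firstBlock n p * expm (matA p P) (t - s)) *ᵥ state p P Q z s =
      (∑ j ∈ Finset.Icc 1 (p - q), gTildeJ p q P Q j (t - s) *ᵥ outputDeriv p P Q (j - 1) z s) +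
      ∫ v in Set.Iic s, pastKernel p q P Q s t v *ᵥ x v := by
  obtain ⟨h1, h2⟩ := hz.matL_mulVec_state hP hp hQ hq hqp hε hA hB s
  have hae : ∀ᵐ v ∂volume.restrict (Set.Iic s), matTheta p q P Q s t *ᵥ
      (expm (companion q Q) (s - v) *ᵥ (inputBlocks q Q (remPoly P Q) *ᵥ
        (firstBlock n p *ᵥ state p P Q z v))) = pastKernel p q P Q s t v *ᵥ x v := by
    filter_upwards [ae_restrict_mem measurableSet_Iic, ae_restrict_of_ae hx] with v hv hxv
    rw [pastKernel_eq hst hv, hxv]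
    simp only [Matrix.mulVec_mulVec, Matrix.mul_assoc]
  refine ⟨(integrable_mulVec _ h1).congr hae, ?_⟩
  rw [← integral_congr_ae hae, mulVec_integral _ h1, h2]
  -- The integral term carries `1 - S` and the derivative terms carry `S`; together they give the
  -- whole state at `s`.
  have h3 := matTheta_mul_matL hP hp hQ hq hqp s t
  have h4 := firstBlock_mul_expm_mul_matS (p := p) (q := q) (P := P) (Q := Q) (t - s)
  simp only [outputDeriv, Matrix.mulVec_mulVec, ← Matrix.sum_mulVec, ← Matrix.add_mulVec]
  rw [h3, ← h4, ← Matrix.mul_add, add_sub_cancel, Matrix.mul_one]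

/-- The representation holds almost surely at each time; joint measurability turns this into almost
all times on almost every path, as the integral over the past of `X` requires. -/
theorem IsMCARMA.ae_ae_eq_output (hP : P.Monic) (hp : P.natDegree = p) (hQ : Q.Monic)
    (hq : Q.natDegree = q) (hqp : q < p) (hPdet : ∀ z : ℂ, 0 ≤ z.re → (matEval P z).det ≠ 0)
    (hZ : IsNoise μ Z) {I : Fin n → (ℝ → ℝ) → Ω → ℝ}
    (hI : ∀ k, IsRegularIntegrator μ (fun t ω => Z t ω k) (I k)) (hX : IsMCARMA μ P Q I X) :
    ∀ᵐ ω ∂μ, ∀ᵐ v, X v ω = firstBlock n p *ᵥ state p P Q (fun u => Z u ω) v := by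
  have hmeas : MeasurableSet {y : ℝ × Ω |
      X y.1 y.2 = firstBlock n p *ᵥ state p P Q (fun u => Z u y.2) y.1} :=
    measurableSet_eq_fun hX.1
      ((mulVecCLM (firstBlock n p)).continuous.measurable.comp hZ.measurable_state)
  exact (Measure.ae_ae_comm (μ := (volume : Measure ℝ)) (ν := μ) (p := fun v ω =>
    X v ω = firstBlock n p *ᵥ state p P Q (fun u => Z u ω) v) hmeas).1
    (Eventually.of_forall fun v => hX.ae_eq_statePath hP hp hQ hq hqp hPdet hZ hI v)

end Prediction

end MCARMA

end

/-! ### The prediction theorem -/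

theorem mainTheorem4 {Ω : Type*} [MeasurableSpace Ω] (μ : Measure Ω) [IsProbabilityMeasure μ]
    {n p q : ℕ} (P Q : (Matrix (Fin n) (Fin n) ℝ)[X])
    (hP : P.Monic) (hp : P.natDegree = p) (hQ : Q.Monic) (hq : Q.natDegree = q) (hqp : q < p)
    (hPdet : ∀ z : ℂ, 0 ≤ z.re → (MCARMA.matEval P z).det ≠ 0)
    (hQdet : ∀ z : ℂ, 0 ≤ z.re → (MCARMA.matEval Q z).det ≠ 0)
    (Z : ℝ → Ω → (Fin n → ℝ)) (hZ : MCARMA.IsNoise μ Z)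
    (I : Fin n → (ℝ → ℝ) → Ω → ℝ)
    (hI : ∀ k, MCARMA.IsRegularIntegrator μ (fun t ω => Z t ω k) (I k))
    (X : ℝ → Ω → (Fin n → ℝ)) (hX : MCARMA.IsMCARMA μ P Q I X)
    (s t : ℝ) (hst : s < t) :
    -- the derivatives of order at most `p - q - 1` exist
    (∃ D, MCARMA.IsDerivFamily μ (p - q) X D) ∧
    -- the predicted noise has a measurable version
    (∃ Zhat, MCARMA.IsNoisePrediction μ Z s Zhat) ∧
    (∀ a b, BoundedVariationOn (fun u => MCARMA.gTilde p P Q u a b) Set.univ) ∧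
    ∀ D, MCARMA.IsDerivFamily μ (p - q) X D →
    ∀ Zhat, MCARMA.IsNoisePrediction μ Z s Zhat →
      (∀ᵐ ω ∂μ, IntegrableOn (fun v => MCARMA.pastKernel p q P Q s t v *ᵥ X v ω) (Set.Iic s)) ∧
      (∀ᵐ ω ∂μ, IntervalIntegrable (fun v => NormedSpace.exp ((-v) • MCARMA.matA p P) *ᵥ
        (MCARMA.matE p P Q *ᵥ Zhat v ω)) volume s t) ∧
      -- the prediction formula
      (μ[X t | MCARMA.pastSigma X s] =ᵐ[μ] fun ω =>
        (∑ j ∈ Finset.Icc 1 (p - q), MCARMA.gTildeJ p q P Q j (t - s) *ᵥ D (j - 1) s ω) +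
        (∫ v in Set.Iic s, MCARMA.pastKernel p q P Q s t v *ᵥ X v ω) +
        MCARMA.stieltjesConv (MCARMA.gTilde p P Q) (fun u => Zhat u ω) s t) ∧
      -- the explicit form of its last term
      (∀ᵐ ω ∂μ, MCARMA.stieltjesConv (MCARMA.gTilde p P Q) (fun u => Zhat u ω) s t =
        (if p = q + 1 then Zhat t ω else 0) +
        (MCARMA.firstBlock n p * MCARMA.matA p P * NormedSpace.exp (t • MCARMA.matA p P)) *ᵥ
          ∫ v in s..t, NormedSpace.exp ((-v) • MCARMA.matA p P) *ᵥ
            (MCARMA.matE p P Q *ᵥ Zhat v ω)) := by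
  have := MCARMA.nontrivial_of_natDegree hp hqp
  obtain ⟨K, ε, hK, hε, hA, hB⟩ := MCARMA.exists_common_rate hP hp hQ hq hPdet hQdet
  have hε2 : 0 < 2 * ε := by positivity
  have hDer := hX.isDerivFamily hP hp hQ hq hqp hPdet hZ hI
  refine ⟨⟨_, hDer⟩, hZ.exists_isNoisePrediction s,
    MCARMA.boundedVariationOn_gTilde hε2 hA, fun D hD Zhat hZhat => ?_⟩
  have hint := hZhat.ae_integrableOn hZ t
  have hpast : ∀ᵐ ω ∂μ,
      IntegrableOn (fun v => MCARMA.pastKernel p q P Q s t v *ᵥ X v ω) (Set.Iic s) ∧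
      (MCARMA.firstBlock n p * MCARMA.expm (MCARMA.matA p P) (t - s)) *ᵥ
          MCARMA.state p P Q (fun u => Z u ω) s =
        (∑ j ∈ Finset.Icc 1 (p - q), MCARMA.gTildeJ p q P Q j (t - s) *ᵥ
          MCARMA.outputDeriv p P Q (j - 1) (fun u => Z u ω) s) +
        ∫ v in Set.Iic s, MCARMA.pastKernel p q P Q s t v *ᵥ X v ω := by
    filter_upwards [hZ.ae_tempered hε, hX.ae_ae_eq_output hP hp hQ hq hqp hPdet hZ hI]
      with ω hω hx
    exact hω.firstBlock_mul_expm_mulVec_state hP hp hQ hq hqp hε hA hB hst.le hx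
  have hconv : ∀ᵐ ω ∂μ, MCARMA.stieltjesConv (MCARMA.gTilde p P Q) (fun u => Zhat u ω) s t =
      (MCARMA.firstBlock n p * MCARMA.matE p P Q) *ᵥ Zhat t ω +
      (MCARMA.firstBlock n p * MCARMA.matA p P * MCARMA.expm (MCARMA.matA p P) t) *ᵥ
        ∫ v in s..t, MCARMA.expm (MCARMA.matA p P) (-v) *ᵥ
          (MCARMA.matE p P Q *ᵥ Zhat v ω) := by
    filter_upwards [hint] with ω hω
    exact MCARMA.stieltjesConv_gTilde hε2 hA hZhat.1.of_uncurry_right hst hω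
  have hexp : ∀ᵐ ω ∂μ, IntegrableOn (fun v => MCARMA.expm (MCARMA.matA p P) (-v) *ᵥ
      (MCARMA.matE p P Q *ᵥ Zhat v ω)) (Set.Ioc s t) := by
    filter_upwards [hint] with ω hω
    exact MCARMA.integrableOn_mulVec_of_continuous
      ((MCARMA.continuous_expm _).comp continuous_neg) (MCARMA.integrable_mulVec _ hω)
  refine ⟨hpast.mono fun ω h => h.1,
    hexp.mono fun ω h => (intervalIntegrable_iff_integrableOn_Ioc_of_le hst.le).2 h, ?_, ?_⟩
  -- Any family of derivatives agrees almost surely at time `s` with the one read off the state, so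
  -- the formula need only be proved for the latter.
  · have hDs : ∀ᵐ ω ∂μ, ∀ j ∈ Finset.Icc 1 (p - q),
        D (j - 1) s ω = MCARMA.outputDeriv p P Q (j - 1) (fun u => Z u ω) s := by
      refine (Finset.eventually_all _).2 fun j hj => ?_
      have hj' := Finset.mem_Icc.1 hj
      exact hD.ae_eq hDer (by omega) s
    -- The conditioning is first moved from the past of `X` to the past increments of `Z`, where the
    -- prediction in terms of the state applies.
    filter_upwards [hZ.condExp_pastSigma hP hp hQ hq hqp hPdet hQdet hI hX s (X t),
      condExp_congr_ae (m := MCARMA.pastIncrSigma Z s)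
        (hX.ae_eq_statePath hP hp hQ hq hqp hPdet hZ hI t),
      MCARMA.condExp_output hZ hZhat hP hp hPdet hst (Q := Q), hpast, hconv, hexp, hDs]
      with ω h1 h2 h3 h4 h5 h6 h7
    rw [h1, h2]
    refine h3.trans ?_
    rw [h4.2, h5, intervalIntegral.integral_of_le hst.le, ← MCARMA.mulVec_integral _ h6,
      Finset.sum_congr rfl fun j hj => by rw [← h7 j hj]]
    simp only [MCARMA.stateKernelDeriv_sub_mulVec]
    abel
  · filter_upwards [hconv] with ω h
    rw [h, MCARMA.firstBlock_mul_matE hP hp hQ hq hqp]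
    split_ifs
    · rw [Matrix.one_mulVec]
    · rw [Matrix.zero_mulVec]
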